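/- **Setting.** Let $N\ge 2$. Let $\mathbb R^{N+1,1}$ have basis $e_1,\dots,e_{N+2}$ and Lorentz product $\langle u,v\rangle=\sum_{k\le N+1}u_kv_k-u_{N+2}v_{N+2}$; put $e_0=\tfrac12(e_{N+2}+e_{N+1})$, $e_\infty=\tfrac12(e_{N+2}-e_{N+1})$, and $\lambda(x)=x+e_0+|x|^2e_\infty$ for $x\in\mathbb R^N$. In the Clifford algebra with $uv+vu=-2\langle u,v\rangle$ let $\mathcal H_\infty$ be the group of products of vectors $u$ with $u^2=-1$, $\langle u,e_\infty\rangle=0$, and $A_\psi(v)=\psi^{-1}v\psi$. A pair of curves $(X,Y)$ *envelopes a circle congruence* if, at every parameter, $Y\ne X$, $\partial X\neq0\ne\partial Y$, $\partial Y-\partial X\in\mathrm{span}(\partial X,Y-X)$, $\big(\frac{\partial Y}{|\partial Y|}+\frac{\partial X}{|\partial X|}\big)\cdot(Y-X)=0$ and $\frac{\partial Y}{|\partial Y|}+\frac{\partial X}{|\partial X|}\ne0$. **Data.** Let $X:\mathbb R\to\mathbb R^N$ be a smooth curve with $\partial X(0)\neq0$, $A:\mathbb R\to\mathbb R$ a smooth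 function, and $X^+(0)\in\mathbb R^N$ a point with $X^+(0)\ne X(0)$ and $|\partial X(0)|+A(0)\,|X^+(0)-X(0)|>0$. Put $\hat X=\lambda\circ X$, $H_1=|\partial X|$, $\hat v_1=H_1^{-1}\partial\hat X$, $H_2(0)=|X^+(0)-X(0)|$, $\hat v_2(0)=H_2(0)^{-1}\big(\lambda(X^+(0))-\lambda(X(0))\big)$. Let $\Psi\in\mathcal H_\infty$ be suited to $(\hat X(0);\hat v_1(0))$, i.e. $A_\Psi(e_0)=\hat X(0)$, $A_\Psi(e_1)=\hat v_1(0)$; put $B_{k2}(0)=-2\langle\hat v_2(0),A_\Psi(e_k)\rangle$ for $k\ne2$ and assume $\sum_{k\neq 2}B_{k2}(0)^2<4$ (equivalently $\langle \hat v_2(0),A_\Psi(e_2)\rangle\ne0$). Let $s$ be the sign of $\langle \hat v_2(0),A_\Psi(e_2)\rangle$. **Claim.** For some $r>0$: 1. There is a unique curve $X^+:[0,r]\to\mathbb R^N$ through the given point $X^+(0)$ such that $(X,X^+)$ envelopes a circle congruence and $$|\partial X^+|-|\partial X|=A\cdot|X^+-X|\quad\text{on }[0,r];$$ it is smooth, and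 unique even among $C^1$ curves. 2. On $[0,r]$ the rotation coefficients $B_{k1}$ ($k\ne1$) can be read off $X$: there are vector fields $\hat v_k$, $k\neq1$, with $\hat v_k(0)=A_\Psi(e_k)$, $\partial\hat v_k=B_{k1}\hat v_1$, $B_{k1}=-\langle\hat v_k,\partial\hat v_1\rangle$. There is $\varepsilon_*>0$ such that for $0<\varepsilon<\varepsilon_*$ the following discrete Goursat problem has a unique solution on $B^\varepsilon(r)=(\varepsilon\mathbb Z\cap[0,r])\times\{0,1\}$. Unknowns: $\psi\in\mathcal H_\infty$, $h_1$, $\beta_{k1}$ $(k\ne1)$ on $B^\varepsilon(r)$, and $h_2$, $\beta_{k2}$ $(k\neq2)$, $\alpha$ on the line $\xi_2=0$. Equations, for $\{i,j\}=\{1,2\}$, $\varepsilon_1$ and $\varepsilon_2$ denoting the mesh sizes $\varepsilon$ and $1$, with $\delta_i u=(u(\xi+\varepsilon_i \mathbf e_i)-u(\xi))/\varepsilon_i$ ($\mathbf e_i$ the $i$th unit vector of the parameter plane): $$\delta_i\psi=\Big(\tfrac{N_i-1}{\varepsilon_i}-\tfrac12\sum_{k\ne i}\beta_{ki}e_ke_i+h_ie_\infty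 e_i\Big)\psi,\qquad \delta_ih_j=\tfrac{\rho_{ij}}{\varepsilon_jn}h_i+\tfrac{1-n}{\varepsilon_in}h_j,$$ $$\delta_i\beta_{ij}=\tfrac{2N_i\rho_{ij}}{\varepsilon_i\varepsilon_jn}-\tfrac{1+n}{\varepsilon_in}\beta_{ij},\qquad \delta_i\beta_{kj}=\tfrac{1-n}{\varepsilon_in}\beta_{kj}+\tfrac{\rho_{ij}}{\varepsilon_jn}\beta_{ki}\ (k>2),$$ where they involve only the unknowns listed, with $\rho_{21}=\varepsilon\alpha$, $\rho_{12}=N_1\beta_{12}+\varepsilon(N_2\beta_{21}-\Theta-\alpha)$, $\Theta=\frac12\sum_{k>2}\beta_{k1}\beta_{k2}$, $n=\sqrt{1-\rho_{12}\rho_{21}}$, $N_1=\big(1-\tfrac{\varepsilon^2}4\sum_{k\ne1}\beta_{k1}^2\big)^{1/2}$, $N_2=s\big(1-\tfrac14\sum_{k\ne2}\beta_{k2}^2\big)^{1/2}$, all radicands being positive. Data: $\psi(0)=\Psi$; $h_1=H_1$, $\beta_{k1}=B_{k1}$, $\alpha=A$ at the points of $\varepsilon\mathbb Z\cap[0,r]$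 on the line $\xi_2=0$; $h_2(0)=H_2(0)$, $\beta_{k2}(0)=B_{k2}(0)$. Let $X^\varepsilon,(X^\varepsilon)^+:\varepsilon\mathbb Z\cap[0,r]\to\mathbb R^N$ be the points with $\lambda$-lift $A_\psi(e_0)$ on the lines $\xi_2=0$ and $\xi_2=1$. Then $X^\varepsilon\to X$ and $(X^\varepsilon)^+\to X^+$ with rate $O(\varepsilon)$ in $C^\infty$: for every $\ell\ge0$ there is $K_\ell$ such that for all $0<\varepsilon<\varepsilon_*$ with $\ell\varepsilon<r$, all difference quotients (of mesh $\varepsilon$) of order at most $\ell$ of $X^\varepsilon-X$ and $(X^\varepsilon)^+-X^+$ on $\varepsilon\mathbb Z\cap[0,r]$ are bounded in norm by $K_\ell\varepsilon$. -/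

import Mathlib

open Set
open scoped ContDiff

noncomputable section

namespace RibPair

/-- Euclidean space `ℝ^N` with `N = n + 2`. Coordinate directions are indexed by `Fin (n + 2)`;
the index `0` is the direction of the curve parameter (direction 1 in the usual numbering) and the
index `1` is the direction of the transformation (direction 2). -/
abbrev E (n : ℕ) : Type := EuclideanSpace ℝ (Fin (n + 2))

/-- The space `ℝ^{N+1,1}`: the triple `(u, a, b)` stands for `u + a e_{N+1} + b e_{N+2}`. -/
abbrev Mink (n : ℕ) : Type := E n × ℝ × ℝ

/-- The Lorentz scalar product. -/
def lor (n : ℕ) : LinearMap.BilinForm ℝ (Mink n) :=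
  LinearMap.mk₂ ℝ (fun u v => inner ℝ u.1 v.1 + u.2.1 * v.2.1 - u.2.2 * v.2.2)
    (fun u u' v => by simp [inner_add_left]; ring)
    (fun c u v => by simp [inner_smul_left]; ring)
    (fun u v v' => by simp [inner_add_right]; ring)
    (fun c u v => by simp [inner_smul_right]; ring)

/-- The form `u ↦ -⟨u, u⟩`, so that `u v + v u = -2 ⟨u, v⟩` holds in its Clifford algebra. -/
def Q (n : ℕ) : QuadraticForm ℝ (Mink n) := -(lor n).toQuadraticMap

/-- The Clifford algebra `𝒞(N+1,1)`. -/
abbrev Cl (n : ℕ) : Type := CliffordAlgebra (Q n)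

/-- The embedding of vectors into the Clifford algebra. -/
abbrev vec {n : ℕ} (u : Mink n) : Cl n := CliffordAlgebra.ι (Q n) u

/-- The basis vectors `e_k`, `1 ≤ k ≤ N`. -/
def e {n : ℕ} (k : Fin (n + 2)) : Mink n := (EuclideanSpace.single k 1, 0, 0)

/-- `e_0 = (e_{N+2} + e_{N+1}) / 2`. -/
def eZero {n : ℕ} : Mink n := (0, 1 / 2, 1 / 2)

/-- `e_∞ = (e_{N+2} - e_{N+1}) / 2`. -/
def eInf {n : ℕ} : Mink n := (0, -(1 / 2), 1 / 2)

/-- The canonical lift `λ(x) = x + e_0 + |x|² e_∞`. -/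
def lift {n : ℕ} (x : E n) : Mink n := (x, 0, 0) + eZero + ‖x‖ ^ 2 • eInf

/-- The group `ℋ_∞` of all products of vectors `u` with `u² = -1` and `⟨u, e_∞⟩ = 0`
(the inverse of such a `u` is `-u`, again of this kind). -/
def Hinf (n : ℕ) : Subgroup (Cl n)ˣ :=
  Subgroup.closure {g | ∃ u : Mink n, (g : Cl n) = vec u ∧ vec u * vec u = -1 ∧ lor n u eInf = 0}

theorem exists_act {n : ℕ} (ψ : Hinf n) (v : Mink n) :
    ∃ w : Mink n, vec w = ((ψ : (Cl n)ˣ)⁻¹ : (Cl n)ˣ) * vec v * ((ψ : (Cl n)ˣ) : Cl n) := by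
  have hle : Hinf n ≤ lipschitzGroup (Q n) :=
    Subgroup.closure_mono (fun g hg => by
      obtain ⟨u, hu, -⟩ := hg
      exact ⟨u, hu.symm⟩)
  have h := lipschitzGroup.conjAct_smul_ι_mem_range_ι (inv_mem (hle ψ.2)) v
  rw [ConjAct.units_smul_def, ConjAct.ofConjAct_toConjAct, inv_inv] at h
  exact h

/-- The action `A_ψ(v) = ψ⁻¹ v ψ` of `ψ ∈ ℋ_∞` on vectors. -/
def act {n : ℕ} (ψ : Hinf n) (v : Mink n) : Mink n := Classical.choose (exists_act ψ v)

theorem act_spec {n : ℕ} (ψ : Hinf n) (v : Mink n) :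
    vec (act ψ v) = ((ψ : (Cl n)ˣ)⁻¹ : (Cl n)ˣ) * vec v * ((ψ : (Cl n)ˣ) : Cl n) :=
  Classical.choose_spec (exists_act ψ v)

/-- Vectors embed injectively, so that `act` is uniquely determined by `act_spec`. -/
theorem vec_injective (n : ℕ) : Function.Injective (vec : Mink n → Cl n) := by
  intro u v h
  have h2 := congrArg (CliffordAlgebra.equivExterior (Q n)) h
  simp only [CliffordAlgebra.equivExterior, CliffordAlgebra.changeFormEquiv_apply,
    CliffordAlgebra.changeForm_ι] at h2
  exact (ExteriorAlgebra.ι_inj ℝ u v).1 h2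

/-- The point of `ℝ^N` carried by a frame `ψ`, i.e. the point `x` with `λ(x) = A_ψ(e_0)`. -/
def point {n : ℕ} (ψ : Hinf n) : E n := (act ψ eZero).1

/-- The unit tangent `v̂_1 = |∂X|⁻¹ ∂X̂` of the lifted curve `X̂ = λ ∘ X`. -/
def tangentHat {n : ℕ} (X : ℝ → E n) (ξ : ℝ) : Mink n :=
  ‖deriv X ξ‖⁻¹ • deriv (fun t => lift (X t)) ξ

/-- `Ψ` is suited to `(X̂(0); v̂_1(0))`. -/
def Suited {n : ℕ} (Ψ : Hinf n) (X : ℝ → E n) : Prop :=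
  act Ψ eZero = lift (X 0) ∧ act Ψ (e 0) = tangentHat X 0

/-- The rotation coefficients `β_{k1}`, `k ≠ 1`, are read off the curve `X` on `[0, r]`, starting
from the frame `Ψ`: there are vector fields `v̂_k` with `v̂_k(0) = A_Ψ(e_k)`,
`∂v̂_k = β_{k1} v̂_1` and `β_{k1} = -⟨v̂_k, ∂v̂_1⟩`. -/
def ReadOff {n : ℕ} (X : ℝ → E n) (Ψ : Hinf n) (r : ℝ) (β : Fin (n + 2) → ℝ → ℝ) : Prop :=
  ∃ V : Fin (n + 2) → ℝ → Mink n, ∀ k, k ≠ 0 →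
    V k 0 = act Ψ (e k) ∧
    ∀ ξ ∈ Icc 0 r,
      HasDerivWithinAt (V k) (β k ξ • tangentHat X ξ) (Icc 0 r) ξ ∧
      β k ξ = -lor n (V k ξ) (deriv (tangentHat X) ξ)

/-- The pair of curves `(X, Y)` envelopes a circle congruence on the parameter set `I`: it is a
Jonas pair (`∂Y - ∂X` is a combination of `∂X` and `Y - X`) and
`(∂Y/|∂Y| + ∂X/|∂X|) · (Y - X) = 0`.  The trivial antiparallel solution `∂Y/|∂Y| = -∂X/|∂X|` of
the last equation, to which in general no circle belongs, is excluded; then at each parameter there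
is exactly one circle through `X` and `Y` tangent to both curves, `∂X` and `∂Y` pointing in opposite
senses along it, and `∂Y/|∂Y|` is the mirror image of `∂X/|∂X|` in the hyperplane orthogonal
to `Y - X`. -/
structure EnvelopesCircles {n : ℕ} (X Y : ℝ → E n) (I : Set ℝ) : Prop where
  ne : ∀ ξ ∈ I, Y ξ ≠ X ξ
  immersed : ∀ ξ ∈ I, derivWithin X I ξ ≠ 0
  immersed' : ∀ ξ ∈ I, derivWithin Y I ξ ≠ 0
  jonas : ∀ ξ ∈ I, ∃ c c' : ℝ,
    derivWithin Y I ξ - derivWithin X I ξ = c • derivWithin X I ξ + c' • (Y ξ - X ξ)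
  ribaucour : ∀ ξ ∈ I,
    inner ℝ (‖derivWithin Y I ξ‖⁻¹ • derivWithin Y I ξ + ‖derivWithin X I ξ‖⁻¹ • derivWithin X I ξ)
      (Y ξ - X ξ) = 0
  nondegenerate : ∀ ξ ∈ I,
    ‖derivWithin Y I ξ‖⁻¹ • derivWithin Y I ξ + ‖derivWithin X I ξ‖⁻¹ • derivWithin X I ξ ≠ 0

/-- `v̂_2(0) = H_2(0)⁻¹ (X̂⁺(0) - X̂(0))` with `H_2(0) = |X⁺(0) - X(0)|`, for `x = X(0)` and
`y = X⁺(0)`. -/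
def chordHat {n : ℕ} (x y : E n) : Mink n := ‖y - x‖⁻¹ • (lift y - lift x)

/-- The initial data `B_{k2} = -2 ⟨v̂_2(0), A_Ψ(e_k)⟩`, `k ≠ 2`. -/
def initB {n : ℕ} (Ψ : Hinf n) (x y : E n) (k : Fin (n + 2)) : ℝ :=
  -2 * lor n (chordHat x y) (act Ψ (e k))

/-- The sign of `⟨v̂_2(0), A_Ψ(e_2)⟩`. It is the sign of the root `N_2`. -/
def initSign {n : ℕ} (Ψ : Hinf n) (x y : E n) : ℝ :=
  Real.sign (lor n (chordHat x y) (act Ψ (e 1)))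

/-- The radicand `N_i² = 1 - (ε_i²/4) ∑_{k ≠ i} β_{ki}²`, where `b k = β_{ki}`. -/
def radicand {n : ℕ} (i : Fin (n + 2)) (εi : ℝ) (b : Fin (n + 2) → ℝ) : ℝ :=
  1 - εi ^ 2 / 4 * ∑ k ∈ Finset.univ.erase i, b k ^ 2

/-- The coefficient of the moving frame equation `δ_i ψ = (…) ψ`, namely
`(N_i - 1)/ε_i - (1/2) ∑_{k ≠ i} β_{ki} e_k e_i + h_i e_∞ e_i`. -/
def frameCoeff {n : ℕ} (i : Fin (n + 2)) (εi Ni : ℝ) (b : Fin (n + 2) → ℝ) (h : ℝ) : Cl n :=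
  algebraMap ℝ (Cl n) ((Ni - 1) / εi)
    - (1 / 2 : ℝ) • ∑ k ∈ Finset.univ.erase i, b k • (vec (e k) * vec (e i))
    + h • (vec eInf * vec (e i))

/-- The dependent variables on `B^ε(r) = (εℤ ∩ [0, r]) × {0, 1}`; the natural number `j` stands for
the lattice point `ξ = j ε`. The letter `p` marks the values on the second line, `β1 j k` is
`β_{k1}` and `β2 j k` is `β_{k2}`. The variables `h_2`, `β_{k2}`, `α` live on the first line. -/
structure Fields (n : ℕ) where
  ψ : ℕ → Hinf n
  ψp : ℕ → Hinf n
  h1 : ℕ → ℝ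
  h1p : ℕ → ℝ
  h2 : ℕ → ℝ
  α : ℕ → ℝ
  β1 : ℕ → Fin (n + 2) → ℝ
  β1p : ℕ → Fin (n + 2) → ℝ
  β2 : ℕ → Fin (n + 2) → ℝ

namespace Fields

variable {n : ℕ}

/-- `N_1` on the first line. -/
def N1 (S : Fields n) (ε : ℝ) (j : ℕ) : ℝ := √(radicand 0 ε (S.β1 j))

/-- `N_1` on the second line. -/
def N1p (S : Fields n) (ε : ℝ) (j : ℕ) : ℝ := √(radicand 0 ε (S.β1p j))

/-- `N_2`, the root of sign `s`. -/
def N2 (S : Fields n) (s : ℝ) (j : ℕ) : ℝ := s * √(radicand 1 1 (S.β2 j))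

/-- `Θ = (1/2) ∑_{k > 2} β_{k1} β_{k2}`. -/
def Θ (S : Fields n) (j : ℕ) : ℝ :=
  1 / 2 * ∑ k ∈ (Finset.univ.erase 0).erase 1, S.β1 j k * S.β2 j k

/-- `ρ_{21} = ε α`. -/
def ρ21 (S : Fields n) (ε : ℝ) (j : ℕ) : ℝ := ε * S.α j

/-- `ρ_{12} = N_1 β_{12} + ε (N_2 β_{21} - Θ - α)`. -/
def ρ12 (S : Fields n) (s ε : ℝ) (j : ℕ) : ℝ :=
  S.N1 ε j * S.β2 j 0 + ε * (S.N2 s j * S.β1 j 1 - S.Θ j - S.α j)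

/-- `n = √(1 - ρ_{12} ρ_{21})`. -/
def nf (S : Fields n) (s ε : ℝ) (j : ℕ) : ℝ := √(1 - S.ρ12 s ε j * S.ρ21 ε j)

end Fields

/-- `S` solves the discrete system with mesh sizes `ε_1 = ε`, `ε_2 = 1` on `B^ε(r)` with Goursat
data `Ψ`, `H_1`, `B_{k1}`, `A` (restricted to the lattice) and `H_2`, `B_{k2}`; `s` is the sign of
the root `N_2`. -/
structure IsGoursatSolution {n : ℕ} (s ε r : ℝ) (Ψ : Hinf n) (H1 : ℝ → ℝ)
    (B1 : Fin (n + 2) → ℝ → ℝ) (A : ℝ → ℝ) (H2 : ℝ) (B2 : Fin (n + 2) → ℝ)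
    (S : Fields n) : Prop where
  init_ψ : S.ψ 0 = Ψ
  init_h1 : ∀ j : ℕ, j * ε ≤ r → S.h1 j = H1 (j * ε)
  init_β1 : ∀ j : ℕ, j * ε ≤ r → ∀ k, k ≠ 0 → S.β1 j k = B1 k (j * ε)
  init_α : ∀ j : ℕ, j * ε ≤ r → S.α j = A (j * ε)
  init_h2 : S.h2 0 = H2
  init_β2 : ∀ k, k ≠ 1 → S.β2 0 k = B2 k
  /- all roots are roots of positive numbers -/
  dom_N1 : ∀ j : ℕ, j * ε ≤ r → 0 < radicand 0 ε (S.β1 j)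
  dom_N1p : ∀ j : ℕ, j * ε ≤ r → 0 < radicand 0 ε (S.β1p j)
  dom_N2 : ∀ j : ℕ, j * ε ≤ r → 0 < radicand 1 1 (S.β2 j)
  dom_n : ∀ j : ℕ, j * ε ≤ r → 0 < 1 - S.ρ12 s ε j * S.ρ21 ε j
  /- direction 1, mesh size `ε` -/
  d1_ψ : ∀ j : ℕ, (j + 1) * ε ≤ r →
    ε⁻¹ • (((S.ψ (j + 1) : (Cl n)ˣ) : Cl n) - ((S.ψ j : (Cl n)ˣ) : Cl n)) =
      frameCoeff 0 ε (S.N1 ε j) (S.β1 j) (S.h1 j) * ((S.ψ j : (Cl n)ˣ) : Cl n)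
  d1_ψp : ∀ j : ℕ, (j + 1) * ε ≤ r →
    ε⁻¹ • (((S.ψp (j + 1) : (Cl n)ˣ) : Cl n) - ((S.ψp j : (Cl n)ˣ) : Cl n)) =
      frameCoeff 0 ε (S.N1p ε j) (S.β1p j) (S.h1p j) * ((S.ψp j : (Cl n)ˣ) : Cl n)
  d1_h2 : ∀ j : ℕ, (j + 1) * ε ≤ r →
    (S.h2 (j + 1) - S.h2 j) / ε =
      S.ρ12 s ε j / S.nf s ε j * S.h1 j + (1 - S.nf s ε j) / (ε * S.nf s ε j) * S.h2 j
  d1_β12 : ∀ j : ℕ, (j + 1) * ε ≤ r →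
    (S.β2 (j + 1) 0 - S.β2 j 0) / ε =
      2 * S.N1 ε j * S.ρ12 s ε j / (ε * S.nf s ε j)
        - (1 + S.nf s ε j) / (ε * S.nf s ε j) * S.β2 j 0
  d1_βk2 : ∀ j : ℕ, (j + 1) * ε ≤ r → ∀ k, k ≠ 0 → k ≠ 1 →
    (S.β2 (j + 1) k - S.β2 j k) / ε =
      (1 - S.nf s ε j) / (ε * S.nf s ε j) * S.β2 j k + S.ρ12 s ε j / S.nf s ε j * S.β1 j k
  /- direction 2, mesh size `1` -/
  d2_ψ : ∀ j : ℕ, j * ε ≤ r →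
    ((S.ψp j : (Cl n)ˣ) : Cl n) - ((S.ψ j : (Cl n)ˣ) : Cl n) =
      frameCoeff 1 1 (S.N2 s j) (S.β2 j) (S.h2 j) * ((S.ψ j : (Cl n)ˣ) : Cl n)
  d2_h1 : ∀ j : ℕ, j * ε ≤ r →
    S.h1p j - S.h1 j =
      S.ρ21 ε j / (ε * S.nf s ε j) * S.h2 j + (1 - S.nf s ε j) / S.nf s ε j * S.h1 j
  d2_β21 : ∀ j : ℕ, j * ε ≤ r →
    S.β1p j 1 - S.β1 j 1 =
      2 * S.N2 s j * S.ρ21 ε j / (ε * S.nf s ε j) - (1 + S.nf s ε j) / S.nf s ε j * S.β1 j 1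
  d2_βk1 : ∀ j : ℕ, j * ε ≤ r → ∀ k, k ≠ 0 → k ≠ 1 →
    S.β1p j k - S.β1 j k =
      (1 - S.nf s ε j) / S.nf s ε j * S.β1 j k + S.ρ21 ε j / (ε * S.nf s ε j) * S.β2 j k

/-- `S` and `T` have the same values of all dependent variables on `B^ε(r)`
(`β_{11}` and `β_{22}` are not variables of the system). -/
def AgreeOn {n : ℕ} (ε r : ℝ) (S T : Fields n) : Prop :=
  ∀ j : ℕ, j * ε ≤ r →
    S.ψ j = T.ψ j ∧ S.ψp j = T.ψp j ∧ S.h1 j = T.h1 j ∧ S.h1p j = T.h1p j ∧ S.h2 j = T.h2 j ∧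
    S.α j = T.α j ∧ (∀ k, k ≠ 0 → S.β1 j k = T.β1 j k) ∧ (∀ k, k ≠ 0 → S.β1p j k = T.β1p j k) ∧
    (∀ k, k ≠ 1 → S.β2 j k = T.β2 j k)

/-- The partial difference operator `δ` of mesh size `ε`, for functions of `ξ = j ε`. -/
def diffQuot {F : Type*} [AddCommGroup F] [Module ℝ F] (ε : ℝ) (u : ℕ → F) : ℕ → F :=
  fun j => ε⁻¹ • (u (j + 1) - u j)

/-- The family `u^ε`, `0 < ε < ε₁`, of functions on `εℤ ∩ [0, r]` is `O(ε)`-convergent in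
`C^∞([0, r])` to `f`: for each `ℓ` there is `K` such that, for `ε < r/ℓ`, all difference quotients
of order at most `ℓ` of `u^ε - f` are bounded by `K ε` wherever they are defined. -/
def OConverges {n : ℕ} (r ε₁ : ℝ) (u : ℝ → ℕ → E n) (f : ℝ → E n) : Prop :=
  ∀ l : ℕ, ∃ K : ℝ, ∀ ε : ℝ, 0 < ε → ε < ε₁ → ε * l < r →
    ∀ i : ℕ, i ≤ l → ∀ j : ℕ, (j + i) * ε ≤ r →
      ‖(diffQuot ε)^[i] (fun m : ℕ => u ε m - f (m * ε)) j‖ ≤ K * ε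

end RibPair

end

open RibPair

/-! Geometry. Every `ψ ∈ ℋ_∞` preserves `e_∞` up to sign, and the orthogonal complement of `e_∞`
modulo `e_∞` is Euclidean. So a frame is a point with an orthonormal basis `v_k`, the spatial parts
of `act ψ (e k)`. A step in direction `i` multiplies `ψ` by `-w e_i` with a unit vector `w = ∑ a_k
e_k + c e_∞` (`frame_step`). It moves the point by `-c` along the unit vector `T = edgeDir ψ i a`
(`point_edge_mul`), sends `v_k` to `v_k + 2 a_k T` for `k ≠ i`, and `v_i` to `-v_i + 2 a_i T`.
Transitions around a quadrilateral close up by `edge_comm`, which makes the discrete system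
consistent. For the edge direction `D` and edge length `h_2` of the transformation, the system says
`ν D⁺ = D + εα T` and `ν h_2⁺ = h_2 + ε ρ_12 h_1`, where `ρ_12 = -εα - 2⟨T, D⟩` and `ν = |D + εα T|`
(`edgeDir_step`, `Admissible.h_succ`).

Limit. As `ε → 0` these become `d' = A t - A⟨t,d⟩ d` and `c' = -2h⟨t,d⟩ - A⟨t,d⟩ c`, with `t` the
unit tangent and `h` the speed of `X`. They are the equations for direction and length of the chord
`Y - X` when `Y' = (|X'| + A|Y - X|) (t - 2⟨t,d⟩ d)` (`hasDerivAt_chord`). Enveloping circles with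
the prescribed difference of speeds forces this differential equation
(`EnvelopesCircles.derivWithin_eq`). Conversely its solutions envelope circles as long as the speed
is positive and the chord is not tangent (`envelopesCircles_of_hasDerivWithinAt`). So the smooth
part is Picard–Lindelöf.

Convergence. The error divided by `ε` solves a linear difference equation whose coefficients and
inhomogeneity have difference quotients of every order bounded uniformly in `ε`. A discrete Gronwall
estimate bounds the solution, and the equation itself then bounds all its difference quotients
(`UBdd.of_linear`). The frame equation is linear already (`frame_convergence`). The chord equation
is not, but `|D| = 1` is an a priori bound from which all difference quotients of `D` are bounded,
and then `D` may serve as a coefficient (`chord_convergence`). Convergence also keeps `⟨D, v_2⟩`,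
which is `N_2`, away from zero, so the root of fixed sign is the right one for small `ε`
(`ChordSystem.exists_sign`). -/

namespace RibPair

set_option linter.unusedSectionVars false

/-! ### Families of lattice functions with uniformly bounded difference quotients -/

section UniformlyBounded

variable {F G H : Type*} [NormedAddCommGroup F] [NormedSpace ℝ F]
  [NormedAddCommGroup G] [NormedSpace ℝ G] [NormedAddCommGroup H] [NormedSpace ℝ H]

/-- The family `u^ε` is uniformly bounded at the lattice points `j ε` with `(j + m) ε ≤ r`. -/
def BddFam (r ε₁ : ℝ) (m : ℕ) (u : ℝ → ℕ → F) : Prop :=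
  ∃ K : ℝ, ∀ ε : ℝ, 0 < ε → ε < ε₁ → ∀ j : ℕ, ((j : ℝ) + m) * ε ≤ r → ‖u ε j‖ ≤ K

/-- All difference quotients of order `i ≤ l` of the family `u^ε` are uniformly bounded at the
lattice points `j ε` with `(j + i + m) ε ≤ r`. -/
def UBdd (r ε₁ : ℝ) : ℕ → ℕ → (ℝ → ℕ → F) → Prop
  | 0, m, u => BddFam r ε₁ m u
  | l + 1, m, u => BddFam r ε₁ m u ∧ UBdd r ε₁ l (m + 1) (fun ε => diffQuot ε (u ε))

variable {r ε₁ : ℝ} {l m : ℕ}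

theorem BddFam.congr {u v : ℝ → ℕ → F} (hu : BddFam r ε₁ m u)
    (h : ∀ ε, 0 < ε → ε < ε₁ → ∀ j : ℕ, ((j : ℝ) + m) * ε ≤ r → u ε j = v ε j) :
    BddFam r ε₁ m v := by
  obtain ⟨K, hK⟩ := hu
  exact ⟨K, fun ε h0 h1 j hj => h ε h0 h1 j hj ▸ hK ε h0 h1 j hj⟩

theorem lattice_le {r ε : ℝ} (h0 : 0 < ε) {j m : ℕ} (hj : ((j : ℝ) + (m + 1 : ℕ)) * ε ≤ r) :
    ((j : ℝ) + m) * ε ≤ r := by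
  push_cast at hj
  nlinarith

theorem lattice_succ_le {r ε : ℝ} {j m : ℕ} (hj : ((j : ℝ) + (m + 1 : ℕ)) * ε ≤ r) :
    (((j + 1 : ℕ) : ℝ) + m) * ε ≤ r := by
  push_cast at hj ⊢
  linarith

theorem UBdd.congr {u v : ℝ → ℕ → F} (hu : UBdd r ε₁ l m u)
    (h : ∀ ε, 0 < ε → ε < ε₁ → ∀ j : ℕ, ((j : ℝ) + m) * ε ≤ r → u ε j = v ε j) :
    UBdd r ε₁ l m v := by
  induction l generalizing m u v with
  | zero => exact BddFam.congr hu h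
  | succ l ih =>
    refine ⟨hu.1.congr h, ih hu.2 fun ε h0 h1 j hj => ?_⟩
    simp only [diffQuot, h ε h0 h1 j (lattice_le h0 hj), h ε h0 h1 (j + 1) (lattice_succ_le hj)]

theorem BddFam.reach_succ {u : ℝ → ℕ → F} (hu : BddFam r ε₁ m u) : BddFam r ε₁ (m + 1) u := by
  obtain ⟨K, hK⟩ := hu
  exact ⟨K, fun ε h0 h1 j hj => hK ε h0 h1 j (lattice_le h0 hj)⟩

theorem UBdd.reach_succ {u : ℝ → ℕ → F} (hu : UBdd r ε₁ l m u) : UBdd r ε₁ l (m + 1) u := by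
  induction l generalizing m u with
  | zero => exact BddFam.reach_succ hu
  | succ l ih => exact ⟨hu.1.reach_succ, ih hu.2⟩

theorem UBdd.of_succ {u : ℝ → ℕ → F} (hu : UBdd r ε₁ (l + 1) m u) : UBdd r ε₁ l m u := by
  induction l generalizing m u with
  | zero => exact hu.1
  | succ l ih => exact ⟨hu.1, ih hu.2⟩

theorem BddFam.shift {u : ℝ → ℕ → F} (hu : BddFam r ε₁ m u) :
    BddFam r ε₁ (m + 1) (fun ε j => u ε (j + 1)) := by
  obtain ⟨K, hK⟩ := hu
  exact ⟨K, fun ε h0 h1 j hj => hK ε h0 h1 _ (lattice_succ_le hj)⟩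

theorem UBdd.shift {u : ℝ → ℕ → F} (hu : UBdd r ε₁ l m u) :
    UBdd r ε₁ l (m + 1) (fun ε j => u ε (j + 1)) := by
  induction l generalizing m u with
  | zero => exact BddFam.shift hu
  | succ l ih => exact ⟨hu.1.shift, ih hu.2⟩

theorem BddFam.bilin (B : F →L[ℝ] G →L[ℝ] H) {u : ℝ → ℕ → F} {v : ℝ → ℕ → G}
    (hu : BddFam r ε₁ m u) (hv : BddFam r ε₁ m v) :
    BddFam r ε₁ m (fun ε j => B (u ε j) (v ε j)) := by
  obtain ⟨K, hK⟩ := hu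
  obtain ⟨K', hK'⟩ := hv
  refine ⟨‖B‖ * K * K', fun ε h0 h1 j hj => (B.le_opNorm₂ _ _).trans ?_⟩
  have a := hK ε h0 h1 j hj
  have b := hK' ε h0 h1 j hj
  have a0 := (norm_nonneg _).trans a
  gcongr

theorem BddFam.add {u v : ℝ → ℕ → F} (hu : BddFam r ε₁ m u) (hv : BddFam r ε₁ m v) :
    BddFam r ε₁ m (fun ε j => u ε j + v ε j) := by
  obtain ⟨K, hK⟩ := hu
  obtain ⟨K', hK'⟩ := hv
  exact ⟨K + K', fun ε h0 h1 j hj =>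
    (norm_add_le _ _).trans (add_le_add (hK ε h0 h1 j hj) (hK' ε h0 h1 j hj))⟩

theorem UBdd.add {u v : ℝ → ℕ → F} (hu : UBdd r ε₁ l m u) (hv : UBdd r ε₁ l m v) :
    UBdd r ε₁ l m (fun ε j => u ε j + v ε j) := by
  induction l generalizing m u v with
  | zero => exact BddFam.add hu hv
  | succ l ih =>
    refine ⟨hu.1.add hv.1, (ih hu.2 hv.2).congr fun ε _ _ j _ => ?_⟩
    simp only [diffQuot, ← smul_add]
    congr 1; abel

/-- Discrete product rule: `δ B(u, v) = B(δu, v) + B(u⁺, δv)` with `u⁺` the shift of `u`. Taking `δ`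
or shifting costs one lattice point, which the reach `m` records. Scalar products, inner products
and operator application are all instances. -/
theorem UBdd.bilin (B : F →L[ℝ] G →L[ℝ] H) {u : ℝ → ℕ → F} {v : ℝ → ℕ → G}
    (hu : UBdd r ε₁ l m u) (hv : UBdd r ε₁ l m v) :
    UBdd r ε₁ l m (fun ε j => B (u ε j) (v ε j)) := by
  induction l generalizing m u v with
  | zero => exact BddFam.bilin B hu hv
  | succ l ih =>
    refine ⟨hu.1.bilin B hv.1, ((ih hu.2 hv.of_succ.reach_succ).add
      (ih hu.of_succ.shift hv.2)).congr fun ε _ _ j _ => ?_⟩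
    simp [diffQuot, ← smul_add]

theorem UBdd.const (c : F) : UBdd r ε₁ l m (fun _ _ => c) := by
  induction l generalizing m c with
  | zero => exact ⟨‖c‖, fun _ _ _ _ _ => le_rfl⟩
  | succ l ih =>
    refine ⟨⟨‖c‖, fun _ _ _ _ _ => le_rfl⟩, (ih 0).congr fun ε _ _ j _ => ?_⟩
    simp [diffQuot]

theorem UBdd.mesh : UBdd r ε₁ l m (fun ε _ => ε) := by
  have h : BddFam r ε₁ m (fun ε _ => ε) :=
    ⟨ε₁, fun ε h0 h1 _ _ => by rw [Real.norm_of_nonneg h0.le]; exact h1.le⟩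
  cases l with
  | zero => exact h
  | succ l =>
    refine ⟨h, (UBdd.const 0).congr fun ε _ _ j _ => ?_⟩
    simp [diffQuot]

theorem UBdd.clm (B : F →L[ℝ] G) {u : ℝ → ℕ → F} (hu : UBdd r ε₁ l m u) :
    UBdd r ε₁ l m (fun ε j => B (u ε j)) :=
  UBdd.bilin (ContinuousLinearMap.id ℝ (F →L[ℝ] G)) (UBdd.const B) hu

theorem UBdd.smul {u : ℝ → ℕ → ℝ} {v : ℝ → ℕ → F} (hu : UBdd r ε₁ l m u)
    (hv : UBdd r ε₁ l m v) : UBdd r ε₁ l m (fun ε j => u ε j • v ε j) :=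
  UBdd.bilin (ContinuousLinearMap.lsmul ℝ ℝ) hu hv

theorem UBdd.mul {u v : ℝ → ℕ → ℝ} (hu : UBdd r ε₁ l m u)
    (hv : UBdd r ε₁ l m v) : UBdd r ε₁ l m (fun ε j => u ε j * v ε j) := hu.smul hv

theorem UBdd.pow {u : ℝ → ℕ → ℝ} (hu : UBdd r ε₁ l m u) (k : ℕ) :
    UBdd r ε₁ l m (fun ε j => u ε j ^ k) := by
  induction k with
  | zero => simpa using UBdd.const (1 : ℝ)
  | succ k ih => simpa only [pow_succ] using ih.mul hu

theorem UBdd.const_smul (c : ℝ) {v : ℝ → ℕ → F} (hv : UBdd r ε₁ l m v) :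
    UBdd r ε₁ l m (fun ε j => c • v ε j) := (UBdd.const c).smul hv

theorem UBdd.const_mul (c : ℝ) {v : ℝ → ℕ → ℝ} (hv : UBdd r ε₁ l m v) :
    UBdd r ε₁ l m (fun ε j => c * v ε j) := (UBdd.const c).mul hv

theorem UBdd.neg {v : ℝ → ℕ → F} (hv : UBdd r ε₁ l m v) :
    UBdd r ε₁ l m (fun ε j => -v ε j) := by
  simpa using UBdd.const_smul (-1) hv

theorem UBdd.sub {u v : ℝ → ℕ → F} (hu : UBdd r ε₁ l m u) (hv : UBdd r ε₁ l m v) :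
    UBdd r ε₁ l m (fun ε j => u ε j - v ε j) := by
  simpa only [sub_eq_add_neg] using hu.add hv.neg

theorem UBdd.inner {E : Type*} [NormedAddCommGroup E] [InnerProductSpace ℝ E]
    {u v : ℝ → ℕ → E} (hu : UBdd r ε₁ l m u) (hv : UBdd r ε₁ l m v) :
    UBdd r ε₁ l m (fun ε j => inner ℝ (u ε j) (v ε j)) :=
  UBdd.bilin (innerSL ℝ) hu hv

theorem UBdd.sum {ι : Type*} (s : Finset ι) {u : ι → ℝ → ℕ → F}
    (hu : ∀ k ∈ s, UBdd r ε₁ l m (u k)) : UBdd r ε₁ l m (fun ε j => ∑ k ∈ s, u k ε j) := by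
  classical
  induction s using Finset.induction_on with
  | empty => simpa using UBdd.const (0 : F)
  | insert a s ha ih =>
    simp only [Finset.sum_insert ha]
    exact (hu a (Finset.mem_insert_self a s)).add
      (ih fun k hk => hu k (Finset.mem_insert_of_mem hk))

theorem UBdd.proj {ι : Type*} [Fintype ι] {u : ℝ → ℕ → ι → F} (hu : UBdd r ε₁ l m u) (k : ι) :
    UBdd r ε₁ l m (fun ε j => u ε j k) :=
  UBdd.clm (ContinuousLinearMap.proj (R := ℝ) (φ := fun _ : ι => F) k) hu

theorem UBdd.pi {ι : Type*} [Fintype ι] {u : ℝ → ℕ → ι → F}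
    (hu : ∀ k, UBdd r ε₁ l m (fun ε j => u ε j k)) : UBdd r ε₁ l m u := by
  classical
  refine (UBdd.sum Finset.univ fun k _ =>
    UBdd.clm (ContinuousLinearMap.single ℝ (fun _ : ι => F) k) (hu k)).congr
      fun ε _ _ j _ => ?_
  ext i
  simp [Finset.sum_apply, Pi.single_apply]

theorem BddFam.inv {u : ℝ → ℕ → ℝ} {c : ℝ} (hc : 0 < c)
    (h : ∀ ε, 0 < ε → ε < ε₁ → ∀ j : ℕ, ((j : ℝ) + m) * ε ≤ r → c ≤ u ε j) :
    BddFam r ε₁ m (fun ε j => (u ε j)⁻¹) := by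
  refine ⟨c⁻¹, fun ε h0 h1 j hj => ?_⟩
  have := h ε h0 h1 j hj
  rw [Real.norm_of_nonneg (inv_nonneg.2 (hc.le.trans this))]
  exact inv_anti₀ hc this

/-- By `δ(1/u) = -δu · (1/u) · (1/u⁺)`, a bound of order `l` on `1/u` yields one of order `l + 1`.
The uniform lower bound is needed only for order zero. -/
theorem UBdd.inv {u : ℝ → ℕ → ℝ} (hu : UBdd r ε₁ l m u) {c : ℝ} (hc : 0 < c)
    (h : ∀ ε, 0 < ε → ε < ε₁ → ∀ j : ℕ, ((j : ℝ) + m) * ε ≤ r → c ≤ u ε j) :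
    UBdd r ε₁ l m (fun ε j => (u ε j)⁻¹) := by
  induction l generalizing m u with
  | zero => exact BddFam.inv hc h
  | succ l ih =>
    have hi := ih hu.of_succ h
    refine ⟨BddFam.inv hc h,
      ((hu.2.mul hi.reach_succ).mul hi.shift).neg.congr fun ε h0 h1 j hj => ?_⟩
    have a := hc.trans_le (h ε h0 h1 j (lattice_le h0 hj))
    have b := hc.trans_le (h ε h0 h1 (j + 1) (lattice_succ_le hj))
    simp only [diffQuot, smul_eq_mul]
    field_simp
    ring

/-- By `δ√u = δu / (√u + √u⁺)`; the denominator stays above `√c`, so the rule for inverses applies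
to it. -/
theorem UBdd.sqrt {u : ℝ → ℕ → ℝ} (hu : UBdd r ε₁ l m u) {c : ℝ} (hc : 0 < c)
    (h : ∀ ε, 0 < ε → ε < ε₁ → ∀ j : ℕ, ((j : ℝ) + m) * ε ≤ r → c ≤ u ε j) :
    UBdd r ε₁ l m (fun ε j => √(u ε j)) := by
  have hb : ∀ {m : ℕ} {u : ℝ → ℕ → ℝ}, BddFam r ε₁ m u → BddFam r ε₁ m (fun ε j => √(u ε j)) := by
    rintro m u ⟨K, hK⟩
    refine ⟨√K, fun ε h0 h1 j hj => ?_⟩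
    rw [Real.norm_of_nonneg (Real.sqrt_nonneg _)]
    exact Real.sqrt_le_sqrt ((le_abs_self _).trans (hK ε h0 h1 j hj))
  induction l generalizing m u with
  | zero => exact hb hu
  | succ l ih =>
    have hi := ih hu.of_succ h
    have hpos : ∀ ε, 0 < ε → ε < ε₁ → ∀ j : ℕ, ((j : ℝ) + (m + 1 : ℕ)) * ε ≤ r →
        √c ≤ √(u ε j) + √(u ε (j + 1)) := fun ε h0 h1 j hj =>
      (Real.sqrt_le_sqrt (h ε h0 h1 j (lattice_le h0 hj))).trans
        (le_add_of_nonneg_right (Real.sqrt_nonneg _))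
    refine ⟨hb hu.1, (hu.2.mul ((hi.reach_succ.add hi.shift).inv (Real.sqrt_pos.2 hc)
      hpos)).congr fun ε h0 h1 j hj => ?_⟩
    have a := hc.trans_le (h ε h0 h1 j (lattice_le h0 hj))
    have b := hc.trans_le (h ε h0 h1 (j + 1) (lattice_succ_le hj))
    have p := (Real.sqrt_pos.2 hc).trans_le (hpos ε h0 h1 j hj)
    simp only [diffQuot, smul_eq_mul]
    rw [mul_assoc, ← div_eq_mul_inv]
    congr 1
    rw [div_eq_iff p.ne']
    nlinarith [Real.sq_sqrt a.le, Real.sq_sqrt b.le]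

theorem BddFam.mono_mesh {u : ℝ → ℕ → F} {ε₂ : ℝ} (hε : ε₂ ≤ ε₁) (hu : BddFam r ε₁ m u) :
    BddFam r ε₂ m u := by
  obtain ⟨K, hK⟩ := hu
  exact ⟨K, fun ε h0 h1 j hj => hK ε h0 (h1.trans_le hε) j hj⟩

theorem UBdd.mono_mesh {u : ℝ → ℕ → F} {ε₂ : ℝ} (hε : ε₂ ≤ ε₁) (hu : UBdd r ε₁ l m u) :
    UBdd r ε₂ l m u := by
  induction l generalizing m u with
  | zero => exact BddFam.mono_mesh hε hu
  | succ l ih => exact ⟨hu.1.mono_mesh hε, ih hu.2⟩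

theorem UBdd.iterate {u : ℝ → ℕ → F} (hu : UBdd r ε₁ l m u) :
    ∃ K : ℝ, ∀ ε : ℝ, 0 < ε → ε < ε₁ → ∀ i ≤ l, ∀ j : ℕ, ((j : ℝ) + i + m) * ε ≤ r →
      ‖(diffQuot ε)^[i] (u ε) j‖ ≤ K := by
  induction l generalizing m u with
  | zero =>
    obtain ⟨K, hK⟩ := hu
    refine ⟨K, fun ε h0 h1 i hi j hj => ?_⟩
    obtain rfl : i = 0 := by omega
    exact hK ε h0 h1 j (by simpa using hj)
  | succ l ih =>
    obtain ⟨K, hK⟩ := hu.1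
    obtain ⟨K', hK'⟩ := ih hu.2
    refine ⟨max K K', fun ε h0 h1 i hi j hj => ?_⟩
    cases i with
    | zero => exact (hK ε h0 h1 j (by simpa using hj)).trans (le_max_left _ _)
    | succ i =>
      refine le_trans ?_ (le_max_right K K')
      exact hK' ε h0 h1 i (by omega) j (by push_cast at hj ⊢; linarith)

theorem diffQuot_iterate_smul (ε c : ℝ) (u : ℕ → F) (i : ℕ) :
    (diffQuot ε)^[i] (fun j => c • u j) = fun j => c • (diffQuot ε)^[i] u j := by
  induction i generalizing u with
  | zero => rfl
  | succ i ih =>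
    have : diffQuot ε (fun j => c • u j) = fun j => c • diffQuot ε u j := by
      ext j; simp only [diffQuot, ← smul_sub, smul_comm ε⁻¹ c]
    rw [Function.iterate_succ_apply, this, ih]; rfl

/-! ### Restrictions of smooth functions to the lattice -/

/-- The difference quotient of `g ε` is again a smooth function of the continuous variable, and by
the mean value inequality its `i`-th derivative is bounded by the `(i+1)`-st derivative of `g ε`.
The functions may depend on `ε` so that the induction applies to difference quotients, and so that
consistency errors are covered. -/
theorem UBdd.of_iteratedDeriv {g : ℝ → ℝ → F} (hg : ∀ ε, ContDiff ℝ ∞ (g ε))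
    (hK : ∀ i : ℕ, ∃ K : ℝ, ∀ ε, 0 < ε → ε < ε₁ → ∀ ξ, 0 ≤ ξ → ξ + m * ε ≤ r →
      ‖iteratedDeriv i (g ε) ξ‖ ≤ K) :
    UBdd r ε₁ l m (fun ε j => g ε (j * ε)) := by
  have hb : ∀ {m : ℕ} {g : ℝ → ℝ → F}, (∀ i : ℕ, ∃ K : ℝ, ∀ ε, 0 < ε → ε < ε₁ → ∀ ξ, 0 ≤ ξ →
      ξ + m * ε ≤ r → ‖iteratedDeriv i (g ε) ξ‖ ≤ K) →
      BddFam r ε₁ m (fun ε j => g ε (j * ε)) := by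
    intro m g hK
    obtain ⟨K, hK⟩ := hK 0
    exact ⟨K, fun ε h0 h1 j hj => by
      simpa using hK ε h0 h1 (j * ε) (by positivity) (by linarith)⟩
  induction l generalizing m g with
  | zero => exact hb hK
  | succ l ih =>
    refine ⟨hb hK, (ih (m := m + 1) (g := fun ε ξ => ε⁻¹ • (g ε (ξ + ε) - g ε ξ))
      (fun ε => ?_) fun i => ?_).congr fun ε h0 h1 j hj => ?_⟩
    · have := hg ε
      fun_prop
    · obtain ⟨K, hK⟩ := hK (i + 1)
      refine ⟨K, fun ε h0 h1 ξ hξ hξr => ?_⟩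
      have hs : ∀ f : ℝ → F, ContDiff ℝ ∞ f → ∀ x, ContDiffAt ℝ (i : ℕ) f x := fun f hf x =>
        (hf.of_le (by exact_mod_cast le_top)).contDiffAt
      have h1g : ContDiff ℝ ∞ (fun ξ => g ε (ξ + ε)) := (hg ε).comp (by fun_prop)
      have e1 : iteratedDeriv i (fun ξ => ε⁻¹ • (g ε (ξ + ε) - g ε ξ)) ξ
          = ε⁻¹ • (iteratedDeriv i (g ε) (ξ + ε) - iteratedDeriv i (g ε) ξ) := by
        rw [iteratedDeriv_fun_const_smul ((hs _ h1g ξ).sub (hs _ (hg ε) ξ)),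
          iteratedDeriv_fun_sub (hs _ h1g ξ) (hs _ (hg ε) ξ), iteratedDeriv_comp_add_const]
      have hd : ∀ x, HasDerivAt (iteratedDeriv i (g ε)) (iteratedDeriv (i + 1) (g ε) x) x := by
        intro x
        rw [iteratedDeriv_succ]
        exact ((hg ε).differentiable_iteratedDeriv i (by exact_mod_cast WithTop.coe_lt_top i)
          x).hasDerivAt
      have := Convex.norm_image_sub_le_of_norm_hasDerivWithin_le (f := iteratedDeriv i (g ε))
        (f' := iteratedDeriv (i + 1) (g ε)) (C := K) (s := Icc ξ (ξ + ε))
        (fun x _ => (hd x).hasDerivWithinAt)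
        (fun x hx => hK ε h0 h1 x (hξ.trans hx.1) (by push_cast at hξr; nlinarith [hx.2]))
        (convex_Icc _ _) (x := ξ) (y := ξ + ε) (by simp [h0.le]) (by simp [h0.le])
      rw [e1, norm_smul, norm_inv, Real.norm_of_nonneg h0.le, inv_mul_le_iff₀ h0]
      simpa [abs_of_pos h0, mul_comm] using this
    · simp only [diffQuot]
      push_cast
      rw [add_mul, one_mul]

theorem bddOn_iteratedDeriv {f : ℝ → F} (hf : ContDiff ℝ ∞ f) (r : ℝ) (i : ℕ) :
    ∃ K : ℝ, ∀ ξ ∈ Icc 0 r, ‖iteratedDeriv i f ξ‖ ≤ K :=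
  isCompact_Icc.exists_bound_of_continuousOn
    (hf.continuous_iteratedDeriv i (by exact_mod_cast le_top)).continuousOn

theorem UBdd.of_smooth {f : ℝ → F} (hf : ContDiff ℝ ∞ f) :
    UBdd r ε₁ l m (fun ε j => f (j * ε)) := by
  refine UBdd.of_iteratedDeriv (g := fun _ => f) (fun _ => hf) fun i => ?_
  obtain ⟨K, hK⟩ := bddOn_iteratedDeriv hf r i
  exact ⟨K, fun ε h0 _ ξ hξ hξr => hK ξ ⟨hξ, by nlinarith [m.cast_nonneg (α := ℝ)]⟩⟩

/-- First order consistency of the difference quotient of a smooth function. -/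
theorem UBdd.consistency {f : ℝ → F} (hf : ContDiff ℝ ∞ f) :
    UBdd r ε₁ l (m + 1) (fun ε j =>
      ε⁻¹ • (diffQuot ε (fun i : ℕ => f (i * ε)) j - deriv f (j * ε))) := by
  have hf' : ContDiff ℝ ∞ (deriv f) := ((contDiff_succ_iff_deriv (n := ∞)).1 hf).2.2
  refine (UBdd.of_iteratedDeriv (m := m + 1)
    (g := fun ε ξ => ε⁻¹ • (ε⁻¹ • (f (ξ + ε) - f ξ) - deriv f ξ)) (fun ε => ?_) fun i => ?_).congr
    fun ε h0 h1 j hj => ?_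
  · fun_prop
  · obtain ⟨K, hK⟩ := bddOn_iteratedDeriv hf r (i + 2)
    refine ⟨K, fun ε h0 h1 ξ hξ hξr => ?_⟩
    push_cast at hξr
    have hm : 0 ≤ (m : ℝ) * ε := by positivity
    have hs : ∀ f : ℝ → F, ContDiff ℝ ∞ f → ∀ x, ContDiffAt ℝ (i : ℕ) f x := fun f hf x =>
        (hf.of_le (by exact_mod_cast le_top)).contDiffAt
    have h1f : ContDiff ℝ ∞ (fun ξ => f (ξ + ε)) := hf.comp (by fun_prop)
    have h2f : ContDiff ℝ ∞ (fun ξ => ε⁻¹ • (f (ξ + ε) - f ξ)) := by fun_prop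
    have hd : ∀ k x, HasDerivAt (iteratedDeriv k f) (iteratedDeriv (k + 1) f x) x := by
      intro k x
      rw [iteratedDeriv_succ]
      exact (hf.differentiable_iteratedDeriv k (by exact_mod_cast WithTop.coe_lt_top k)
        x).hasDerivAt
    have e1 : iteratedDeriv i (fun ξ => ε⁻¹ • (ε⁻¹ • (f (ξ + ε) - f ξ) - deriv f ξ)) ξ
        = ε⁻¹ • (ε⁻¹ • (iteratedDeriv i f (ξ + ε) - iteratedDeriv i f ξ)
          - iteratedDeriv (i + 1) f ξ) := by
      rw [iteratedDeriv_fun_const_smul ((hs _ h2f ξ).sub (hs _ hf' ξ)),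
        iteratedDeriv_fun_sub (hs _ h2f ξ) (hs _ hf' ξ),
        iteratedDeriv_fun_const_smul ((hs _ h1f ξ).sub (hs _ hf ξ)),
        iteratedDeriv_fun_sub (hs _ h1f ξ) (hs _ hf ξ), iteratedDeriv_comp_add_const,
        iteratedDeriv_succ']
    have hx0 : ∀ x ∈ Icc ξ (ξ + ε), x ∈ Icc 0 r := fun x hx =>
      ⟨hξ.trans hx.1, by linarith [hx.2]⟩
    have hK0 : 0 ≤ K := (norm_nonneg _).trans (hK ξ (hx0 ξ (by simp [h0.le])))
    -- Second order Taylor bound in two mean value steps: `f^(i+1)` varies by at most `K ε` on the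
    -- cell, hence `f^(i)` minus its linear part at `ξ` varies by at most `K ε²`.
    have b1 : ∀ x ∈ Icc ξ (ξ + ε),
        ‖iteratedDeriv (i + 1) f x - iteratedDeriv (i + 1) f ξ‖ ≤ K * ε := by
      intro x hx
      refine (Convex.norm_image_sub_le_of_norm_hasDerivWithin_le (f := iteratedDeriv (i + 1) f)
        (f' := iteratedDeriv (i + 2) f) (C := K) (s := Icc ξ (ξ + ε))
        (fun x _ => (hd _ x).hasDerivWithinAt) (fun x hx => hK x (hx0 x hx))
        (convex_Icc _ _) (x := ξ) (y := x) (by simp [h0.le]) hx).trans ?_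
      rw [Real.norm_of_nonneg (by linarith [hx.1])]
      exact mul_le_mul_of_nonneg_left (by linarith [hx.2]) hK0
    have b2 := Convex.norm_image_sub_le_of_norm_hasDerivWithin_le
      (f := fun x => iteratedDeriv i f x - x • iteratedDeriv (i + 1) f ξ)
      (f' := fun x => iteratedDeriv (i + 1) f x - iteratedDeriv (i + 1) f ξ)
      (C := K * ε) (s := Icc ξ (ξ + ε))
      (fun x _ => ((hd i x).sub (by
        simpa using (hasDerivAt_id x).smul_const (iteratedDeriv (i + 1) f ξ))).hasDerivWithinAt)
      b1 (convex_Icc _ _) (x := ξ) (y := ξ + ε) (by simp [h0.le]) (by simp [h0.le])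
    have e2 : ε⁻¹ • (ε⁻¹ • (iteratedDeriv i f (ξ + ε) - iteratedDeriv i f ξ)
          - iteratedDeriv (i + 1) f ξ) = (ε⁻¹ * ε⁻¹) •
        ((iteratedDeriv i f (ξ + ε) - (ξ + ε) • iteratedDeriv (i + 1) f ξ)
          - (iteratedDeriv i f ξ - ξ • iteratedDeriv (i + 1) f ξ)) := by
      match_scalars <;> field_simp <;> ring
    rw [e1, e2, norm_smul, Real.norm_of_nonneg (by positivity), ← mul_inv,
      inv_mul_le_iff₀ (by positivity)]
    refine b2.trans (le_of_eq ?_)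
    rw [add_sub_cancel_left, Real.norm_of_nonneg h0.le]
    ring
  · simp only [diffQuot]
    push_cast
    rw [add_mul, one_mul]

/-! ### Linear difference equations -/

/-- The solution of a linear difference equation with smoothly bounded coefficients is smoothly
bounded. -/
theorem UBdd.of_linear {u g : ℝ → ℕ → F} {A : ℝ → ℕ → F →L[ℝ] F}
    (h0 : ∃ K : ℝ, ∀ ε, 0 < ε → ε < ε₁ → ‖u ε 0‖ ≤ K)
    (hA : ∀ l, UBdd r ε₁ l 1 A) (hg : ∀ l, UBdd r ε₁ l 1 g)
    (hu : ∀ ε, 0 < ε → ε < ε₁ → ∀ j : ℕ, ((j : ℝ) + 1) * ε ≤ r →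
      diffQuot ε (u ε) j = A ε j (u ε j) + g ε j) (l : ℕ) :
    UBdd r ε₁ l 0 u := by
  -- Read as a formula for `δu`, the equation turns bounds of order `l` on `u` into bounds of order
  -- `l` on `δu`. Only order zero needs an estimate.
  have hd : ∀ l, UBdd r ε₁ l 0 u → UBdd r ε₁ l 1 (fun ε => diffQuot ε (u ε)) := fun l hl =>
    ((UBdd.bilin (ContinuousLinearMap.id ℝ (F →L[ℝ] F)) (hA l) hl.reach_succ).add (hg l)).congr
      fun ε e0 e1 j hj => (hu ε e0 e1 j (by simpa using hj)).symm
  have hbase : BddFam r ε₁ 0 u := by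
    obtain ⟨K₀, hK₀⟩ := h0
    obtain ⟨C, hC⟩ := hA 0
    obtain ⟨D, hD⟩ := hg 0
    -- Discrete Gronwall: `‖u‖ + D'` grows by at most the factor `1 + C' ε` per step. `C' ≥ 1` lets
    -- the added `D'` absorb the inhomogeneity.
    set C' := max C 1 with hC'
    set D' := max D 0 with hD'
    set K' := max K₀ 0 with hK'
    have c1 : 1 ≤ C' := le_max_right _ _
    have d0 : 0 ≤ D' := le_max_right _ _
    have k0 : 0 ≤ K' := le_max_right _ _
    refine ⟨(K' + D') * Real.exp (C' * r), fun ε e0 e1 j hj => ?_⟩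
    have key : ∀ j : ℕ, (j : ℝ) * ε ≤ r →
        ‖u ε j‖ + D' ≤ (K' + D') * Real.exp (C' * (j * ε)) := by
      intro j
      induction j with
      | zero =>
        intro _
        have : ‖u ε 0‖ ≤ K' := (hK₀ ε e0 e1).trans (le_max_left K₀ 0)
        simp only [Nat.cast_zero, zero_mul, mul_zero, Real.exp_zero, mul_one]
        linarith
      | succ j ih =>
        intro hj
        push_cast at hj
        have ih := ih (by nlinarith)
        have hj' : ((j : ℝ) + (1 : ℕ)) * ε ≤ r := by simpa using hj
        have e : u ε (j + 1) = u ε j + ε • (A ε j (u ε j) + g ε j) := by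
          rw [← hu ε e0 e1 j hj, diffQuot, smul_inv_smul₀ e0.ne']; abel
        have hn : ‖A ε j (u ε j) + g ε j‖ ≤ C' * ‖u ε j‖ + D' := by
          refine (norm_add_le _ _).trans (add_le_add ?_ ((hD ε e0 e1 j hj').trans
            (le_max_left _ _)))
          exact ((A ε j).le_opNorm _).trans (mul_le_mul_of_nonneg_right
            ((hC ε e0 e1 j hj').trans (le_max_left _ _)) (norm_nonneg _))
        have hstep : ‖u ε (j + 1)‖ + D' ≤ (1 + C' * ε) * (‖u ε j‖ + D') := by
          rw [e]
          have := norm_add_le (u ε j) (ε • (A ε j (u ε j) + g ε j))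
          rw [norm_smul, Real.norm_of_nonneg e0.le] at this
          have h2 := mul_le_mul_of_nonneg_left hn e0.le
          nlinarith [mul_nonneg (mul_nonneg (sub_nonneg.2 c1) e0.le) d0]
        refine hstep.trans ?_
        have h3 : 1 + C' * ε ≤ Real.exp (C' * ε) := by
          linarith [Real.add_one_le_exp (C' * ε)]
        calc (1 + C' * ε) * (‖u ε j‖ + D')
            ≤ Real.exp (C' * ε) * ((K' + D') * Real.exp (C' * (j * ε))) := by
              gcongr
          _ = (K' + D') * Real.exp (C' * ((j + 1 : ℕ) * ε)) := by
              rw [mul_left_comm, ← Real.exp_add]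
              push_cast
              ring_nf
    have hj : (j : ℝ) * ε ≤ r := by simpa using hj
    have h1 := key j hj
    have h2 : (K' + D') * Real.exp (C' * (j * ε)) ≤ (K' + D') * Real.exp (C' * r) := by
      gcongr
    linarith
  induction l with
  | zero => exact hbase
  | succ l ih => exact ⟨hbase, hd l ih⟩

end UniformlyBounded

end RibPair

namespace RibPair

/-! ### Convergence of the discrete frames and of the discrete transforms -/

section Convergence

variable {r ε₁ : ℝ}

/-- Matrix form of `UBdd.of_linear`: the operator coefficient is a combination of the elementary
matrices `Λ k i`, which are constant. -/
theorem UBdd.of_linear_system {ι F : Type*} [Fintype ι] [NormedAddCommGroup F]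
    [NormedSpace ℝ F] {u g : ℝ → ℕ → ι → F} {c : ι → ι → ℝ → ℕ → ℝ}
    (h0 : ∃ K : ℝ, ∀ ε, 0 < ε → ε < ε₁ → ‖u ε 0‖ ≤ K)
    (hc : ∀ k i l, UBdd r ε₁ l 1 (c k i)) (hg : ∀ l, UBdd r ε₁ l 1 g)
    (hu : ∀ ε, 0 < ε → ε < ε₁ → ∀ j : ℕ, ((j : ℝ) + 1) * ε ≤ r →
      ∀ k, diffQuot ε (u ε) j k = ∑ i, c k i ε j • u ε j i + g ε j k) (l : ℕ) :
    UBdd r ε₁ l 0 u := by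
  classical
  let Λ : ι → ι → (ι → F) →L[ℝ] (ι → F) := fun k i =>
    (ContinuousLinearMap.single ℝ (fun _ : ι => F) k).comp
      (ContinuousLinearMap.proj (R := ℝ) (φ := fun _ : ι => F) i)
  refine UBdd.of_linear (A := fun ε j => ∑ k, ∑ i, c k i ε j • Λ k i) (g := g) h0
    (fun l => UBdd.sum _ fun k _ => UBdd.sum _ fun i _ => (hc k i l).smul (UBdd.const _)) hg
    (fun ε e0 e1 j hj => ?_) l
  ext k : 1
  rw [hu ε e0 e1 j hj k, Pi.add_apply]
  congr 1
  simp [Λ, Finset.sum_apply, Pi.single_apply]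

variable {E : Type*} [NormedAddCommGroup E] [InnerProductSpace ℝ E]
  {ι : Type*} [Fintype ι] [DecidableEq ι] {o : ι}

theorem diffQuot_error {F : Type*} [NormedAddCommGroup F] [NormedSpace ℝ F] (ε : ℝ) (u v : ℕ → F)
    (j : ℕ) : diffQuot ε (fun i => ε⁻¹ • (u i - v i)) j =
      ε⁻¹ • (diffQuot ε u j - diffQuot ε v j) := by
  simp only [diffQuot]
  module

theorem lattice_mem {r ε : ℝ} (h0 : 0 < ε) {j : ℕ} (hj : ((j : ℝ) + 1) * ε ≤ r) :
    (j : ℝ) * ε ∈ Icc 0 r := ⟨by positivity, by linarith⟩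

/-- The recursion is linear in `F`, and the exact frame `f` satisfies it up to `O(ε²)` per step, so
`ε⁻¹ (F - f)` solves a linear system of the kind above. The edge direction `T` is a linear function
of `F` and inherits the rate. -/
theorem frame_convergence {β : ι → ℝ → ℝ} (hβ : ∀ k, ContDiff ℝ ∞ (β k)) {f : ι → ℝ → E}
    (hf : ∀ k, ContDiff ℝ ∞ (f k))
    (hfo : ∀ ξ ∈ Icc 0 r, deriv (f o) ξ = -∑ k ∈ Finset.univ.erase o, β k ξ • f k ξ)
    (hfk : ∀ k, k ≠ o → ∀ ξ ∈ Icc 0 r, deriv (f k) ξ = β k ξ • f o ξ)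
    {F : ℝ → ℕ → ι → E} {T : ℝ → ℕ → E} {N : ℝ → ℕ → ℝ}
    (hN : ∀ ε, 0 < ε → ε < ε₁ → ∀ j : ℕ, j * ε ≤ r →
      1 / 2 ≤ 1 - ε ^ 2 / 4 * ∑ k ∈ Finset.univ.erase o, β k (j * ε) ^ 2 ∧
      N ε j = √(1 - ε ^ 2 / 4 * ∑ k ∈ Finset.univ.erase o, β k (j * ε) ^ 2))
    (hT : ∀ ε, 0 < ε → ε < ε₁ → ∀ j : ℕ, j * ε ≤ r →
      T ε j = N ε j • F ε j o - (ε / 2) • ∑ k ∈ Finset.univ.erase o, β k (j * ε) • F ε j k)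
    (hF : ∀ ε, 0 < ε → ε < ε₁ → ∀ j : ℕ, ((j : ℝ) + 1) * ε ≤ r →
      F ε (j + 1) o = -F ε j o + (2 * N ε j) • T ε j ∧
      ∀ k, k ≠ o → F ε (j + 1) k = F ε j k + (ε * β k (j * ε)) • T ε j)
    (h0 : ∀ ε, 0 < ε → ε < ε₁ → ∀ k, F ε 0 k = f k 0) (l : ℕ) :
    UBdd r ε₁ l 0 (fun ε j => ε⁻¹ • (F ε j - fun k => f k (j * ε))) ∧
    UBdd r ε₁ l 0 (fun ε j => ε⁻¹ • (T ε j - f o (j * ε))) := by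
  set S : ℝ → ℕ → ℝ := fun ε j => ∑ k ∈ Finset.univ.erase o, β k (j * ε) ^ 2 with hS
  have bβ : ∀ k l m, UBdd r ε₁ l m (fun ε j => β k (j * ε)) := fun k l m => .of_smooth (hβ k)
  have bf : ∀ k l m, UBdd r ε₁ l m (fun ε j => f k (j * ε)) := fun k l m => .of_smooth (hf k)
  have bS : ∀ l m, UBdd r ε₁ l m S := fun l m => .sum _ fun k _ => (bβ k l m).pow 2
  have bN0 : ∀ l, UBdd r ε₁ l 0 N := fun l => by
    refine (UBdd.sqrt (c := 1 / 2) ((UBdd.const 1).sub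
      (((UBdd.mesh.pow 2).mul (UBdd.const (1 / 4))).mul (bS l 0))) (by norm_num) ?_).congr ?_
    · intro ε e0 e1 j hj
      have := (hN ε e0 e1 j (by simpa using hj)).1
      rw [div_eq_mul_one_div (ε ^ 2)] at this
      exact this
    · intro ε e0 e1 j hj
      have := (hN ε e0 e1 j (by simpa using hj)).2
      rw [this]; simp [div_eq_mul_inv, hS]
  -- `N = 1 + ε ν`. Since `N² - 1 = -(ε²/4) S`, division by `1 + N` gives a formula for `ν` without
  -- `ε` in a denominator.
  have bν0 : ∀ l, UBdd r ε₁ l 0 (fun ε j => -(ε / 4 * S ε j * (1 + N ε j)⁻¹)) := fun l => by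
    refine (((UBdd.mesh.mul (UBdd.const (1 / 4))).mul (bS l 0)).mul
      (((UBdd.const 1).add (bN0 l)).inv one_pos ?_)).neg.congr ?_
    · intro ε e0 e1 j hj
      rw [(hN ε e0 e1 j (by simpa using hj)).2]
      linarith [Real.sqrt_nonneg (1 - ε ^ 2 / 4 * ∑ k ∈ Finset.univ.erase o, β k (j * ε) ^ 2)]
    · intro ε e0 e1 j hj
      simp [div_eq_mul_inv]
  set ν : ℝ → ℕ → ℝ := fun ε j => -(ε / 4 * S ε j * (1 + N ε j)⁻¹) with hν
  have bN : ∀ l, UBdd r ε₁ l 1 N := fun l => (bN0 l).reach_succ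
  have bν : ∀ l, UBdd r ε₁ l 1 ν := fun l => (bν0 l).reach_succ
  have eN : ∀ ε, 0 < ε → ε < ε₁ → ∀ j : ℕ, j * ε ≤ r →
      N ε j = 1 + ε * ν ε j ∧ N ε j ^ 2 = 1 - ε ^ 2 / 4 * S ε j := by
    intro ε e0 e1 j hj
    obtain ⟨a, b⟩ := hN ε e0 e1 j hj
    have hn0 : 0 ≤ N ε j := b ▸ Real.sqrt_nonneg _
    have hsq : N ε j ^ 2 = 1 - ε ^ 2 / 4 * S ε j := by
      rw [b, Real.sq_sqrt (by linarith)]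
    refine ⟨?_, hsq⟩
    have : 1 + N ε j ≠ 0 := by positivity
    simp only [hν]
    field_simp
    linear_combination 4 * hsq
  have main : ∀ l, UBdd r ε₁ l 0 (fun ε j => ε⁻¹ • (F ε j - fun k => f k (j * ε))) := by
    -- `c` holds the coefficients of the recursion `δF = c F`; the entry `(o, o)` is `(2N² - 2)/ε =
    -- -(ε/2) S`, so the singular factor cancels. `g` is `ε⁻¹ (c f - f')` minus the consistency
    -- error of the difference quotient.
    let c : ι → ι → ℝ → ℕ → ℝ := fun k i ε j =>
      if k = o then (if i = o then -(ε / 2 * S ε j) else -(N ε j * β i (j * ε)))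
      else (if i = o then β k (j * ε) * N ε j else -(β k (j * ε) * (ε / 2 * β i (j * ε))))
    let g : ℝ → ℕ → ι → E := fun ε j k =>
      (if k = o then
        -(ν ε j • ∑ i ∈ Finset.univ.erase o, β i (j * ε) • f i (j * ε))
          - (1 / 2 * S ε j) • f o (j * ε)
      else β k (j * ε) • (ν ε j • f o (j * ε)
        - (1 / 2 : ℝ) • ∑ i ∈ Finset.univ.erase o, β i (j * ε) • f i (j * ε)))
      - ε⁻¹ • (diffQuot ε (fun i : ℕ => f k (i * ε)) j - deriv (f k) (j * ε))
    have bmesh : ∀ l, UBdd r ε₁ l 1 (fun ε _ => ε / 2) := fun l =>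
      UBdd.mesh.mul (UBdd.const (2⁻¹ : ℝ))
    have bsum : ∀ l, UBdd r ε₁ l 1
        (fun ε j => ∑ i ∈ Finset.univ.erase o, β i (j * ε) • f i (j * ε)) := fun l =>
      UBdd.sum _ fun i _ => (bβ i l 1).smul (bf i l 1)
    refine UBdd.of_linear_system (c := c) (g := g) ⟨0, ?_⟩ ?_ ?_ ?_
    · intro ε e0 e1
      have : F ε 0 = fun k => f k 0 := funext (h0 ε e0 e1)
      simp [this]
    · intro k i l
      simp only [c]
      split_ifs
      · exact ((bmesh l).mul (bS l 1)).neg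
      · exact ((bN l).mul (bβ i l 1)).neg
      · exact (bβ k l 1).mul (bN l)
      · exact ((bβ k l 1).mul ((bmesh l).mul (bβ i l 1))).neg
    · intro l
      refine UBdd.pi fun k => ?_
      simp only [g]
      refine UBdd.sub ?_ (UBdd.consistency (hf k))
      split_ifs
      · exact ((bν l).smul (bsum l)).neg.sub (((bS l 1).const_mul _).smul (bf o l 1))
      · exact (bβ k l 1).smul (((bν l).smul (bf o l 1)).sub ((bsum l).const_smul _))
    · intro ε e0 e1 j hj k
      have hj' := lattice_mem e0 hj
      obtain ⟨n1, n2⟩ := eN ε e0 e1 j hj'.2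
      have t := hT ε e0 e1 j hj'.2
      have e := diffQuot_error ε (F ε) (fun i : ℕ => fun k => f k (i * ε)) j
      rw [e, ← Finset.add_sum_erase _ _ (Finset.mem_univ o)]
      have split : ∀ z : ι → ℝ, ∑ i ∈ Finset.univ.erase o,
          z i • (ε⁻¹ • (F ε j - fun k => f k (j * ε))) i =
          ε⁻¹ • (∑ i ∈ Finset.univ.erase o, z i • F ε j i
            - ∑ i ∈ Finset.univ.erase o, z i • f i (j * ε)) := fun z => by
        rw [← Finset.sum_sub_distrib, Finset.smul_sum]
        refine Finset.sum_congr rfl fun i _ => ?_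
        simp only [Pi.smul_apply, Pi.sub_apply]
        module
      have pull : ∀ (w : ℝ) (z : ι → E), ∑ i ∈ Finset.univ.erase o, (w * β i (j * ε)) • z i =
          w • ∑ i ∈ Finset.univ.erase o, β i (j * ε) • z i := fun w z => by
        simp only [mul_smul, Finset.smul_sum]
      by_cases hk : k = o
      · subst hk
        have hc : ∑ i ∈ Finset.univ.erase k,
            c k i ε j • (ε⁻¹ • (F ε j - fun k => f k (j * ε))) i =
            ∑ i ∈ Finset.univ.erase k,
            (-N ε j * β i (j * ε)) • (ε⁻¹ • (F ε j - fun k => f k (j * ε))) i :=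
          Finset.sum_congr rfl fun i hi => by
            simp only [c, if_pos, if_neg (Finset.ne_of_mem_erase hi), neg_mul]
        rw [hc, split, pull, pull]
        simp only [c, g, if_pos, hfo _ hj', Pi.smul_apply, Pi.sub_apply, diffQuot,
          (hF ε e0 e1 j hj).1, t]
        generalize ∑ i ∈ Finset.univ.erase k, β i (j * ε) • F ε j i = sF
        generalize ∑ i ∈ Finset.univ.erase k, β i (j * ε) • f i (j * ε) = sf
        have hν' : ν ε j = (N ε j - 1) / ε := by rw [n1]; field_simp; ring
        have hS' : S ε j = 4 * (1 - N ε j ^ 2) / ε ^ 2 := by rw [n2]; field_simp; ring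
        rw [hν', hS']
        match_scalars <;> field_simp <;> ring
      · have hc : ∑ i ∈ Finset.univ.erase o,
            c k i ε j • (ε⁻¹ • (F ε j - fun k => f k (j * ε))) i =
            ∑ i ∈ Finset.univ.erase o,
            ((-(β k (j * ε) * (ε / 2))) * β i (j * ε)) •
              (ε⁻¹ • (F ε j - fun k => f k (j * ε))) i :=
          Finset.sum_congr rfl fun i hi => by
            simp only [c, if_neg hk, if_neg (Finset.ne_of_mem_erase hi)]
            congr 1; ring
        rw [hc, split, pull, pull]
        simp only [c, g, if_pos, if_neg hk, hfk k hk _ hj', Pi.smul_apply, Pi.sub_apply, diffQuot,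
          (hF ε e0 e1 j hj).2 k hk, t]
        generalize ∑ i ∈ Finset.univ.erase o, β i (j * ε) • F ε j i = sF
        generalize ∑ i ∈ Finset.univ.erase o, β i (j * ε) • f i (j * ε) = sf
        have hν' : ν ε j = (N ε j - 1) / ε := by rw [n1]; field_simp; ring
        rw [hν']
        match_scalars <;> field_simp <;> ring
  refine ⟨main l, ?_⟩
  have bE : ∀ k, UBdd r ε₁ l 0 (fun ε j => ε⁻¹ • (F ε j k - f k (j * ε))) := fun k =>
    (main l).proj k
  -- Substituting `F = f + ε · ε⁻¹ (F - f)` in the formula for `T` exhibits its error over `ε` as a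
  -- combination of bounded families.
  have bsum : UBdd r ε₁ l 0 (fun ε j => ∑ i ∈ Finset.univ.erase o,
      β i (j * ε) • (f i (j * ε) + ε • ε⁻¹ • (F ε j i - f i (j * ε)))) :=
    UBdd.sum _ fun i _ => (bβ i l 0).smul ((bf i l 0).add (UBdd.mesh.smul (bE i)))
  refine ((((bν0 l).smul (bf o l 0)).add ((bN0 l).smul (bE o))).sub
    (bsum.const_smul (1 / 2))).congr fun ε e0 e1 j hj => ?_
  have hj : (j : ℝ) * ε ≤ r := by simpa using hj
  obtain ⟨n1, n2⟩ := eN ε e0 e1 j hj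
  rw [hT ε e0 e1 j hj]
  have : ∑ i ∈ Finset.univ.erase o,
      β i (j * ε) • (f i (j * ε) + ε • ε⁻¹ • (F ε j i - f i (j * ε))) =
      ∑ i ∈ Finset.univ.erase o, β i (j * ε) • F ε j i := by
    refine Finset.sum_congr rfl fun i _ => ?_
    rw [smul_inv_smul₀ e0.ne']
    congr 1; abel
  rw [this]
  generalize ∑ i ∈ Finset.univ.erase o, β i (j * ε) • F ε j i = sF
  have hν' : ν ε j = (N ε j - 1) / ε := by rw [n1]; field_simp; ring
  rw [hν']
  match_scalars <;> field_simp <;> ring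

/-- Convergence of the solution of an explicit first order equation for a curve. -/
theorem curve_convergence {F : Type*} [NormedAddCommGroup F] [NormedSpace ℝ F]
    {x : ℝ → ℕ → F} {X t : ℝ → F} {T : ℝ → ℕ → F} {h : ℝ → ℝ} (hX : ContDiff ℝ ∞ X)
    (hh : ContDiff ℝ ∞ h) (hX' : ∀ ξ ∈ Icc 0 r, deriv X ξ = h ξ • t ξ)
    (hx : ∀ ε, 0 < ε → ε < ε₁ → ∀ j : ℕ, ((j : ℝ) + 1) * ε ≤ r →
      x ε (j + 1) = x ε j + (ε * h (j * ε)) • T ε j)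
    (h0 : ∀ ε, 0 < ε → ε < ε₁ → x ε 0 = X 0)
    (hT : ∀ l, UBdd r ε₁ l 0 (fun ε j => ε⁻¹ • (T ε j - t (j * ε)))) (l : ℕ) :
    UBdd r ε₁ l 0 (fun ε j => ε⁻¹ • (x ε j - X (j * ε))) := by
  refine UBdd.of_linear (A := fun _ _ => 0) (g := fun ε j =>
    h (j * ε) • (ε⁻¹ • (T ε j - t (j * ε)))
      - ε⁻¹ • (diffQuot ε (fun i : ℕ => X (i * ε)) j - deriv X (j * ε))) ⟨0, ?_⟩
    (fun l => UBdd.const 0)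
    (fun l => ((UBdd.of_smooth hh).smul (hT l).reach_succ).sub (UBdd.consistency hX)) ?_ l
  · intro ε e0 e1
    simp [h0 ε e0 e1]
  · intro ε e0 e1 j hj
    have hj' := lattice_mem e0 hj
    rw [diffQuot_error, hX' _ hj']
    simp only [diffQuot, hx ε e0 e1 j hj, zero_apply]
    match_scalars <;> field_simp <;> ring

/-- Convergence of the direction and of the length of the chord of a discrete pair. -/
theorem chord_convergence {A h : ℝ → ℝ} (hA : ContDiff ℝ ∞ A) (hh : ContDiff ℝ ∞ h)
    {t d : ℝ → E} {c : ℝ → ℝ} (ht : ContDiff ℝ ∞ t) (hd : ContDiff ℝ ∞ d) (hc : ContDiff ℝ ∞ c)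
    (hd' : ∀ ξ ∈ Icc 0 r, deriv d ξ = A ξ • t ξ - (A ξ * inner ℝ (t ξ) (d ξ)) • d ξ)
    (hc' : ∀ ξ ∈ Icc 0 r, deriv c ξ =
      -(2 * h ξ * inner ℝ (t ξ) (d ξ)) - A ξ * inner ℝ (t ξ) (d ξ) * c ξ)
    {T D : ℝ → ℕ → E} {C : ℝ → ℕ → ℝ} {N : ℝ → ℕ → ℝ}
    (hN : ∀ ε, 0 < ε → ε < ε₁ → ∀ j : ℕ, j * ε ≤ r →
      1 / 2 ≤ 1 + ε * (2 * A (j * ε) * inner ℝ (T ε j) (D ε j) + ε * A (j * ε) ^ 2) ∧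
      N ε j = √(1 + ε * (2 * A (j * ε) * inner ℝ (T ε j) (D ε j) + ε * A (j * ε) ^ 2)))
    (hD1 : ∀ ε, 0 < ε → ε < ε₁ → ∀ j : ℕ, j * ε ≤ r → ‖D ε j‖ = 1)
    (hD : ∀ ε, 0 < ε → ε < ε₁ → ∀ j : ℕ, ((j : ℝ) + 1) * ε ≤ r →
      N ε j • D ε (j + 1) = D ε j + (ε * A (j * ε)) • T ε j)
    (hC : ∀ ε, 0 < ε → ε < ε₁ → ∀ j : ℕ, ((j : ℝ) + 1) * ε ≤ r →
      N ε j * C ε (j + 1) =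
        C ε j - ε * h (j * ε) * (ε * A (j * ε) + 2 * inner ℝ (T ε j) (D ε j)))
    (hD0 : ∀ ε, 0 < ε → ε < ε₁ → D ε 0 = d 0) (hC0 : ∀ ε, 0 < ε → ε < ε₁ → C ε 0 = c 0)
    (hT : ∀ l, UBdd r ε₁ l 0 (fun ε j => ε⁻¹ • (T ε j - t (j * ε)))) (l : ℕ) :
    UBdd r ε₁ l 0 (fun ε j => ε⁻¹ • (D ε j - d (j * ε))) ∧
    UBdd r ε₁ l 0 (fun ε j => ε⁻¹ • (C ε j - c (j * ε))) := by
  have bA : ∀ l m, UBdd r ε₁ l m (fun ε j => A (j * ε)) := fun l m => .of_smooth hA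
  have bh : ∀ l m, UBdd r ε₁ l m (fun ε j => h (j * ε)) := fun l m => .of_smooth hh
  have bt : ∀ l m, UBdd r ε₁ l m (fun ε j => t (j * ε)) := fun l m => .of_smooth ht
  have bd : ∀ l m, UBdd r ε₁ l m (fun ε j => d (j * ε)) := fun l m => .of_smooth hd
  have bT : ∀ l, UBdd r ε₁ l 0 T := fun l => ((bt l 0).add (UBdd.mesh.smul (hT l))).congr
    fun ε e0 e1 j _ => by rw [smul_inv_smul₀ e0.ne']; abel
  let p : ℝ → ℕ → ℝ := fun ε j =>
    2 * A (j * ε) * inner ℝ (T ε j) (D ε j) + ε * A (j * ε) ^ 2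
  -- `1/N = 1 - ε κ` and `κ = p/2 + ε κ₂`. Both come from `N² = 1 + ε p` by rationalising, so they
  -- are bounded to every order to which `D` is.
  let κ : ℝ → ℕ → ℝ := fun ε j => p ε j * ((N ε j)⁻¹ * (1 + N ε j)⁻¹)
  let κ₂ : ℝ → ℕ → ℝ := fun ε j =>
    -(1 / 2) * (p ε j ^ 2 * (2 + N ε j) * ((N ε j)⁻¹ * (1 + N ε j)⁻¹ ^ 2))
  have hNpos : ∀ ε, 0 < ε → ε < ε₁ → ∀ j : ℕ, j * ε ≤ r →
      1 / 2 ≤ N ε j ∧ N ε j ^ 2 = 1 + ε * p ε j := by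
    intro ε e0 e1 j hj
    obtain ⟨a, b⟩ := hN ε e0 e1 j hj
    have hsq : N ε j ^ 2 = 1 + ε * p ε j := by
      rw [b, Real.sq_sqrt (by linarith)]
    refine ⟨?_, hsq⟩
    have : 0 ≤ N ε j := b ▸ Real.sqrt_nonneg _
    by_contra hlt
    push Not at hlt
    nlinarith [hsq, a]
  have bp : ∀ l, UBdd r ε₁ l 0 D → UBdd r ε₁ l 0 p := fun l hDl =>
    (((bA l 0).const_mul 2).mul ((bT l).inner hDl)).add (UBdd.mesh.mul ((bA l 0).pow 2))
  have bN : ∀ l, UBdd r ε₁ l 0 D → UBdd r ε₁ l 0 N := fun l hDl => by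
    refine (UBdd.sqrt (c := 1 / 2) ((UBdd.const 1).add (UBdd.mesh.mul (bp l hDl))) (by norm_num)
      fun ε e0 e1 j hj => (hN ε e0 e1 j (by simpa using hj)).1).congr fun ε e0 e1 j hj =>
      (hN ε e0 e1 j (by simpa using hj)).2.symm
  have bNi : ∀ l, UBdd r ε₁ l 0 D → UBdd r ε₁ l 0 (fun ε j => (N ε j)⁻¹) := fun l hDl =>
    (bN l hDl).inv (c := 1 / 2) (by norm_num) fun ε e0 e1 j hj =>
      (hNpos ε e0 e1 j (by simpa using hj)).1
  have bN1 : ∀ l, UBdd r ε₁ l 0 D → UBdd r ε₁ l 0 (fun ε j => (1 + N ε j)⁻¹) := fun l hDl =>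
    ((UBdd.const 1).add (bN l hDl)).inv (c := 1) (by norm_num) fun ε e0 e1 j hj => by
      linarith [(hNpos ε e0 e1 j (by simpa using hj)).1]
  have bκ : ∀ l, UBdd r ε₁ l 0 D → UBdd r ε₁ l 0 κ := fun l hDl =>
    (bp l hDl).mul ((bNi l hDl).mul (bN1 l hDl))
  have bκ₂ : ∀ l, UBdd r ε₁ l 0 D → UBdd r ε₁ l 0 κ₂ := fun l hDl =>
    ((((bp l hDl).pow 2).mul ((UBdd.const 2).add (bN l hDl))).mul
      ((bNi l hDl).mul ((bN1 l hDl).pow 2))).const_mul _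
  have eκ : ∀ ε, 0 < ε → ε < ε₁ → ∀ j : ℕ, j * ε ≤ r →
      (N ε j)⁻¹ = 1 - ε * κ ε j ∧ κ ε j = p ε j / 2 + ε * κ₂ ε j := by
    intro ε e0 e1 j hj
    obtain ⟨a, b⟩ := hNpos ε e0 e1 j hj
    have n0 : N ε j ≠ 0 := by linarith
    have n1 : 1 + N ε j ≠ 0 := by linarith
    have hp : p ε j = (N ε j ^ 2 - 1) / ε := by rw [b]; field_simp; ring
    simp only [κ, κ₂, hp]
    constructor <;> field_simp <;> ring
  have sD : ∀ ε, 0 < ε → ε < ε₁ → ∀ j : ℕ, ((j : ℝ) + 1) * ε ≤ r →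
      diffQuot ε (D ε) j = A (j * ε) • T ε j - κ ε j • D ε j
        - (ε * κ ε j * A (j * ε)) • T ε j := by
    intro ε e0 e1 j hj
    have hj' := (lattice_mem e0 hj).2
    obtain ⟨a, -⟩ := hNpos ε e0 e1 j hj'
    have e : D ε (j + 1) = (1 - ε * κ ε j) • (D ε j + (ε * A (j * ε)) • T ε j) := by
      rw [← hD ε e0 e1 j hj, ← (eκ ε e0 e1 j hj').1, inv_smul_smul₀ (by linarith)]
    simp only [diffQuot, e]
    match_scalars <;> field_simp <;> ring
  -- Bootstrap: `|D| = 1` gives order zero, and the right-hand side of `sD` involves only `T`, the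
  -- data and functions of `D`, so each order of `D` gives the next.
  have bD : ∀ l, UBdd r ε₁ l 0 D := by
    have hb : BddFam r ε₁ 0 D :=
      ⟨1, fun ε e0 e1 j hj => (hD1 ε e0 e1 j (by simpa using hj)).le⟩
    intro l
    induction l with
    | zero => exact hb
    | succ l ih =>
      refine ⟨hb, (((((bA l 0).smul (bT l)).sub ((bκ l ih).smul ih)).sub
        (((UBdd.mesh.mul (bκ l ih)).mul (bA l 0)).smul (bT l))).reach_succ).congr
        fun ε e0 e1 j hj => (sD ε e0 e1 j (by simpa using hj)).symm⟩
  have sC : ∀ ε, 0 < ε → ε < ε₁ → ∀ j : ℕ, ((j : ℝ) + 1) * ε ≤ r →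
      diffQuot ε (C ε) j = -(κ ε j * C ε j)
        - h (j * ε) * (1 - ε * κ ε j) * (ε * A (j * ε) + 2 * inner ℝ (T ε j) (D ε j)) := by
    intro ε e0 e1 j hj
    have hj' := (lattice_mem e0 hj).2
    obtain ⟨a, -⟩ := hNpos ε e0 e1 j hj'
    have e : C ε (j + 1) = (1 - ε * κ ε j) *
        (C ε j - ε * h (j * ε) * (ε * A (j * ε) + 2 * inner ℝ (T ε j) (D ε j))) := by
      rw [← hC ε e0 e1 j hj, ← (eκ ε e0 e1 j hj').1, inv_mul_cancel_left₀ (by linarith)]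
    simp only [diffQuot, e, smul_eq_mul]
    field_simp
    ring
  have bC : ∀ l, UBdd r ε₁ l 0 C := by
    refine UBdd.of_linear (A := fun ε j => -(κ ε j • ContinuousLinearMap.id ℝ ℝ))
      (g := fun ε j => -(h (j * ε) * (1 - ε * κ ε j) *
        (ε * A (j * ε) + 2 * inner ℝ (T ε j) (D ε j)))) ⟨‖c 0‖, ?_⟩ (fun l =>
        (((bκ l (bD l)).smul (UBdd.const _)).neg).reach_succ) (fun l => ?_) ?_
    · intro ε e0 e1
      rw [hC0 ε e0 e1]
    · exact (((bh l 0).mul ((UBdd.const 1).sub (UBdd.mesh.mul (bκ l (bD l))))).mul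
        ((UBdd.mesh.mul (bA l 0)).add (((bT l).inner (bD l)).const_mul 2))).neg.reach_succ
    · intro ε e0 e1 j hj
      rw [sC ε e0 e1 j hj]
      simp [sub_eq_add_neg]
  -- What remains of `δD` after removing `A T - A⟨T,D⟩ D`, divided by `ε`; `bRC` is the analogue for
  -- `C`.
  have bRD : ∀ l, UBdd r ε₁ l 0 (fun ε j =>
      -((1 / 2 * A (j * ε) ^ 2 + κ₂ ε j) • D ε j) - (κ ε j * A (j * ε)) • T ε j) := fun l =>
    (((((bA l 0).pow 2).const_mul _).add (bκ₂ l (bD l))).smul (bD l)).neg.sub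
      (((bκ l (bD l)).mul (bA l 0)).smul (bT l))
  have bRC : ∀ l, UBdd r ε₁ l 0 (fun ε j =>
      -((1 / 2 * A (j * ε) ^ 2 + κ₂ ε j) * C ε j) - h (j * ε) * A (j * ε)
        + κ ε j * h (j * ε) * (ε * A (j * ε) + 2 * inner ℝ (T ε j) (D ε j))) := fun l =>
    ((((((bA l 0).pow 2).const_mul _).add (bκ₂ l (bD l))).mul (bC l)).neg.sub
      ((bh l 0).mul (bA l 0))).add (((bκ l (bD l)).mul (bh l 0)).mul
        ((UBdd.mesh.mul (bA l 0)).add (((bT l).inner (bD l)).const_mul 2)))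
  have inner_T : ∀ ε, 0 < ε → ∀ j : ℕ, inner ℝ (T ε j) (D ε j) =
      inner ℝ (t (j * ε)) (d (j * ε)) + ε * (inner ℝ (ε⁻¹ • (T ε j - t (j * ε))) (D ε j)
        + inner ℝ (t (j * ε)) (ε⁻¹ • (D ε j - d (j * ε)))) := by
    intro ε e0 j
    simp only [inner_smul_left, inner_smul_right, inner_sub_left, inner_sub_right, conj_trivial]
    field_simp
    ring
  -- The nonlinearity is split asymmetrically: `⟨T,D⟩D - ⟨t,d⟩d = ⟨T-t,D⟩D + ⟨t,D-d⟩D + ⟨t,d⟩(D-d)`.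
  -- The factor `D`, already bounded to all orders, counts as a coefficient, and the equation is
  -- linear in the error.
  have main : ∀ l, UBdd r ε₁ l 0 (fun ε j => ε⁻¹ • (D ε j - d (j * ε))) := by
    refine UBdd.of_linear
      (A := fun ε j => -(A (j * ε) • ContinuousLinearMap.smulRightL ℝ E E
          (innerSL ℝ (t (j * ε))) (D ε j))
        - (A (j * ε) * inner ℝ (t (j * ε)) (d (j * ε))) • ContinuousLinearMap.id ℝ E)
      (g := fun ε j => A (j * ε) • ε⁻¹ • (T ε j - t (j * ε))
        - (A (j * ε) * inner ℝ (ε⁻¹ • (T ε j - t (j * ε))) (D ε j)) • D ε j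
        + (-((1 / 2 * A (j * ε) ^ 2 + κ₂ ε j) • D ε j) - (κ ε j * A (j * ε)) • T ε j)
        - ε⁻¹ • (diffQuot ε (fun i : ℕ => d (i * ε)) j - deriv d (j * ε)))
      ⟨0, ?_⟩ (fun l => ?_) (fun l => ?_) ?_
    · intro ε e0 e1
      simp [hD0 ε e0 e1]
    · exact (((bA l 0).smul (UBdd.bilin (ContinuousLinearMap.smulRightL ℝ E E)
        (UBdd.clm (innerSL ℝ) (bt l 0)) (bD l))).neg.sub
        (((bA l 0).mul ((bt l 0).inner (bd l 0))).smul (UBdd.const _))).reach_succ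
    · exact ((((bA l 0).smul (hT l)).sub
        (((bA l 0).mul ((hT l).inner (bD l))).smul (bD l))).add (bRD l)).reach_succ.sub
        (UBdd.consistency hd)
    · intro ε e0 e1 j hj
      have hj' := lattice_mem e0 hj
      rw [diffQuot_error, hd' _ hj', sD ε e0 e1 j hj]
      have e2 := (eκ ε e0 e1 j hj'.2).2
      have i1 := inner_T ε e0 j
      have hsm : ∀ x y z : E, ContinuousLinearMap.smulRightL ℝ E E (innerSL ℝ x) y z =
        inner ℝ x z • y := fun _ _ _ => rfl
      simp only [sub_apply, neg_apply, smul_apply, hsm, ContinuousLinearMap.id_apply]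
      generalize inner ℝ (ε⁻¹ • (T ε j - t (j * ε))) (D ε j) = a at *
      generalize inner ℝ (t (j * ε)) (ε⁻¹ • (D ε j - d (j * ε))) = b at *
      generalize inner ℝ (t (j * ε)) (d (j * ε)) = b₀ at *
      have hp : p ε j = 2 * A (j * ε) * (b₀ + ε * (a + b)) + ε * A (j * ε) ^ 2 := by
        simp only [p, i1]
      rw [hp] at e2
      have hκ₂ : κ₂ ε j = (κ ε j - (2 * A (j * ε) * (b₀ + ε * (a + b)) + ε * A (j * ε) ^ 2) / 2)
          / ε := by
        rw [eq_div_iff e0.ne']; linear_combination -e2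
      rw [hκ₂]
      match_scalars <;> field_simp <;> ring
  refine ⟨main l, ?_⟩
  refine UBdd.of_linear
    (A := fun ε j => -((A (j * ε) * inner ℝ (t (j * ε)) (d (j * ε))) •
      ContinuousLinearMap.id ℝ ℝ))
    (g := fun ε j => -(2 * h (j * ε) * (inner ℝ (ε⁻¹ • (T ε j - t (j * ε))) (D ε j)
        + inner ℝ (t (j * ε)) (ε⁻¹ • (D ε j - d (j * ε)))))
      - A (j * ε) * (inner ℝ (ε⁻¹ • (T ε j - t (j * ε))) (D ε j)
        + inner ℝ (t (j * ε)) (ε⁻¹ • (D ε j - d (j * ε)))) * C ε j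
      + (-((1 / 2 * A (j * ε) ^ 2 + κ₂ ε j) * C ε j) - h (j * ε) * A (j * ε)
        + κ ε j * h (j * ε) * (ε * A (j * ε) + 2 * inner ℝ (T ε j) (D ε j)))
      - ε⁻¹ • (diffQuot ε (fun i : ℕ => c (i * ε)) j - deriv c (j * ε)))
    ⟨0, ?_⟩ (fun l => ?_) (fun l => ?_) ?_ l
  · intro ε e0 e1
    simp [hC0 ε e0 e1]
  · exact (((bA l 0).mul ((bt l 0).inner (bd l 0))).smul (UBdd.const _)).neg.reach_succ
  · have bi := ((hT l).inner (bD l)).add ((bt l 0).inner (main l))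
    exact ((((((bh l 0).const_mul 2).mul bi).neg.sub (((bA l 0).mul bi).mul (bC l))).add
      (bRC l)).reach_succ).sub (UBdd.consistency hc)
  · intro ε e0 e1 j hj
    have hj' := lattice_mem e0 hj
    rw [diffQuot_error, hc' _ hj', sC ε e0 e1 j hj]
    have e2 := (eκ ε e0 e1 j hj'.2).2
    have i1 := inner_T ε e0 j
    simp only [neg_apply, smul_apply, ContinuousLinearMap.id_apply, smul_eq_mul]
    have hp : p ε j = 2 * A (j * ε) * inner ℝ (T ε j) (D ε j) + ε * A (j * ε) ^ 2 := rfl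
    rw [hp] at e2
    rw [i1] at e2 ⊢
    generalize inner ℝ (ε⁻¹ • (T ε j - t (j * ε))) (D ε j) = a at *
    generalize inner ℝ (t (j * ε)) (ε⁻¹ • (D ε j - d (j * ε))) = b at *
    generalize inner ℝ (t (j * ε)) (d (j * ε)) = b₀ at *
    have hκ₂ : κ₂ ε j = (κ ε j - (2 * A (j * ε) * (b₀ + ε * (a + b)) + ε * A (j * ε) ^ 2) / 2)
        / ε := by
      rw [eq_div_iff e0.ne']; linear_combination -e2
    rw [hκ₂]
    field_simp
    ring

end Convergence

end RibPair

noncomputable section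

namespace RibPair

/-! ### The action of `ℋ_∞` on vectors -/

section Action

variable {n : ℕ}

theorem lor_apply (u v : Mink n) :
    lor n u v = inner ℝ u.1 v.1 + u.2.1 * v.2.1 - u.2.2 * v.2.2 := rfl

theorem lor_comm (u v : Mink n) : lor n u v = lor n v u := by
  simp only [lor_apply, real_inner_comm, mul_comm]

theorem vec_add (u v : Mink n) : vec (u + v) = vec u + vec v := map_add _ u v

theorem vec_sub (u v : Mink n) : vec (u - v) = vec u - vec v := map_sub _ u v

theorem vec_neg (u : Mink n) : vec (-u) = -vec u := map_neg _ u

theorem vec_smul (c : ℝ) (u : Mink n) : vec (c • u) = c • vec u := map_smul _ c u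

theorem vec_sum {ι : Type*} (s : Finset ι) (u : ι → Mink n) :
    vec (∑ k ∈ s, u k) = ∑ k ∈ s, vec (u k) := map_sum _ u s

theorem vec_mul_vec_self (u : Mink n) : vec u * vec u = algebraMap ℝ (Cl n) (-lor n u u) := by
  rw [CliffordAlgebra.ι_sq_scalar]; rfl

theorem vec_mul_vec_add (u v : Mink n) :
    vec u * vec v + vec v * vec u = algebraMap ℝ (Cl n) (-2 * lor n u v) := by
  rw [CliffordAlgebra.ι_mul_ι_add_swap]
  congr 1
  simp only [QuadraticMap.polar, Q, neg_apply, LinearMap.BilinMap.toQuadraticMap_apply,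
    map_add, LinearMap.add_apply, lor_comm v u]
  ring

theorem vec_mul_comm (u v : Mink n) :
    vec u * vec v = algebraMap ℝ (Cl n) (-2 * lor n u v) - vec v * vec u :=
  eq_sub_of_add_eq (vec_mul_vec_add u v)

theorem algebraMap_Cl_injective (n : ℕ) : Function.Injective (algebraMap ℝ (Cl n)) :=
  (algebraMap ℝ (Cl n)).injective

theorem act_eq {ψ : Hinf n} {v w : Mink n}
    (h : vec w = ((ψ : (Cl n)ˣ)⁻¹ : (Cl n)ˣ) * vec v * ((ψ : (Cl n)ˣ) : Cl n)) : act ψ v = w :=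
  vec_injective n ((act_spec ψ v).trans h.symm)

theorem act_add (ψ : Hinf n) (u v : Mink n) : act ψ (u + v) = act ψ u + act ψ v :=
  act_eq (by simp only [map_add, act_spec, mul_add, add_mul])

theorem act_smul (ψ : Hinf n) (c : ℝ) (v : Mink n) : act ψ (c • v) = c • act ψ v :=
  act_eq (by simp only [map_smul, act_spec, mul_smul_comm, smul_mul_assoc])

/-- The action of a frame as a linear map. -/
def actLin (ψ : Hinf n) : Mink n →ₗ[ℝ] Mink n where
  toFun := act ψ
  map_add' := act_add ψ
  map_smul' := act_smul ψ

theorem actLin_apply (ψ : Hinf n) (v : Mink n) : actLin ψ v = act ψ v := rfl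

theorem act_one (v : Mink n) : act (1 : Hinf n) v = v := act_eq (by simp)

theorem act_mul (φ ψ : Hinf n) (v : Mink n) : act (φ * ψ) v = act ψ (act φ v) :=
  act_eq (by
    simp only [act_spec, Subgroup.coe_mul, mul_inv_rev, Units.val_mul]
    simp only [mul_assoc])

theorem lor_act (ψ : Hinf n) (u v : Mink n) : lor n (act ψ u) (act ψ v) = lor n u v := by
  have h := vec_mul_vec_add (act ψ u) (act ψ v)
  have key : ∀ a b : Mink n, vec (act ψ a) * vec (act ψ b) =
      ((ψ : (Cl n)ˣ)⁻¹ : (Cl n)ˣ) * (vec a * vec b) * ((ψ : (Cl n)ˣ) : Cl n) := fun a b => by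
    rw [act_spec, act_spec]
    simp only [mul_assoc, Units.mul_inv_cancel_left]
  rw [key, key, ← add_mul, ← mul_add, vec_mul_vec_add, ← Algebra.commutes, mul_assoc,
    Units.inv_mul, mul_one] at h
  have := algebraMap_Cl_injective n h
  linarith

/-- A unit vector orthogonal to `e_∞`, as an element of `ℋ_∞`. -/
def vecH (u : Mink n) (h1 : lor n u u = 1) (h2 : lor n u eInf = 0) : Hinf n :=
  ⟨⟨vec u, -vec u, by rw [mul_neg, vec_mul_vec_self, h1]; simp,
      by rw [neg_mul, vec_mul_vec_self, h1]; simp⟩,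
    Subgroup.subset_closure ⟨u, rfl, by rw [vec_mul_vec_self, h1]; simp, h2⟩⟩

theorem coe_vecH (u : Mink n) (h1 : lor n u u = 1) (h2 : lor n u eInf = 0) :
    ((vecH u h1 h2 : (Cl n)ˣ) : Cl n) = vec u := rfl

theorem coe_vecH_inv (u : Mink n) (h1 : lor n u u = 1) (h2 : lor n u eInf = 0) :
    (((vecH u h1 h2 : (Cl n)ˣ)⁻¹ : (Cl n)ˣ) : Cl n) = -vec u := rfl

/-- Here `u⁻¹ = -u`, so the action is `v ↦ -u v u`, minus the reflection in the hyperplane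
orthogonal to `u`. -/
theorem act_vecH (u : Mink n) (h1 : lor n u u = 1) (h2 : lor n u eInf = 0) (v : Mink n) :
    act (vecH u h1 h2) v = (2 * lor n u v) • u - v := by
  apply act_eq
  rw [coe_vecH, coe_vecH_inv, neg_mul, neg_mul, vec_mul_comm u v, sub_mul, mul_assoc (vec v),
    vec_mul_vec_self, h1, vec_sub, vec_smul, ← Algebra.smul_def]
  simp [sub_eq_add_neg, add_comm]

/-- Each generator is orthogonal to `e_∞` and therefore reverses its sign. This sign does not affect
spatial parts, since `e_∞` has none. -/
theorem act_eInf (ψ : Hinf n) : act ψ eInf = eInf ∨ act ψ eInf = -eInf := by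
  obtain ⟨g, hg⟩ := ψ
  induction hg using Subgroup.closure_induction with
  | mem x hx =>
    obtain ⟨u, hu, h1, h2⟩ := hx
    right
    have h1' : lor n u u = 1 := by
      rw [vec_mul_vec_self] at h1
      have := algebraMap_Cl_injective n (h1.trans (by simp : (-1 : Cl n) = algebraMap ℝ _ (-1)))
      linarith
    have hx : (⟨x, Subgroup.subset_closure ⟨u, hu, h1, h2⟩⟩ : Hinf n) = vecH u h1' h2 :=
      Subtype.ext (Units.ext hu)
    rw [hx, act_vecH, h2]
    simp
  | one => exact Or.inl (act_one _)
  | mul x y hx hy ihx ihy =>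
    have e : (⟨x * y, Subgroup.mul_mem _ hx hy⟩ : Hinf n) =
      (⟨x, hx⟩ : Hinf n) * (⟨y, hy⟩ : Hinf n) := rfl
    rw [e, act_mul]
    have hneg : act (⟨y, hy⟩ : Hinf n) (-eInf) = -act (⟨y, hy⟩ : Hinf n) eInf :=
      map_neg (actLin (⟨y, hy⟩ : Hinf n)) _
    rcases ihx with a | a <;> rcases ihy with b | b <;> rw [a] <;>
      simp only [hneg, b, neg_neg, true_or, or_true]
  | inv x hx ih =>
    have e : act ((⟨x, hx⟩ : Hinf n) * (⟨x, hx⟩ : Hinf n)⁻¹) (eInf : Mink n) = eInf := by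
      rw [mul_inv_cancel, act_one]
    have e2 : (⟨x⁻¹, Subgroup.inv_mem _ hx⟩ : Hinf n) = (⟨x, hx⟩ : Hinf n)⁻¹ := rfl
    rw [act_mul] at e
    rw [e2]
    have hneg : act (⟨x, hx⟩ : Hinf n)⁻¹ (-eInf) = -act (⟨x, hx⟩ : Hinf n)⁻¹ eInf :=
      map_neg (actLin (⟨x, hx⟩ : Hinf n)⁻¹) _
    rcases ih with a | a <;> rw [a] at e
    · exact Or.inl e
    · rw [hneg] at e
      exact Or.inr (neg_eq_iff_eq_neg.1 e)

theorem act_eInf_fst (ψ : Hinf n) : (act ψ eInf).1 = 0 := by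
  rcases act_eInf ψ with h | h <;> rw [h] <;> simp [eInf]

theorem lor_act_eInf {ψ : Hinf n} {v : Mink n} (h : lor n v eInf = 0) :
    lor n (act ψ v) eInf = 0 := by
  have := lor_act ψ v eInf
  rw [h] at this
  rcases act_eInf ψ with a | a <;> rw [a] at this
  · exact this
  · simpa using this

theorem lor_eInf (v : Mink n) : lor n v eInf = -(1 / 2) * (v.2.1 + v.2.2) := by
  simp only [lor_apply, eInf, inner_zero_right]
  ring

/-- On the complement of `e_∞` the last two coordinates are opposite and their contributions cancel.
This is what permits working with spatial parts only. -/
theorem lor_eq_inner {u v : Mink n} (hu : lor n u eInf = 0) (hv : lor n v eInf = 0) :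
    lor n u v = inner ℝ u.1 v.1 := by
  rw [lor_eInf] at hu hv
  have a : u.2.2 = -u.2.1 := by linarith
  have b : v.2.2 = -v.2.1 := by linarith
  rw [lor_apply, a, b]
  ring

/-- The vector `∑ a_k e_k + c e_∞`. -/
def combo (a : Fin (n + 2) → ℝ) (c : ℝ) : Mink n := (WithLp.toLp 2 a, -(c / 2), c / 2)

theorem combo_eq (a : Fin (n + 2) → ℝ) (c : ℝ) :
    (combo a c : Mink n) = ∑ k, a k • e k + c • eInf := by
  have h1 : ∀ s : Finset (Fin (n + 2)), (∑ k ∈ s, a k • (e k : Mink n)) =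
      (∑ k ∈ s, a k • EuclideanSpace.single k (1 : ℝ), 0, 0) := by
    intro s
    induction s using Finset.induction_on with
    | empty => simp; rfl
    | insert b s hb ih => rw [Finset.sum_insert hb, ih, Finset.sum_insert hb]; simp [e]
  rw [h1]
  ext i
  · simp [combo, eInf, EuclideanSpace.single, Pi.single_apply]
  · simp [combo, eInf]; ring
  · simp [combo, eInf]; ring

theorem lor_combo (a b : Fin (n + 2) → ℝ) (c d : ℝ) :
    lor n (combo a c) (combo b d) = ∑ k, a k * b k := by
  simp only [lor_apply, combo, PiLp.inner_apply]
  simp [mul_comm]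

theorem e_eq_combo (k : Fin (n + 2)) : (e k : Mink n) = combo (Pi.single k 1) 0 := by
  ext i <;> simp [e, combo, EuclideanSpace.single]

theorem lor_combo_eInf (a : Fin (n + 2) → ℝ) (c : ℝ) : lor n (combo a c) eInf = 0 := by
  rw [lor_eInf]; simp [combo]

theorem lor_e_eInf (k : Fin (n + 2)) : lor n (e k) eInf = 0 := by
  rw [e_eq_combo, lor_combo_eInf]

theorem lor_combo_e (a : Fin (n + 2) → ℝ) (c : ℝ) (k : Fin (n + 2)) :
    lor n (combo a c) (e k) = a k := by
  rw [e_eq_combo, lor_combo]; simp [Pi.single_apply]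

theorem lor_e_e (k i : Fin (n + 2)) : lor n (e k) (e i) = if k = i then 1 else 0 := by
  rw [e_eq_combo k, lor_combo_e]; simp [Pi.single_apply, eq_comm]

theorem lor_combo_eZero (a : Fin (n + 2) → ℝ) (c : ℝ) :
    lor n (combo a c) eZero = -(c / 2) := by
  simp only [lor_apply, combo, eZero, inner_zero_right]
  ring

theorem act_combo_fst (ψ : Hinf n) (a : Fin (n + 2) → ℝ) (c : ℝ) :
    (act ψ (combo a c)).1 = ∑ k, a k • (act ψ (e k)).1 := by
  rw [combo_eq, act_add, act_smul, Prod.fst_add, Prod.smul_fst, act_eInf_fst, smul_zero, add_zero,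
    ← actLin_apply, map_sum, Prod.fst_sum]
  simp only [map_smul, Prod.smul_fst, actLin_apply]

/-- The spatial parts of the frame vectors are orthonormal. -/
theorem orthonormal_frame (ψ : Hinf n) : Orthonormal ℝ fun k => (act ψ (e k)).1 := by
  rw [orthonormal_iff_ite]
  intro i j
  rw [← lor_eq_inner (lor_act_eInf (lor_e_eInf i)) (lor_act_eInf (lor_e_eInf j)), lor_act, lor_e_e]

/-- The transition `-w e_i` along an edge in direction `i`, for `w = ∑ a_k e_k + c e_∞`. -/
def edge (i : Fin (n + 2)) (a : Fin (n + 2) → ℝ) (c : ℝ) (ha : ∑ k, a k * a k = 1) : Hinf n :=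
  vecH (combo (-a) (-c)) (by rw [lor_combo]; simpa using ha) (lor_combo_eInf _ _) *
    vecH (e i) (by rw [lor_e_e, if_pos rfl]) (lor_e_eInf i)

theorem combo_neg (a : Fin (n + 2) → ℝ) (c : ℝ) : (combo (-a) (-c) : Mink n) = -combo a c := by
  ext i
  · simp [combo]
  · simp [combo]; ring
  · simp [combo]; ring

theorem coe_edge (i : Fin (n + 2)) (a : Fin (n + 2) → ℝ) (c : ℝ) (ha : ∑ k, a k * a k = 1) :
    ((edge i a c ha : (Cl n)ˣ) : Cl n) = -(vec (combo a c) * vec (e i)) := by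
  rw [edge, Subgroup.coe_mul, Units.val_mul, coe_vecH, coe_vecH, combo_neg, vec_neg, neg_mul]

/-- The direction of an edge, up to the `e_∞` component. -/
def edgeDir (ψ : Hinf n) (i : Fin (n + 2)) (a : Fin (n + 2) → ℝ) : E n :=
  (2 * a i) • (act ψ (e i)).1 - ∑ k, a k • (act ψ (e k)).1

theorem act_edge_mul_fst (i : Fin (n + 2)) (a : Fin (n + 2) → ℝ) (c : ℝ)
    (ha : ∑ k, a k * a k = 1) (ψ : Hinf n) (v : Mink n) :
    (act (edge i a c ha * ψ) v).1 = (act ψ v).1 - (2 * lor n (e i) v) • (act ψ (e i)).1 +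
      (2 * lor n (combo a c) v) • edgeDir ψ i a := by
  rw [act_mul, edge, act_mul, act_vecH, act_vecH, combo_neg]
  simp only [map_neg, map_sub, map_smul, LinearMap.neg_apply, smul_eq_mul,
    lor_comm (e i) (combo a c), lor_combo_e]
  simp only [← actLin_apply, map_sub, map_smul, map_neg]
  simp only [actLin_apply, Prod.fst_sub, Prod.smul_fst, Prod.fst_neg, act_combo_fst, edgeDir]
  module

theorem act_edge_mul_e (i : Fin (n + 2)) (a : Fin (n + 2) → ℝ) (c : ℝ)
    (ha : ∑ k, a k * a k = 1) (ψ : Hinf n) (k : Fin (n + 2)) :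
    (act (edge i a c ha * ψ) (e k)).1 =
      (if k = i then -(act ψ (e i)).1 else (act ψ (e k)).1) + (2 * a k) • edgeDir ψ i a := by
  rw [act_edge_mul_fst, lor_e_e, lor_combo_e]
  split_ifs with h1 h2 h2
  · subst h1; module
  · exact absurd h1.symm h2
  · exact absurd h2.symm h1
  · module

/-- Among the components of the two reflecting vectors only the `e_∞` part of `w` pairs with `e_0`,
and `⟨e_∞, e_0⟩ = -1/2` gives the factor `-c`. With `c = -ε h` the point advances by `ε h` along the
edge direction. -/
theorem point_edge_mul (i : Fin (n + 2)) (a : Fin (n + 2) → ℝ) (c : ℝ)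
    (ha : ∑ k, a k * a k = 1) (ψ : Hinf n) :
    point (edge i a c ha * ψ) = point ψ - c • edgeDir ψ i a := by
  have h0 : lor n (e i) (eZero : Mink n) = 0 := by
    rw [e_eq_combo, lor_combo_eZero]; simp
  rw [point, act_edge_mul_fst, lor_combo_eZero, h0, point]
  module

theorem edgeDir_eq (ψ : Hinf n) (i : Fin (n + 2)) (a : Fin (n + 2) → ℝ) :
    edgeDir ψ i a = a i • (act ψ (e i)).1 - ∑ k ∈ Finset.univ.erase i, a k • (act ψ (e k)).1 := by
  rw [edgeDir, ← Finset.add_sum_erase _ _ (Finset.mem_univ i)]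
  module

theorem inner_edgeDir (ψ : Hinf n) (i j : Fin (n + 2)) (hij : i ≠ j) (a b : Fin (n + 2) → ℝ) :
    inner ℝ (edgeDir ψ i a) (edgeDir ψ j b) = -(2 * a i * b i) - 2 * a j * b j
      + ∑ k, a k * b k := by
  have ho := orthonormal_iff_ite.1 (orthonormal_frame ψ)
  have h1 := (orthonormal_frame ψ).inner_right_fintype b i
  have h2 := (orthonormal_frame ψ).inner_left_fintype a j
  have h3 := (orthonormal_frame ψ).inner_sum a b Finset.univ
  simp only [conj_trivial] at h2 h3
  simp only [edgeDir, inner_sub_left, inner_sub_right, inner_smul_left, inner_smul_right,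
    conj_trivial, h1, h2, h3, ho i j, if_neg hij]
  ring

theorem norm_edgeDir (ψ : Hinf n) (i : Fin (n + 2)) (a : Fin (n + 2) → ℝ)
    (ha : ∑ k, a k * a k = 1) : ‖edgeDir ψ i a‖ = 1 := by
  have ho := orthonormal_iff_ite.1 (orthonormal_frame ψ)
  have h1 := (orthonormal_frame ψ).inner_right_fintype a i
  have h2 := (orthonormal_frame ψ).inner_left_fintype a i
  have h3 := (orthonormal_frame ψ).inner_sum a a Finset.univ
  simp only [conj_trivial] at h2 h3
  have : inner ℝ (edgeDir ψ i a) (edgeDir ψ i a) = (1 : ℝ) := by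
    simp only [edgeDir, inner_sub_left, inner_sub_right, inner_smul_left, inner_smul_right,
      conj_trivial, h1, h2, h3, ho i i, if_pos, ha]
    ring
  rw [real_inner_self_eq_norm_sq] at this
  nlinarith [norm_nonneg (edgeDir ψ i a)]

theorem edgeDir_inner_frame (ψ : Hinf n) (i : Fin (n + 2)) (a : Fin (n + 2) → ℝ) :
    inner ℝ (edgeDir ψ i a) (act ψ (e i)).1 = a i := by
  have h2 := (orthonormal_frame ψ).inner_left_fintype a i
  have ho := orthonormal_iff_ite.1 (orthonormal_frame ψ) i i
  simp only [conj_trivial, if_pos] at h2 ho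
  rw [edgeDir, inner_sub_left, inner_smul_left, h2, ho, conj_trivial]
  ring

/-- Multiplication by a transition is one step of the moving frame equation. -/
theorem edge_sub_one (i : Fin (n + 2)) {ε N h : ℝ} (hε : ε ≠ 0) {b a : Fin (n + 2) → ℝ}
    (hai : a i = N) (hak : ∀ k, k ≠ i → a k = ε / 2 * b k) (ha : ∑ k, a k * a k = 1) :
    ((edge i a (-(ε * h)) ha : (Cl n)ˣ) : Cl n) = 1 + ε • frameCoeff i ε N b h := by
  have hs : ∑ k, a k • (vec (e k) * vec (e i) : Cl n) =
      -(algebraMap ℝ (Cl n) N) +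
        (ε / 2) • ∑ k ∈ Finset.univ.erase i, b k • (vec (e k) * vec (e i)) := by
    rw [← Finset.add_sum_erase _ _ (Finset.mem_univ i), vec_mul_vec_self, lor_e_e, if_pos rfl, hai,
      Finset.smul_sum]
    congr 1
    · rw [Algebra.smul_def, ← map_mul]; simp
    · refine Finset.sum_congr rfl fun k hk => ?_
      rw [hak k (Finset.ne_of_mem_erase hk), mul_smul]
  rw [coe_edge, combo_eq, vec_add, vec_sum, add_mul, Finset.sum_mul]
  simp only [vec_smul, smul_mul_assoc]
  rw [hs, frameCoeff]
  have : algebraMap ℝ (Cl n) N = 1 + ε • algebraMap ℝ (Cl n) ((N - 1) / ε) := by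
    rw [Algebra.smul_def, ← map_mul, mul_div_cancel₀ _ hε, map_sub, map_one]; abel
  rw [this]
  module

theorem frame_step (i : Fin (n + 2)) {ε N h : ℝ} (hε : ε ≠ 0) {b a : Fin (n + 2) → ℝ}
    (hai : a i = N) (hak : ∀ k, k ≠ i → a k = ε / 2 * b k) (ha : ∑ k, a k * a k = 1)
    (ψ : Hinf n) :
    ε⁻¹ • ((((edge i a (-(ε * h)) ha * ψ : Hinf n) : (Cl n)ˣ) : Cl n) - ((ψ : (Cl n)ˣ) : Cl n)) =
      frameCoeff i ε N b h * ((ψ : (Cl n)ˣ) : Cl n) := by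
  rw [Subgroup.coe_mul, Units.val_mul, edge_sub_one i hε hai hak ha, add_mul, one_mul,
    add_sub_cancel_left, smul_mul_assoc, inv_smul_smul₀ hε]

/-- The coordinates with the sign of the coordinate `i` reversed. -/
def flip (i : Fin (n + 2)) (a : Fin (n + 2) → ℝ) : Fin (n + 2) → ℝ :=
  fun k => if k = i then -a k else a k

theorem combo_flip (i : Fin (n + 2)) (a : Fin (n + 2) → ℝ) (c : ℝ) :
    (combo (flip i a) c : Mink n) = combo a c - (2 * a i) • e i := by
  rw [e_eq_combo]
  ext k
  · by_cases h : k = i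
    · subst h; simp [combo, flip]; ring
    · simp [combo, flip, h]
  · simp [combo]
  · simp [combo]

theorem vec_e_mul_combo (i : Fin (n + 2)) (a : Fin (n + 2) → ℝ) (c : ℝ) :
    (vec (e i) * vec (combo a c) : Cl n) = -(vec (combo (flip i a) c) * vec (e i)) := by
  rw [vec_mul_comm, combo_flip, vec_sub, vec_smul, sub_mul, smul_mul_assoc, vec_mul_vec_self,
    lor_comm, lor_combo_e, lor_e_e, if_pos rfl, neg_sub, Algebra.smul_def,
    ← (algebraMap ℝ (Cl n)).map_mul]
  congr 2
  ring

/-- The compatibility of the transitions around an elementary quadrilateral. -/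
theorem edge_comm (i j : Fin (n + 2)) (hij : i ≠ j) {a b a' b' : Fin (n + 2) → ℝ}
    {c d c' d' ν ρ σ : ℝ} (ha : ∑ k, a k * a k = 1) (hb : ∑ k, b k * b k = 1)
    (ha' : ∑ k, a' k * a' k = 1) (hb' : ∑ k, b' k * b' k = 1) (hν : ν ≠ 0)
    (e1 : ∀ k, ν * a' k = flip j a k + ρ * flip i b k) (e1' : ν * c' = c + ρ * d)
    (e2 : ∀ k, ν * b' k = flip i b k + σ * flip j a k) (e2' : ν * d' = d + σ * c)
    (hρσ : ρ + σ = -2 * ∑ k, flip j a k * flip i b k) :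
    edge i a' c' ha' * edge j b d hb = edge j b' d' hb' * edge i a c ha := by
  have h1 : ν • (combo a' c' : Mink n) = combo (flip j a) c + ρ • combo (flip i b) d := by
    ext k
    · simpa [combo] using e1 k
    · simp [combo]; linear_combination -(1 / 2) * e1'
    · simp [combo]; linear_combination (1 / 2) * e1'
  have h2 : ν • (combo b' d' : Mink n) = combo (flip i b) d + σ • combo (flip j a) c := by
    ext k
    · simpa [combo] using e2 k
    · simp [combo]; linear_combination -(1 / 2) * e2'
    · simp [combo]; linear_combination (1 / 2) * e2'
  have hp : ∑ k, flip j a k * flip j a k = 1 := by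
    rw [← ha]; refine Finset.sum_congr rfl fun k _ => ?_
    simp only [flip]; split_ifs <;> ring
  have hq : ∑ k, flip i b k * flip i b k = 1 := by
    rw [← hb]; refine Finset.sum_congr rfl fun k _ => ?_
    simp only [flip]; split_ifs <;> ring
  have hpp := vec_mul_vec_self (combo (flip j a) c : Mink n)
  have hqq := vec_mul_vec_self (combo (flip i b) d : Mink n)
  have hpq := vec_mul_vec_add (combo (flip j a) c : Mink n) (combo (flip i b) d)
  rw [lor_combo] at hpp hqq hpq
  rw [hp] at hpp
  rw [hq] at hqq
  rw [← hρσ] at hpq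
  have hee := vec_mul_vec_add (e i : Mink n) (e j)
  rw [lor_e_e, if_neg hij] at hee
  refine Subtype.ext (Units.ext ?_)
  rw [Subgroup.coe_mul, Subgroup.coe_mul, Units.val_mul, Units.val_mul, coe_edge, coe_edge,
    coe_edge, coe_edge]
  have k1 := vec_e_mul_combo i b d
  have k2 := vec_e_mul_combo j a c
  have g1 := congrArg (vec : Mink n → Cl n) h1
  have g2 := congrArg (vec : Mink n → Cl n) h2
  rw [vec_add, vec_smul, vec_smul] at g1 g2
  generalize vec (combo (flip j a) c) = p at *
  generalize vec (combo (flip i b) d) = q at *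
  generalize vec (combo a' c') = wa at *
  generalize vec (combo b' d') = wb at *
  -- Moving `e_i` past `w_b` and `e_j` past `w_a` flips one coordinate each, and `e_i e_j` splits
  -- off on the right. What remains is `-(p + ρ q) q = (q + σ p) p`, which by `p² = q² = -1` is the
  -- relation `p q + q p = ρ + σ`.
  have l1 : ν • (-(wa * vec (e i)) * -(vec (combo b d) * vec (e j))) =
      ν • (-(wb * vec (e j)) * -(vec (combo a c) * vec (e i)) : Cl n) := by
    have s1 : -(wa * vec (e i)) * -(vec (combo b d) * vec (e j)) =
        -(wa * q * (vec (e i) * vec (e j))) := by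
      rw [neg_mul_neg, mul_assoc, ← mul_assoc (vec (e i)), k1]
      simp only [mul_assoc, neg_mul, mul_neg]
    have s2 : -(wb * vec (e j)) * -(vec (combo a c) * vec (e i)) =
        -(wb * p * (vec (e j) * vec (e i))) := by
      rw [neg_mul_neg, mul_assoc, ← mul_assoc (vec (e j)), k2]
      simp only [mul_assoc, neg_mul, mul_neg]
    have s3 : (vec (e j) * vec (e i) : Cl n) = -(vec (e i) * vec (e j)) := by
      rw [eq_neg_iff_add_eq_zero, add_comm, hee]; simp
    have hpq' : p * q + q * p = (ρ + σ) • (1 : Cl n) := by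
      rw [hpq, Algebra.algebraMap_eq_smul_one]
    have hpp' : p * p = -1 := by rw [hpp]; simp
    have hqq' : q * q = -1 := by rw [hqq]; simp
    rw [s1, s2, s3, mul_neg, neg_neg, smul_neg, ← smul_mul_assoc, ← smul_mul_assoc,
      ← smul_mul_assoc, ← smul_mul_assoc, g1, g2, ← neg_mul]
    congr 1
    rw [add_mul, add_mul, smul_mul_assoc, smul_mul_assoc, hpp', hqq']
    have : p * q = (ρ + σ) • (1 : Cl n) - q * p := eq_sub_of_add_eq hpq'
    rw [this]
    module
  exact smul_right_injective _ hν l1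

end Action

end RibPair

end

noncomputable section

namespace RibPair

/-! ### The discrete Goursat problem -/

section Discrete

variable {n : ℕ}

theorem flip_flip (i : Fin (n + 2)) (a : Fin (n + 2) → ℝ) : flip i (flip i a) = a := by
  ext k; simp only [flip]; split_ifs <;> simp

theorem sum_flip_mul_flip {i j : Fin (n + 2)} (hij : i ≠ j) (a b : Fin (n + 2) → ℝ) :
    ∑ k, flip j a k * flip i b k = -(2 * a i * b i) - 2 * a j * b j + ∑ k, a k * b k := by
  have : ∀ k, flip j a k * flip i b k = (if k = i then -(2 * a i * b i) else 0)
      + (if k = j then -(2 * a j * b j) else 0) + a k * b k := by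
    intro k
    by_cases h1 : k = i
    · subst h1; simp [flip, hij]; ring
    · by_cases h2 : k = j
      · subst h2; simp [flip, h1]; ring
      · simp [flip, h1, h2]
  simp only [this, Finset.sum_add_distrib, Finset.sum_ite_eq', Finset.mem_univ, if_true]
  ring

theorem sum_flip_sq (i : Fin (n + 2)) (a : Fin (n + 2) → ℝ) :
    ∑ k, flip i a k * flip i a k = ∑ k, a k * a k :=
  Finset.sum_congr rfl fun k _ => by simp only [flip]; split_ifs <;> ring

/-- `|p + ρ q|² = 1 + 2ρ⟨p,q⟩ + ρ² = 1 - ρσ`, so `ν` is the normalising factor that keeps transition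
vectors of unit length. -/
theorem sum_sq_combination {p q w : Fin (n + 2) → ℝ} {ν ρ σ : ℝ} (hp : ∑ k, p k * p k = 1)
    (hq : ∑ k, q k * q k = 1) (hν : ν ≠ 0) (hν2 : ν ^ 2 = 1 - σ * ρ)
    (hρσ : ρ + σ = -2 * ∑ k, p k * q k) (hw : ∀ k, w k = (p k + ρ * q k) / ν) :
    ∑ k, w k * w k = 1 := by
  have : ∀ k, w k * w k = (p k * p k + 2 * ρ * (p k * q k) + ρ ^ 2 * (q k * q k)) / ν ^ 2 :=
    fun k => by rw [hw]; field_simp; ring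
  simp only [this, ← Finset.sum_div, Finset.sum_add_distrib, ← Finset.mul_sum, hp, hq]
  rw [div_eq_one_iff_eq (pow_ne_zero 2 hν), hν2]
  linear_combination ρ * hρσ

theorem edgeDir_eq_sum_flip (ψ : Hinf n) (i : Fin (n + 2)) (a : Fin (n + 2) → ℝ) :
    edgeDir ψ i a = -∑ k, flip i a k • (act ψ (e k)).1 := by
  have : ∀ k, flip i a k • (act ψ (e k)).1 = a k • (act ψ (e k)).1
      - (if k = i then (2 * a i) • (act ψ (e i)).1 else 0) := by
    intro k
    by_cases h : k = i
    · subst h; simp only [flip, if_true]; module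
    · simp [flip, h]
  simp only [this, Finset.sum_sub_distrib, Finset.sum_ite_eq', Finset.mem_univ, if_true, edgeDir]
  abel

/-- Gives the algebraic quantity in `rho` its meaning: it is the inner product of the two edge
directions at a vertex, whatever the frame there. -/
theorem inner_edgeDir_eq (ψ : Hinf n) {i j : Fin (n + 2)} (hij : i ≠ j)
    (a b : Fin (n + 2) → ℝ) :
    inner ℝ (edgeDir ψ i a) (edgeDir ψ j b) = ∑ k, flip j a k * flip i b k := by
  rw [inner_edgeDir ψ i j hij, sum_flip_mul_flip hij]

/-- The change of the edge directions `j` along an edge in direction `i`. -/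
theorem edgeDir_step (ψ : Hinf n) {i j : Fin (n + 2)} {a b b' : Fin (n + 2) → ℝ}
    {c ν ρ σ : ℝ} (ha : ∑ k, a k * a k = 1)
    (hb' : ∀ k, ν * b' k = flip i b k + σ * flip j a k)
    (hρσ : ρ + σ = -2 * ∑ k, flip j a k * flip i b k) :
    ν • edgeDir (edge i a c ha * ψ) j b' = edgeDir ψ j b + ρ • edgeDir ψ i a := by
  have h0 : ∀ k, ν * flip j b' k = flip j (flip i b) k + σ * a k := by
    intro k
    have := hb' k
    by_cases h : k = j
    · subst h; simp only [flip, if_true] at this ⊢; linarith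
    · simp only [flip, if_neg h] at this ⊢; exact this
  have h1 : ∀ k, ν • (flip j b' k • (act (edge i a c ha * ψ) (e k)).1) =
      flip j b k • (act ψ (e k)).1 + σ • (flip i a k • (act ψ (e k)).1)
      + (2 * (flip j a k * flip i b k)) • edgeDir ψ i a
      + (2 * σ * (a k * a k)) • edgeDir ψ i a := by
    intro k
    rw [act_edge_mul_e, smul_smul, h0]
    by_cases h : k = i <;> by_cases h' : k = j <;> simp only [flip, h, h', if_true, if_false]
    · subst h; subst h'; simp only [if_true]; module
    · subst h; simp only [h', if_false]; module
    · subst h'; simp only [h, if_false]; module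
    · module
  -- Summed over `k`, the multiples of `T = edgeDir ψ i a` are `-σ`, `-(ρ + σ)` and `2σ`, in total
  -- `-ρ`.
  rw [edgeDir_eq_sum_flip _ j b', smul_neg, Finset.smul_sum, Finset.sum_congr rfl fun k _ => h1 k]
  simp only [Finset.sum_add_distrib, ← Finset.sum_smul, ← Finset.smul_sum, ← Finset.mul_sum, ha]
  have h2 := edgeDir_eq_sum_flip ψ i a
  have h3 := edgeDir_eq_sum_flip ψ j b
  rw [eq_neg_iff_add_eq_zero, add_comm, ← eq_neg_iff_add_eq_zero] at h2 h3
  rw [h2, h3]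
  have h4 : 2 * ∑ k, flip j a k * flip i b k = -(ρ + σ) := by rw [hρσ]; ring
  rw [h4]
  module

/-- The transition along an edge, trivial if the coefficients are not admissible. -/
def edgeOr (i : Fin (n + 2)) (a : Fin (n + 2) → ℝ) (c : ℝ) : Hinf n :=
  open Classical in if ha : ∑ k, a k * a k = 1 then edge i a c ha else 1

theorem edgeOr_eq (i : Fin (n + 2)) {a : Fin (n + 2) → ℝ} (c : ℝ) (ha : ∑ k, a k * a k = 1) :
    edgeOr i a c = edge i a c ha := dif_pos ha

/-- The coefficients of the transition along an edge of mesh size `ε` in direction 1. -/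
def coef (ε : ℝ) (β : Fin (n + 2) → ℝ) : Fin (n + 2) → ℝ :=
  fun k => if k = 0 then √(radicand 0 ε β) else ε / 2 * β k

theorem sum_coef_sq {ε : ℝ} {β : Fin (n + 2) → ℝ} (h : 0 ≤ radicand 0 ε β) :
    ∑ k, coef ε β k * coef ε β k = 1 := by
  rw [← Finset.add_sum_erase _ _ (Finset.mem_univ 0)]
  have : ∑ k ∈ Finset.univ.erase 0, coef ε β k * coef ε β k =
      ε ^ 2 / 4 * ∑ k ∈ Finset.univ.erase 0, β k ^ 2 := by
    rw [Finset.mul_sum]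
    refine Finset.sum_congr rfl fun k hk => ?_
    rw [coef, if_neg (Finset.ne_of_mem_erase hk)]
    ring
  rw [this, coef, if_pos rfl, Real.mul_self_sqrt h, radicand]
  ring

/-- The quantity `ρ_{12}` in terms of the transition coefficients and of `ρ = ρ_{21}`. -/
def rho (a b : Fin (n + 2) → ℝ) (ρ : ℝ) : ℝ := -ρ - 2 * ∑ k, flip 1 a k * flip 0 b k

/-- The quantity `n`. -/
def nu (a b : Fin (n + 2) → ℝ) (ρ : ℝ) : ℝ := √(1 - rho a b ρ * ρ)

/-- The independent variables of the discrete evolution. -/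
structure DState (n : ℕ) where
  ψ : Hinf n
  b : Fin (n + 2) → ℝ
  h : ℝ

/-- One step of the discrete evolution. -/
def DState.step (ε h1 α : ℝ) (β : Fin (n + 2) → ℝ) (S : DState n) : DState n where
  ψ := edgeOr 0 (coef ε β) (-(ε * h1)) * S.ψ
  b := fun k => (flip 0 S.b k + rho (coef ε β) S.b (ε * α) * flip 1 (coef ε β) k) /
    nu (coef ε β) S.b (ε * α)
  h := (S.h + ε * rho (coef ε β) S.b (ε * α) * h1) / nu (coef ε β) S.b (ε * α)

/-- The discrete evolution with given data on the first line. -/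
def dseq (S₀ : DState n) (H1 : ℝ → ℝ) (B1 : Fin (n + 2) → ℝ → ℝ) (A : ℝ → ℝ) (ε : ℝ) :
    ℕ → DState n
  | 0 => S₀
  | j + 1 => (dseq S₀ H1 B1 A ε j).step ε (H1 (j * ε)) (A (j * ε)) (fun k => B1 k (j * ε))

/-- The dependent variables of the discrete system, obtained from the discrete evolution. -/
def dfields (S₀ : DState n) (H1 : ℝ → ℝ) (B1 : Fin (n + 2) → ℝ → ℝ) (A : ℝ → ℝ) (ε : ℝ) :
    Fields n where
  ψ := fun j => (dseq S₀ H1 B1 A ε j).ψ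
  ψp := fun j => edgeOr 1 (dseq S₀ H1 B1 A ε j).b (-(dseq S₀ H1 B1 A ε j).h) *
    (dseq S₀ H1 B1 A ε j).ψ
  h1 := fun j => H1 (j * ε)
  h1p := fun j => (H1 (j * ε) + A (j * ε) * (dseq S₀ H1 B1 A ε j).h) /
    nu (coef ε fun k => B1 k (j * ε)) (dseq S₀ H1 B1 A ε j).b (ε * A (j * ε))
  h2 := fun j => (dseq S₀ H1 B1 A ε j).h
  α := fun j => A (j * ε)
  β1 := fun j k => B1 k (j * ε)
  β1p := fun j k => 2 / ε * ((flip 1 (coef ε fun k => B1 k (j * ε)) k +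
    ε * A (j * ε) * flip 0 (dseq S₀ H1 B1 A ε j).b k) /
    nu (coef ε fun k => B1 k (j * ε)) (dseq S₀ H1 B1 A ε j).b (ε * A (j * ε)))
  β2 := fun j k => 2 * (dseq S₀ H1 B1 A ε j).b k

theorem rho_add (a b : Fin (n + 2) → ℝ) (ρ : ℝ) :
    ρ + rho a b ρ = -2 * ∑ k, flip 1 a k * flip 0 b k := by rw [rho]; ring

/-- The radicand is `1 + 2ρ⟨T,D⟩ + ρ²` with unit vectors `T`, `D`, so Cauchy–Schwarz bounds it below
by `1 - 2/8`. The trivial frame serves to realise the coefficients as such vectors. -/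
theorem rho_bound {a b : Fin (n + 2) → ℝ} {ρ : ℝ} (ha : ∑ k, a k * a k = 1)
    (hb : ∑ k, b k * b k = 1) (hρ : |ρ| ≤ 1 / 8) : 1 / 2 ≤ 1 - rho a b ρ * ρ := by
  have h1 := norm_edgeDir (1 : Hinf n) 0 a ha
  have h2 := norm_edgeDir (1 : Hinf n) 1 b hb
  have h3 := abs_real_inner_le_norm (edgeDir (1 : Hinf n) 0 a) (edgeDir (1 : Hinf n) 1 b)
  rw [h1, h2, inner_edgeDir_eq _ zero_ne_one] at h3
  rw [rho]
  set x := ∑ k, flip 1 a k * flip 0 b k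
  have h4 : |ρ * x| ≤ 1 / 8 * 1 := by
    rw [abs_mul]
    exact mul_le_mul hρ (by simpa using h3) (abs_nonneg _) (by norm_num)
  nlinarith [neg_le_of_abs_le h4, sq_nonneg ρ]

/-- The admissible data of the discrete evolution. -/
structure Admissible (r ε : ℝ) (S₀ : DState n) (B1 : Fin (n + 2) → ℝ → ℝ) (A : ℝ → ℝ) :
    Prop where
  pos : 0 < ε
  rad : ∀ j : ℕ, j * ε ≤ r → 1 / 2 ≤ radicand 0 ε (fun k => B1 k (j * ε))
  alpha : ∀ j : ℕ, j * ε ≤ r → |ε * A (j * ε)| ≤ 1 / 8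
  init : ∑ k, S₀.b k * S₀.b k = 1

variable {r ε : ℝ} {S₀ : DState n} {H1 : ℝ → ℝ} {B1 : Fin (n + 2) → ℝ → ℝ} {A : ℝ → ℝ}

theorem Admissible.coef_sq (h : Admissible r ε S₀ B1 A) {j : ℕ} (hj : j * ε ≤ r) :
    ∑ k, coef ε (fun k => B1 k (j * ε)) k * coef ε (fun k => B1 k (j * ε)) k = 1 :=
  sum_coef_sq (by linarith [h.rad j hj])

/-- The normalisation by `nu` preserves unit length, so the recursion stays admissible without
further smallness conditions. -/
theorem Admissible.b_sq (h : Admissible r ε S₀ B1 A) {j : ℕ} (hj : j * ε ≤ r) :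
    ∑ k, (dseq S₀ H1 B1 A ε j).b k * (dseq S₀ H1 B1 A ε j).b k = 1 := by
  induction j with
  | zero => exact h.init
  | succ j ih =>
    have hj' : (j : ℝ) * ε ≤ r := by push_cast at hj; nlinarith [h.pos]
    have hb := ih hj'
    have ha := h.coef_sq hj'
    have hn := rho_bound ha hb (h.alpha j hj')
    refine sum_sq_combination (p := flip 0 (dseq S₀ H1 B1 A ε j).b)
      (q := flip 1 (coef ε fun k => B1 k (j * ε))) (σ := ε * A (j * ε))
      (ρ := rho (coef ε fun k => B1 k (j * ε)) (dseq S₀ H1 B1 A ε j).b (ε * A (j * ε)))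
      (by rw [sum_flip_sq, hb]) (by rw [sum_flip_sq, ha])
      (Real.sqrt_pos.2 (by linarith)).ne' (Real.sq_sqrt (by linarith) |>.trans (by ring)) ?_
      fun k => rfl
    rw [add_comm, rho_add]
    simp only [mul_comm]

theorem Admissible.nu_spec (h : Admissible r ε S₀ B1 A) {j : ℕ} (hj : j * ε ≤ r) :
    1 / 2 ≤ 1 - rho (coef ε fun k => B1 k (j * ε)) (dseq S₀ H1 B1 A ε j).b (ε * A (j * ε)) *
      (ε * A (j * ε)) ∧
    0 < nu (coef ε fun k => B1 k (j * ε)) (dseq S₀ H1 B1 A ε j).b (ε * A (j * ε)) :=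
  ⟨rho_bound (h.coef_sq hj) (h.b_sq hj) (h.alpha j hj), Real.sqrt_pos.2 (by
    linarith [rho_bound (h.coef_sq hj) (h.b_sq (H1 := H1) hj) (h.alpha j hj)])⟩

theorem Admissible.ψ_succ (h : Admissible r ε S₀ B1 A) {j : ℕ} (hj : j * ε ≤ r) :
    (dseq S₀ H1 B1 A ε (j + 1)).ψ = edge 0 (coef ε fun k => B1 k (j * ε)) (-(ε * H1 (j * ε)))
      (h.coef_sq hj) * (dseq S₀ H1 B1 A ε j).ψ := by
  rw [← edgeOr_eq]; rfl

theorem Admissible.b_succ (h : Admissible r ε S₀ B1 A) {j : ℕ} (hj : j * ε ≤ r)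
    (k : Fin (n + 2)) :
    nu (coef ε fun k => B1 k (j * ε)) (dseq S₀ H1 B1 A ε j).b (ε * A (j * ε)) *
      (dseq S₀ H1 B1 A ε (j + 1)).b k = flip 0 (dseq S₀ H1 B1 A ε j).b k +
      rho (coef ε fun k => B1 k (j * ε)) (dseq S₀ H1 B1 A ε j).b (ε * A (j * ε)) *
        flip 1 (coef ε fun k => B1 k (j * ε)) k :=
  mul_div_cancel₀ _ (h.nu_spec hj).2.ne'

theorem Admissible.h_succ (h : Admissible r ε S₀ B1 A) {j : ℕ} (hj : j * ε ≤ r) :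
    nu (coef ε fun k => B1 k (j * ε)) (dseq S₀ H1 B1 A ε j).b (ε * A (j * ε)) *
      (dseq S₀ H1 B1 A ε (j + 1)).h = (dseq S₀ H1 B1 A ε j).h +
      ε * rho (coef ε fun k => B1 k (j * ε)) (dseq S₀ H1 B1 A ε j).b (ε * A (j * ε)) *
        H1 (j * ε) :=
  mul_div_cancel₀ _ (h.nu_spec hj).2.ne'

/-- The discrete evolution solves the discrete Goursat problem as long as the component `b_2` has
the sign `s`. -/
theorem Admissible.isGoursatSolution (h : Admissible r ε S₀ B1 A) {s : ℝ} (hs : s * s = 1)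
    (hsign : ∀ j : ℕ, j * ε ≤ r → 0 < s * (dseq S₀ H1 B1 A ε j).b 1)
    {B2 : Fin (n + 2) → ℝ} (hB2 : ∀ k, k ≠ 1 → 2 * S₀.b k = B2 k) :
    IsGoursatSolution s ε r S₀.ψ H1 B1 A S₀.h B2 (dfields S₀ H1 B1 A ε) := by
  have hε := h.pos
  have hε0 := hε.ne'
  set S := dfields S₀ H1 B1 A ε with hS
  set D := dseq S₀ H1 B1 A ε with hD
  set a : ℕ → Fin (n + 2) → ℝ := fun j => coef ε fun k => B1 k (j * ε) with ha_def
  have h01 : (0 : Fin (n + 2)) ≠ 1 := zero_ne_one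
  have h10 : (1 : Fin (n + 2)) ≠ 0 := one_ne_zero
  have ha : ∀ j : ℕ, j * ε ≤ r → ∑ k, a j k * a j k = 1 := fun j hj => h.coef_sq hj
  have hb : ∀ j : ℕ, j * ε ≤ r → ∑ k, (D j).b k * (D j).b k = 1 := fun j hj => h.b_sq hj
  have a0 : ∀ j : ℕ, a j 0 = S.N1 ε j := fun j => if_pos rfl
  have ak : ∀ j k, k ≠ 0 → a j k = ε / 2 * S.β1 j k := fun j k hk => if_neg hk
  have a0pos : ∀ j : ℕ, j * ε ≤ r → 1 / 2 ≤ a j 0 := fun j hj => by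
    rw [a0]
    refine Real.le_sqrt_of_sq_le ?_
    have := h.rad j hj
    change _ ≤ radicand 0 ε (fun k => B1 k (j * ε))
    linarith
  have split1 : ∀ w : Fin (n + 2) → ℝ, ∑ k ∈ Finset.univ.erase 1, w k ^ 2 =
      ∑ k, w k * w k - w 1 ^ 2 := fun w => by
    rw [← Finset.add_sum_erase _ _ (Finset.mem_univ (1 : Fin (n + 2)))]
    simp only [← sq]; ring
  have split0 : ∀ w : Fin (n + 2) → ℝ, ∑ k ∈ Finset.univ.erase 0, w k ^ 2 =
      ∑ k, w k * w k - w 0 ^ 2 := fun w => by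
    rw [← Finset.add_sum_erase _ _ (Finset.mem_univ (0 : Fin (n + 2)))]
    simp only [← sq]; ring
  have rad2 : ∀ j : ℕ, j * ε ≤ r → radicand 1 1 (S.β2 j) = (s * (D j).b 1) ^ 2 := by
    intro j hj
    have : ∑ k ∈ Finset.univ.erase 1, S.β2 j k ^ 2 =
        4 * ∑ k ∈ Finset.univ.erase 1, (D j).b k ^ 2 := by
      rw [Finset.mul_sum]
      exact Finset.sum_congr rfl fun k _ => by
        change (2 * (D j).b k) ^ 2 = _; ring
    rw [radicand, this, split1, hb j hj, mul_pow, sq s, hs]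
    ring
  -- `b` is half of `β_{k2}` off the index `1` and carries `N_2` itself at the index `1`. Unit
  -- length makes its square the radicand, and `hsign` selects the root.
  have N2 : ∀ j : ℕ, j * ε ≤ r → S.N2 s j = (D j).b 1 := by
    intro j hj
    rw [Fields.N2, rad2 j hj, Real.sqrt_sq (hsign j hj).le, ← mul_assoc, hs, one_mul]
  have hρ : ∀ j : ℕ, j * ε ≤ r → S.ρ12 s ε j = rho (a j) (D j).b (ε * A (j * ε)) := by
    intro j hj
    have hsum : ∀ w : Fin (n + 2) → ℝ, ∑ k, w k =
        w 0 + (w 1 + ∑ k ∈ (Finset.univ.erase 0).erase 1, w k) := fun w => by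
      rw [Finset.add_sum_erase _ _ (Finset.mem_erase.2 ⟨h10, Finset.mem_univ _⟩),
        Finset.add_sum_erase _ _ (Finset.mem_univ _)]
    have hΘ : ε * S.Θ j = 2 * ∑ k ∈ (Finset.univ.erase 0).erase 1, a j k * (D j).b k := by
      rw [Fields.Θ, Finset.mul_sum, Finset.mul_sum, Finset.mul_sum]
      refine Finset.sum_congr rfl fun k hk => ?_
      rw [ak j k (Finset.ne_of_mem_erase (Finset.mem_of_mem_erase hk))]
      change ε * (1 / 2 * (S.β1 j k * (2 * (D j).b k))) = _
      ring
    rw [rho, sum_flip_mul_flip h01, hsum, Fields.ρ12, N2 j hj, ← a0, ak j 1 h10]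
    change a j 0 * (2 * (D j).b 0) + ε * ((D j).b 1 * S.β1 j 1 - S.Θ j - A (j * ε)) = _
    linear_combination -hΘ
  have hn : ∀ j : ℕ, j * ε ≤ r → S.nf s ε j = nu (a j) (D j).b (ε * A (j * ε)) := by
    intro j hj
    rw [Fields.nf, hρ j hj]; rfl
  have hnpos : ∀ j : ℕ, j * ε ≤ r → 0 < nu (a j) (D j).b (ε * A (j * ε)) := fun j hj =>
    (h.nu_spec hj).2
  set a' : ℕ → Fin (n + 2) → ℝ := fun j k => (flip 1 (a j) k + ε * A (j * ε) * flip 0 (D j).b k) /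
    nu (a j) (D j).b (ε * A (j * ε)) with ha'_def
  have ha' : ∀ j : ℕ, j * ε ≤ r → ∑ k, a' j k * a' j k = 1 := fun j hj =>
    sum_sq_combination (p := flip 1 (a j)) (q := flip 0 (D j).b)
      (σ := rho (a j) (D j).b (ε * A (j * ε))) (ρ := ε * A (j * ε))
      (by rw [sum_flip_sq, ha j hj]) (by rw [sum_flip_sq, hb j hj]) (hnpos j hj).ne'
      (Real.sq_sqrt (by linarith [(h.nu_spec (H1 := H1) hj).1])) (rho_add _ _ _) fun k => rfl
  -- The numerator is `N_1 - εA b_0 ≥ 1/2 - 1/8`. Positivity is needed because `N_1` on the second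
  -- line is defined as the positive root.
  have a'0 : ∀ j : ℕ, j * ε ≤ r → 0 < a' j 0 := by
    intro j hj
    refine div_pos ?_ (hnpos j hj)
    simp only [flip, if_neg h01, if_true]
    have hb0 : |(D j).b 0| ≤ 1 := by
      rw [← sq_le_one_iff_abs_le_one, sq, ← hb j hj]
      exact Finset.single_le_sum (f := fun k => (D j).b k * (D j).b k)
        (fun k _ => mul_self_nonneg _) (Finset.mem_univ 0)
    have h3 : |ε * A (j * ε) * (D j).b 0| ≤ 1 / 8 * 1 := by
      rw [abs_mul]
      exact mul_le_mul (h.alpha j hj) hb0 (abs_nonneg _) (by norm_num)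
    have := le_of_abs_le h3
    linarith [a0pos j hj]
  have rad1p : ∀ j : ℕ, j * ε ≤ r → radicand 0 ε (S.β1p j) = a' j 0 ^ 2 := by
    intro j hj
    have : ∑ k ∈ Finset.univ.erase 0, S.β1p j k ^ 2 =
        (2 / ε) ^ 2 * ∑ k ∈ Finset.univ.erase 0, a' j k ^ 2 := by
      rw [Finset.mul_sum]
      exact Finset.sum_congr rfl fun k _ => by
        change (2 / ε * a' j k) ^ 2 = _; ring
    rw [radicand, this, split0, ha' j hj]
    field_simp
    ring
  have N1p : ∀ j : ℕ, j * ε ≤ r → S.N1p ε j = a' j 0 := by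
    intro j hj
    rw [Fields.N1p, rad1p j hj, Real.sqrt_sq (a'0 j hj).le]
  have lt : ∀ j : ℕ, (j + 1) * ε ≤ r → (j : ℝ) * ε ≤ r := fun j hj => by linarith
  have ψp : ∀ j : ℕ, (hj : j * ε ≤ r) → S.ψp j =
      edge 1 (D j).b (-(1 * (D j).h)) (hb j hj) * S.ψ j := fun j hj => by
    rw [one_mul, ← edgeOr_eq]; rfl
  have ψ1 : ∀ j : ℕ, (hj : j * ε ≤ r) → S.ψ (j + 1) =
      edge 0 (a j) (-(ε * S.h1 j)) (ha j hj) * S.ψ j := fun j hj => h.ψ_succ hj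
  have hcast : ∀ j : ℕ, (j + 1) * ε ≤ r → ((j + 1 : ℕ) : ℝ) * ε ≤ r := fun j hj => by
    push_cast; exact hj
  -- The second line was built column by column from the first. That it satisfies the direction 1
  -- equation is the closing of the elementary quadrilateral.
  have ψp1 : ∀ j : ℕ, (hj : (j + 1) * ε ≤ r) → S.ψp (j + 1) =
      edge 0 (a' j) (-(ε * S.h1p j)) (ha' j (lt j hj)) * S.ψp j := by
    intro j hj
    have hj' := lt j hj
    rw [ψp (j + 1) (hcast j hj), ψ1 j hj', ψp j hj', ← mul_assoc, ← mul_assoc]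
    congr 1
    refine (edge_comm 0 1 h01 (ha j hj') (hb j hj') _ _ (hnpos j hj').ne'
      (ρ := ε * A (j * ε)) (σ := rho (a j) (D j).b (ε * A (j * ε))) ?_ ?_ ?_ ?_
      (rho_add _ _ _)).symm
    · exact fun k => mul_div_cancel₀ _ (hnpos j hj').ne'
    · have : nu (a j) (D j).b (ε * A (j * ε)) * S.h1p j = H1 (j * ε) + A (j * ε) * (D j).h :=
        mul_div_cancel₀ _ (hnpos j hj').ne'
      change _ = -(ε * H1 (j * ε)) + _
      linear_combination -ε * this
    · exact fun k => h.b_succ hj' k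
    · have := h.h_succ (H1 := H1) hj'
      change _ = _ + _ * -(ε * H1 (j * ε))
      linear_combination -this
  refine
  { init_ψ := rfl
    init_h1 := fun j _ => rfl
    init_β1 := fun j _ k _ => rfl
    init_α := fun j _ => rfl
    init_h2 := rfl
    init_β2 := hB2
    dom_N1 := fun j hj => by
      have := h.rad j hj
      change 0 < radicand 0 ε (fun k => B1 k (j * ε))
      linarith
    dom_N1p := fun j hj => by rw [rad1p j hj]; exact pow_pos (a'0 j hj) 2
    dom_N2 := fun j hj => by rw [rad2 j hj]; exact pow_pos (hsign j hj) 2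
    dom_n := fun j hj => by
      rw [hρ j hj]
      have := (h.nu_spec (H1 := H1) hj).1
      change 0 < 1 - _ * (ε * A (j * ε))
      linarith
    d1_ψ := fun j hj => ?_
    d1_ψp := fun j hj => ?_
    d1_h2 := fun j hj => ?_
    d1_β12 := fun j hj => ?_
    d1_βk2 := fun j hj k h0 h1 => ?_
    d2_ψ := fun j hj => ?_
    d2_h1 := fun j hj => ?_
    d2_β21 := fun j hj => ?_
    d2_βk1 := fun j hj k h0 h1 => ?_ }
  · rw [ψ1 j (lt j hj)]
    exact frame_step 0 hε0 (a0 j) (fun k hk => ak j k hk) _ _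
  · rw [ψp1 j hj]
    refine frame_step 0 hε0 (N1p j (lt j hj)).symm (fun k hk => ?_) _ _
    change _ = ε / 2 * (2 / ε * a' j k)
    field_simp
  · have hj' := lt j hj
    rw [hρ j hj', hn j hj']
    have := h.h_succ (H1 := H1) hj'
    have hne := (hnpos j hj').ne'
    have e1 : S.h2 (j + 1) = ((D j).h + ε * rho (a j) (D j).b (ε * A (j * ε)) * H1 (j * ε)) /
      nu (a j) (D j).b (ε * A (j * ε)) := rfl
    have e2 : S.h2 j = (D j).h := rfl
    have e3 : S.h1 j = H1 (j * ε) := rfl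
    rw [e1, e2, e3]
    generalize nu (a j) (D j).b (ε * A (j * ε)) = ν at hne ⊢
    field_simp
    ring
  · have hj' := lt j hj
    have hne := (hnpos j hj').ne'
    rw [hρ j hj', hn j hj', ← a0]
    have e1 : S.β2 (j + 1) 0 = 2 * ((flip 0 (D j).b 0 + rho (a j) (D j).b (ε * A (j * ε)) *
      flip 1 (a j) 0) / nu (a j) (D j).b (ε * A (j * ε))) := rfl
    have e2 : S.β2 j 0 = 2 * (D j).b 0 := rfl
    rw [e1, e2]
    simp only [flip, if_neg h01, if_true]
    generalize nu (a j) (D j).b (ε * A (j * ε)) = ν at hne ⊢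
    field_simp
    ring
  · have hj' := lt j hj
    have hne := (hnpos j hj').ne'
    rw [hρ j hj', hn j hj']
    have e1 : S.β2 (j + 1) k = 2 * ((flip 0 (D j).b k + rho (a j) (D j).b (ε * A (j * ε)) *
      flip 1 (a j) k) / nu (a j) (D j).b (ε * A (j * ε))) := rfl
    have e2 : S.β2 j k = 2 * (D j).b k := rfl
    rw [e1, e2]
    simp only [flip, if_neg h0, if_neg h1, ak j k h0]
    generalize nu (a j) (D j).b (ε * A (j * ε)) = ν at hne ⊢
    field_simp
    ring
  · rw [ψp j hj]
    have := frame_step 1 one_ne_zero (N2 j hj).symm (b := S.β2 j) (h := (D j).h)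
      (fun k hk => by change _ = 1 / 2 * (2 * (D j).b k); ring) (hb j hj) (S.ψ j)
    rw [inv_one, one_smul] at this
    exact this
  · have hne := (hnpos j hj).ne'
    rw [hn j hj]
    have e1 : S.h1p j = (H1 (j * ε) + A (j * ε) * (D j).h) /
      nu (a j) (D j).b (ε * A (j * ε)) := rfl
    have e2 : S.h2 j = (D j).h := rfl
    have e3 : S.h1 j = H1 (j * ε) := rfl
    have e4 : S.ρ21 ε j = ε * A (j * ε) := rfl
    rw [e1, e2, e3, e4]
    generalize nu (a j) (D j).b (ε * A (j * ε)) = ν at hne ⊢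
    field_simp
    ring
  · have hne := (hnpos j hj).ne'
    rw [hn j hj, N2 j hj]
    have e1 : S.β1p j 1 = 2 / ε * ((flip 1 (a j) 1 + ε * A (j * ε) * flip 0 (D j).b 1) /
      nu (a j) (D j).b (ε * A (j * ε))) := rfl
    have e4 : S.ρ21 ε j = ε * A (j * ε) := rfl
    rw [e1, e4]
    simp only [flip, if_neg h10, if_true, ak j 1 h10]
    generalize nu (a j) (D j).b (ε * A (j * ε)) = ν at hne ⊢
    field_simp
    ring
  · have hne := (hnpos j hj).ne'
    rw [hn j hj]
    have e1 : S.β1p j k = 2 / ε * ((flip 1 (a j) k + ε * A (j * ε) * flip 0 (D j).b k) /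
      nu (a j) (D j).b (ε * A (j * ε))) := rfl
    have e2 : S.β2 j k = 2 * (D j).b k := rfl
    have e4 : S.ρ21 ε j = ε * A (j * ε) := rfl
    rw [e1, e2, e4]
    simp only [flip, if_neg h0, if_neg h1, ak j k h0]
    generalize nu (a j) (D j).b (ε * A (j * ε)) = ν at hne ⊢
    field_simp
    ring

/-- The discrete Goursat problem has at most one solution. -/
theorem IsGoursatSolution.agreeOn {s : ℝ} {Ψ : Hinf n} {H2 : ℝ} {B2 : Fin (n + 2) → ℝ}
    {S T : Fields n} (hε : 0 < ε) (hS : IsGoursatSolution s ε r Ψ H1 B1 A H2 B2 S)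
    (hT : IsGoursatSolution s ε r Ψ H1 B1 A H2 B2 T) : AgreeOn ε r S T := by
  have hβ1 : ∀ j : ℕ, j * ε ≤ r → ∀ k, k ≠ 0 → S.β1 j k = T.β1 j k := fun j hj k hk =>
    (hS.init_β1 j hj k hk).trans (hT.init_β1 j hj k hk).symm
  have hα : ∀ j : ℕ, j * ε ≤ r → S.α j = T.α j := fun j hj =>
    (hS.init_α j hj).trans (hT.init_α j hj).symm
  have hh1 : ∀ j : ℕ, j * ε ≤ r → S.h1 j = T.h1 j := fun j hj =>
    (hS.init_h1 j hj).trans (hT.init_h1 j hj).symm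
  have rad : ∀ (i : Fin (n + 2)) (δ : ℝ) (b b' : Fin (n + 2) → ℝ), (∀ k, k ≠ i → b k = b' k) →
      radicand i δ b = radicand i δ b' := fun i δ b b' hb => by
    rw [radicand, radicand, Finset.sum_congr rfl fun k hk => by
      rw [hb k (Finset.ne_of_mem_erase hk)]]
  have frame : ∀ (i : Fin (n + 2)) (δ N h : ℝ) (b b' : Fin (n + 2) → ℝ),
      (∀ k, k ≠ i → b k = b' k) → frameCoeff i δ N b h = frameCoeff i δ N b' h :=
    fun i δ N h b b' hb => by
      rw [frameCoeff, frameCoeff, Finset.sum_congr rfl fun k hk => by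
        rw [hb k (Finset.ne_of_mem_erase hk)]]
  have N1 : ∀ j : ℕ, j * ε ≤ r → S.N1 ε j = T.N1 ε j := fun j hj => by
    rw [Fields.N1, Fields.N1, rad _ _ _ _ (hβ1 j hj)]
  have N2 : ∀ j : ℕ, (∀ k, k ≠ 1 → S.β2 j k = T.β2 j k) → S.N2 s j = T.N2 s j := fun j hj => by
    rw [Fields.N2, Fields.N2, rad _ _ _ _ hj]
  have ρ21 : ∀ j : ℕ, j * ε ≤ r → S.ρ21 ε j = T.ρ21 ε j := fun j hj => by
    rw [Fields.ρ21, Fields.ρ21, hα j hj]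
  have ρ12 : ∀ j : ℕ, j * ε ≤ r → (∀ k, k ≠ 1 → S.β2 j k = T.β2 j k) →
      S.ρ12 s ε j = T.ρ12 s ε j := fun j hj hb => by
    have hΘ : S.Θ j = T.Θ j := by
      rw [Fields.Θ, Fields.Θ, Finset.sum_congr rfl fun k hk => by
        rw [hb k (Finset.ne_of_mem_erase hk),
          hβ1 j hj k (Finset.ne_of_mem_erase (Finset.mem_of_mem_erase hk))]]
    rw [Fields.ρ12, Fields.ρ12, N1 j hj, N2 j hb, hΘ, hα j hj, hβ1 j hj 1 one_ne_zero,
      hb 0 zero_ne_one]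
  have nf : ∀ j : ℕ, j * ε ≤ r → (∀ k, k ≠ 1 → S.β2 j k = T.β2 j k) →
      S.nf s ε j = T.nf s ε j := fun j hj hb => by
    rw [Fields.nf, Fields.nf, ρ12 j hj hb, ρ21 j hj]
  -- The scheme is explicit: the direction 1 equations determine the first line successively, and
  -- the direction 2 equations then give the second line in each column.
  have key : ∀ j : ℕ, j * ε ≤ r →
      S.ψ j = T.ψ j ∧ S.h2 j = T.h2 j ∧ ∀ k, k ≠ 1 → S.β2 j k = T.β2 j k := by
    intro j
    induction j with
    | zero =>
      exact fun _ => ⟨hS.init_ψ.trans hT.init_ψ.symm, hS.init_h2.trans hT.init_h2.symm,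
        fun k hk => (hS.init_β2 k hk).trans (hT.init_β2 k hk).symm⟩
    | succ j ih =>
      intro hj
      have hj1 : ((j : ℝ) + 1) * ε ≤ r := by push_cast at hj; exact hj
      have hj' : (j : ℝ) * ε ≤ r := by linarith
      obtain ⟨iψ, ih2, ib⟩ := ih hj'
      have eρ := ρ12 j hj' ib
      have en := nf j hj' ib
      refine ⟨?_, ?_, fun k hk => ?_⟩
      · have a := hS.d1_ψ j hj1
        have b := hT.d1_ψ j hj1
        rw [N1 j hj', frame 0 _ _ _ _ _ (hβ1 j hj'), hh1 j hj', iψ, ← b] at a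
        exact Subtype.ext (Units.ext (sub_left_injective
          (smul_right_injective _ (inv_ne_zero hε.ne') a)))
      · have a := hS.d1_h2 j hj1
        have b := hT.d1_h2 j hj1
        rw [eρ, en, hh1 j hj', ih2, ← b, div_left_inj' hε.ne'] at a
        exact sub_left_injective a
      · by_cases h0 : k = 0
        · subst h0
          have a := hS.d1_β12 j hj1
          have b := hT.d1_β12 j hj1
          rw [eρ, en, N1 j hj', ib 0 hk, ← b, div_left_inj' hε.ne'] at a
          exact sub_left_injective a
        · have a := hS.d1_βk2 j hj1 k h0 hk
          have b := hT.d1_βk2 j hj1 k h0 hk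
          rw [eρ, en, hβ1 j hj' k h0, ib k hk, ← b, div_left_inj' hε.ne'] at a
          exact sub_left_injective a
  intro j hj
  obtain ⟨iψ, ih2, ib⟩ := key j hj
  have en := nf j hj ib
  refine ⟨iψ, ?_, hh1 j hj, ?_, ih2, hα j hj, hβ1 j hj, fun k hk => ?_, ib⟩
  · have a := hS.d2_ψ j hj
    have b := hT.d2_ψ j hj
    rw [N2 j ib, frame 1 _ _ _ _ _ ib, ih2, iψ, ← b] at a
    exact Subtype.ext (Units.ext (sub_left_injective a))
  · have a := hS.d2_h1 j hj
    have b := hT.d2_h1 j hj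
    rw [ρ21 j hj, en, ih2, hh1 j hj, ← b] at a
    exact sub_left_injective a
  · by_cases h1 : k = 1
    · subst h1
      have a := hS.d2_β21 j hj
      have b := hT.d2_β21 j hj
      rw [ρ21 j hj, en, N2 j ib, hβ1 j hj 1 hk, ← b] at a
      exact sub_left_injective a
    · have a := hS.d2_βk1 j hj k hk h1
      have b := hT.d2_βk1 j hj k hk h1
      rw [ρ21 j hj, en, ib k h1, hβ1 j hj k hk, ← b] at a
      exact sub_left_injective a

end Discrete

end RibPair

end

noncomputable section

namespace RibPair

/-! ### Smooth curves, their frames and their transforms -/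

section Smooth

variable {n : ℕ}

/-- A smooth function on an interval around `0` agrees near `0` with a smooth function on `ℝ`. -/
theorem exists_smooth_extension {F : Type*} [NormedAddCommGroup F] [NormedSpace ℝ F] {f : ℝ → F}
    {R : ℝ} (hR : 0 < R) (hf : ContDiffOn ℝ ∞ f (Ioo (-R) R)) :
    ∃ g : ℝ → F, ContDiff ℝ ∞ g ∧ EqOn f g (Ioo (-(R / 2)) (R / 2)) := by
  let φ : ContDiffBump (0 : ℝ) := ⟨R / 2, 3 * R / 4, by positivity, by linarith⟩
  refine ⟨fun x => φ x • f x, contDiff_iff_contDiffAt.2 fun x => ?_, fun x hx => ?_⟩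
  · by_cases hx : x ∈ Ioo (-R) R
    · exact φ.contDiff.contDiffAt.smul (hf.contDiffAt (Ioo_mem_nhds hx.1 hx.2))
    · have hx' : x ∉ tsupport φ := by
        rw [φ.tsupport_eq, Metric.mem_closedBall, dist_zero_right, Real.norm_eq_abs, abs_le]
        rintro ⟨h1, h2⟩
        exact hx ⟨by change -(3 * R / 4) ≤ x at h1; linarith,
          by change x ≤ 3 * R / 4 at h2; linarith⟩
      have h0 := notMem_tsupport_iff_eventuallyEq.1 hx'
      refine (contDiffAt_const (c := (0 : F))).congr_of_eventuallyEq ?_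
      filter_upwards [h0] with y hy
      simp [hy]
  · have : φ x = 1 := φ.one_of_mem_closedBall (by
      rw [Metric.mem_closedBall, dist_zero_right, Real.norm_eq_abs, abs_le]
      exact ⟨hx.1.le, hx.2.le⟩)
    simp [this]

/-- Integral curves of smooth vector fields are smooth. -/
theorem contDiffOn_of_integralCurve {F : Type*} [NormedAddCommGroup F] [NormedSpace ℝ F]
    {v : F → F} {U : Set F} (hv : ContDiffOn ℝ ∞ v U) {y : ℝ → F} {J : Set ℝ} (hJ : IsOpen J)
    (hy : ∀ t ∈ J, HasDerivAt y (v (y t)) t) (hU : ∀ t ∈ J, y t ∈ U) : ContDiffOn ℝ ∞ y J := by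
  rw [contDiffOn_infty]
  intro m
  induction m with
  | zero =>
    exact contDiffOn_zero.2 fun t ht => (hy t ht).continuousAt.continuousWithinAt
  | succ m ih =>
    rw [Nat.cast_succ]
    refine (contDiffOn_succ_iff_deriv_of_isOpen hJ).2
      ⟨fun t ht => (hy t ht).differentiableAt.differentiableWithinAt, by simp, ?_⟩
    exact ((hv.of_le (by exact_mod_cast le_top)).comp ih hU).congr fun t ht => (hy t ht).deriv

theorem eq_zero_value_of_deriv_zero {F : Type*} [NormedAddCommGroup F] [NormedSpace ℝ F]
    {g : ℝ → F} {r : ℝ} (hg : ∀ ξ ∈ Icc 0 r, HasDerivWithinAt g 0 (Icc 0 r) ξ) :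
    ∀ ξ ∈ Icc 0 r, g ξ = g 0 := by
  refine constant_of_has_deriv_right_zero (fun ξ hξ => (hg ξ hξ).continuousWithinAt) fun ξ hξ => ?_
  exact (hg ξ ⟨hξ.1, hξ.2.le⟩).mono_of_mem_nhdsWithin (Icc_mem_nhdsGE_of_mem hξ)

/-- The unit tangent of a curve. -/
def tang (X : ℝ → E n) (ξ : ℝ) : E n := ‖deriv X ξ‖⁻¹ • deriv X ξ

/-- The linear functional `u ↦ u_{N+1} + u_{N+2}`, a multiple of the product with `e_∞`. -/
def infPart (n : ℕ) : Mink n →L[ℝ] ℝ :=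
  (ContinuousLinearMap.fst ℝ ℝ ℝ + ContinuousLinearMap.snd ℝ ℝ ℝ).comp
    (ContinuousLinearMap.snd ℝ (E n) (ℝ × ℝ))

theorem infPart_apply (v : Mink n) : infPart n v = v.2.1 + v.2.2 := rfl

theorem lor_eInf_eq_zero {v : Mink n} : lor n v eInf = 0 ↔ infPart n v = 0 := by
  rw [lor_eInf, infPart_apply]
  constructor <;> intro h <;> linarith

theorem lift_fst (x : E n) : (lift x).1 = x := by simp [lift, eZero, eInf]

theorem infPart_lift (x : E n) : infPart n (lift x) = 1 := by
  rw [infPart_apply]; simp [lift, eZero, eInf]; ring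

theorem contDiff_lift_comp {X : ℝ → E n} (hX : ContDiff ℝ ∞ X) :
    ContDiff ℝ ∞ fun t => lift (X t) := by
  unfold lift
  have := hX.norm_sq ℝ
  fun_prop

theorem HasDerivAt.fst' {F G : Type*} [NormedAddCommGroup F] [NormedSpace ℝ F]
    [NormedAddCommGroup G] [NormedSpace ℝ G] {f : ℝ → F × G} {f' : F × G} {x : ℝ}
    (h : HasDerivAt f f' x) : HasDerivAt (fun t => (f t).1) f'.1 x :=
  (ContinuousLinearMap.fst ℝ F G).hasFDerivAt.comp_hasDerivAt x h

theorem HasDerivWithinAt.fst' {F G : Type*} [NormedAddCommGroup F] [NormedSpace ℝ F]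
    [NormedAddCommGroup G] [NormedSpace ℝ G] {f : ℝ → F × G} {f' : F × G} {s : Set ℝ} {x : ℝ}
    (h : HasDerivWithinAt f f' s x) : HasDerivWithinAt (fun t => (f t).1) f'.1 s x :=
  (ContinuousLinearMap.fst ℝ F G).hasFDerivAt.comp_hasDerivWithinAt x h

theorem tangentHat_fst {X : ℝ → E n} (hX : ContDiff ℝ ∞ X) (ξ : ℝ) :
    (tangentHat X ξ).1 = tang X ξ := by
  have h := ((contDiff_lift_comp hX).differentiable (by simp) ξ).hasDerivAt
  have h1 := HasDerivAt.fst' h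
  simp only [lift_fst] at h1
  rw [tangentHat, Prod.smul_fst, ← h1.deriv, tang]

theorem infPart_tangentHat {X : ℝ → E n} (hX : ContDiff ℝ ∞ X) (ξ : ℝ) :
    infPart n (tangentHat X ξ) = 0 := by
  have h := ((contDiff_lift_comp hX).differentiable (by simp) ξ).hasDerivAt
  have h1 := (infPart n).hasFDerivAt.comp_hasDerivAt ξ h
  have h2 : (infPart n ∘ fun t => lift (X t)) = fun _ => 1 := funext fun t => infPart_lift _
  rw [h2] at h1
  have := h1.unique (hasDerivAt_const ξ (1 : ℝ))
  rw [tangentHat, map_smul, this, smul_zero]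

theorem contDiff_deriv {X : ℝ → E n} (hX : ContDiff ℝ ∞ X) : ContDiff ℝ ∞ (deriv X) :=
  ((contDiff_succ_iff_deriv (n := ∞)).1 hX).2.2

theorem contDiffAt_speed {X : ℝ → E n} (hX : ContDiff ℝ ∞ X) {ξ : ℝ} (h : deriv X ξ ≠ 0) :
    ContDiffAt ℝ ∞ (fun t => ‖deriv X t‖) ξ :=
  (contDiff_deriv hX).contDiffAt.norm ℝ h

theorem contDiffAt_tang {X : ℝ → E n} (hX : ContDiff ℝ ∞ X) {ξ : ℝ} (h : deriv X ξ ≠ 0) :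
    ContDiffAt ℝ ∞ (tang X) ξ :=
  ((contDiffAt_speed hX h).inv (norm_ne_zero_iff.2 h)).smul (contDiff_deriv hX).contDiffAt

theorem contDiffAt_tangentHat {X : ℝ → E n} (hX : ContDiff ℝ ∞ X) {ξ : ℝ} (h : deriv X ξ ≠ 0) :
    ContDiffAt ℝ ∞ (tangentHat X) ξ :=
  ((contDiffAt_speed hX h).inv (norm_ne_zero_iff.2 h)).smul
    ((contDiff_succ_iff_deriv (n := ∞)).1 (contDiff_lift_comp hX)).2.2.contDiffAt

theorem contDiffAt_deriv {F : Type*} [NormedAddCommGroup F] [NormedSpace ℝ F] {f : ℝ → F} {ξ : ℝ}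
    (h : ContDiffAt ℝ ∞ f ξ) : ContDiffAt ℝ ∞ (deriv f) ξ := by
  have h1 : ContDiffAt ℝ ∞ (fun x => fderiv ℝ f x 1) ξ :=
    (h.fderiv_right (m := ∞) (by simp)).clm_apply contDiffAt_const
  simpa using h1

theorem deriv_tangentHat_fst {X : ℝ → E n} (hX : ContDiff ℝ ∞ X) {ξ : ℝ} (h : deriv X ξ ≠ 0) :
    (deriv (tangentHat X) ξ).1 = deriv (tang X) ξ := by
  have h1 := HasDerivAt.fst' ((contDiffAt_tangentHat hX h).differentiableAt (by simp)).hasDerivAt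
  simp only [tangentHat_fst hX] at h1
  exact h1.deriv.symm

theorem infPart_deriv_tangentHat {X : ℝ → E n} (hX : ContDiff ℝ ∞ X) {ξ : ℝ}
    (h : deriv X ξ ≠ 0) : infPart n (deriv (tangentHat X) ξ) = 0 := by
  have h1 := (infPart n).hasFDerivAt.comp_hasDerivAt ξ
    ((contDiffAt_tangentHat hX h).differentiableAt (by simp)).hasDerivAt
  have h2 : (infPart n ∘ tangentHat X) = fun _ => 0 := funext fun t => infPart_tangentHat hX t
  rw [h2] at h1
  exact h1.unique (hasDerivAt_const ξ (0 : ℝ))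

theorem norm_tang {X : ℝ → E n} {ξ : ℝ} (h : deriv X ξ ≠ 0) : ‖tang X ξ‖ = 1 := by
  rw [tang, norm_smul, norm_inv, norm_norm, inv_mul_cancel₀ (norm_ne_zero_iff.2 h)]

theorem speed_smul_tang {X : ℝ → E n} {ξ : ℝ} (h : deriv X ξ ≠ 0) :
    ‖deriv X ξ‖ • tang X ξ = deriv X ξ := smul_inv_smul₀ (norm_ne_zero_iff.2 h) _

theorem hasDerivAt_tang {X : ℝ → E n} (hX : ContDiff ℝ ∞ X) {ξ : ℝ} (h : deriv X ξ ≠ 0) :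
    HasDerivAt (tang X) (deriv (tang X) ξ) ξ :=
  ((contDiffAt_tang hX h).differentiableAt (by simp)).hasDerivAt

theorem inner_tang_deriv {X : ℝ → E n} (hX : ContDiff ℝ ∞ X) {ξ : ℝ} (h : deriv X ξ ≠ 0) :
    inner ℝ (tang X ξ) (deriv (tang X) ξ) = 0 := by
  have h1 := (hasDerivAt_tang hX h).inner ℝ (hasDerivAt_tang hX h)
  have h2 : (fun t => inner ℝ (tang X t) (tang X t)) =ᶠ[nhds ξ] fun _ => (1 : ℝ) := by
    filter_upwards [(contDiff_deriv hX).continuous.continuousAt.eventually_ne h] with t ht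
    rw [real_inner_self_eq_norm_sq, norm_tang ht, one_pow]
  have h3 := (h2.hasDerivAt_iff.1 h1).unique (hasDerivAt_const ξ (1 : ℝ))
  rw [real_inner_comm (tang X ξ)] at h3
  linarith

/-! ### The orthonormal frame along the curve and its rotation coefficients -/

section Frames

variable {X : ℝ → E n} {Ψ : Hinf n} {r : ℝ} {β : Fin (n + 2) → ℝ → ℝ} {V : Fin (n + 2) → ℝ → Mink n}

/-- The vector fields of the definition of `ReadOff`. -/
def FrameFields (X : ℝ → E n) (Ψ : Hinf n) (r : ℝ) (β : Fin (n + 2) → ℝ → ℝ)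
    (V : Fin (n + 2) → ℝ → Mink n) : Prop :=
  ∀ k, k ≠ 0 → V k 0 = act Ψ (e k) ∧ ∀ ξ ∈ Icc 0 r,
    HasDerivWithinAt (V k) (β k ξ • tangentHat X ξ) (Icc 0 r) ξ ∧
    β k ξ = -lor n (V k ξ) (deriv (tangentHat X) ξ)

/-- `∂V_k` is a multiple of the lifted tangent, which is orthogonal to `e_∞`. So `⟨V_k, e_∞⟩` is
constant, it vanishes at `0`, and Lorentz products reduce to Euclidean ones. -/
theorem FrameFields.spatial (hV : FrameFields X Ψ r β V) (hX : ContDiff ℝ ∞ X)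
    (hX' : ∀ ξ ∈ Icc 0 r, deriv X ξ ≠ 0) {k : Fin (n + 2)} (hk : k ≠ 0) {ξ : ℝ}
    (hξ : ξ ∈ Icc 0 r) :
    HasDerivWithinAt (fun ξ => (V k ξ).1) (β k ξ • tang X ξ) (Icc 0 r) ξ ∧
    β k ξ = -inner ℝ (V k ξ).1 (deriv (tang X) ξ) := by
  obtain ⟨h0, h1⟩ := hV k hk
  have hinf : ∀ ξ ∈ Icc 0 r, infPart n (V k ξ) = 0 := by
    have := eq_zero_value_of_deriv_zero (r := r) (g := fun ξ => infPart n (V k ξ))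
      fun ξ hξ => by
        have := (infPart n).hasFDerivAt.comp_hasDerivWithinAt ξ (h1 ξ hξ).1
        rwa [map_smul, infPart_tangentHat hX, smul_zero] at this
    intro ξ hξ
    rw [this ξ hξ, h0, ← lor_eInf_eq_zero]
    exact lor_act_eInf (lor_e_eInf k)
  refine ⟨?_, ?_⟩
  · have := HasDerivWithinAt.fst' (h1 ξ hξ).1
    rwa [Prod.smul_fst, tangentHat_fst hX] at this
  · rw [(h1 ξ hξ).2, lor_eq_inner (lor_eInf_eq_zero.2 (hinf ξ hξ))
      (lor_eInf_eq_zero.2 (infPart_deriv_tangentHat hX (hX' ξ hξ))),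
      deriv_tangentHat_fst hX (hX' ξ hξ)]

theorem Suited.act_e_zero (hΨ : Suited Ψ X) (hX : ContDiff ℝ ∞ X) :
    (act Ψ (e 0)).1 = tang X 0 := by rw [hΨ.2, tangentHat_fst hX]

theorem Suited.point_eq (hΨ : Suited Ψ X) : point Ψ = X 0 := by
  rw [point, hΨ.1, lift_fst]

/-- The derivative of `⟨V_k, t⟩` is `β_k + ⟨V_k, t'⟩ = 0` by the choice of `β_k`, and suitedness of
the initial frame gives the value `0` at the start. -/
theorem FrameFields.inner_tang (hV : FrameFields X Ψ r β V) (hX : ContDiff ℝ ∞ X)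
    (hX' : ∀ ξ ∈ Icc 0 r, deriv X ξ ≠ 0) (hΨ : Suited Ψ X) {k : Fin (n + 2)} (hk : k ≠ 0) {ξ : ℝ}
    (hξ : ξ ∈ Icc 0 r) : inner ℝ (V k ξ).1 (tang X ξ) = 0 := by
  have := eq_zero_value_of_deriv_zero (r := r) (g := fun ξ => inner ℝ (V k ξ).1 (tang X ξ))
    fun ξ hξ => by
      obtain ⟨h1, h2⟩ := hV.spatial hX hX' hk hξ
      have := h1.inner ℝ (hasDerivAt_tang hX (hX' ξ hξ)).hasDerivWithinAt
      rw [inner_smul_left, real_inner_self_eq_norm_sq, norm_tang (hX' ξ hξ), conj_trivial] at this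
      refine this.congr_deriv ?_
      rw [h2]; ring
  rw [this ξ hξ, (hV k hk).1, ← hΨ.act_e_zero hX]
  have := orthonormal_iff_ite.1 (orthonormal_frame Ψ) k 0
  rwa [if_neg hk] at this

/-- The orthonormal frame of the curve. -/
def curveFrame (X : ℝ → E n) (V : Fin (n + 2) → ℝ → Mink n) (k : Fin (n + 2)) (ξ : ℝ) : E n :=
  if k = 0 then tang X ξ else (V k ξ).1

/-- All `V_k` change in the direction of the tangent only, to which they are orthogonal; hence their
mutual products are constant. -/
theorem FrameFields.orthonormal (hV : FrameFields X Ψ r β V) (hX : ContDiff ℝ ∞ X)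
    (hX' : ∀ ξ ∈ Icc 0 r, deriv X ξ ≠ 0) (hΨ : Suited Ψ X) {ξ : ℝ} (hξ : ξ ∈ Icc 0 r) :
    Orthonormal ℝ fun k => curveFrame X V k ξ := by
  have key : ∀ k i, k ≠ 0 → i ≠ 0 → ∀ ξ ∈ Icc 0 r,
      inner ℝ (V k ξ).1 (V i ξ).1 = if k = i then (1 : ℝ) else 0 := by
    intro k i hk hi ξ hξ
    have := eq_zero_value_of_deriv_zero (r := r) (g := fun ξ => inner ℝ (V k ξ).1 (V i ξ).1)
      fun ξ hξ => by
        have := (hV.spatial hX hX' hk hξ).1.inner ℝ (hV.spatial hX hX' hi hξ).1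
        refine this.congr_deriv ?_
        rw [inner_smul_left, inner_smul_right, real_inner_comm (V i ξ).1, hV.inner_tang hX hX' hΨ hk hξ,
          hV.inner_tang hX hX' hΨ hi hξ]
        simp
    rw [this ξ hξ, (hV k hk).1, (hV i hi).1]
    exact orthonormal_iff_ite.1 (orthonormal_frame Ψ) k i
  rw [orthonormal_iff_ite]
  intro k i
  by_cases hk : k = 0 <;> by_cases hi : i = 0
  · subst hk; subst hi
    simp [curveFrame, norm_tang (hX' ξ hξ)]
  · subst hk
    rw [curveFrame, curveFrame, if_pos rfl, if_neg hi, if_neg (Ne.symm hi), real_inner_comm,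
      hV.inner_tang hX hX' hΨ hi hξ]
  · subst hi
    rw [curveFrame, curveFrame, if_pos rfl, if_neg hk, if_neg hk, hV.inner_tang hX hX' hΨ hk hξ]
  · rw [curveFrame, curveFrame, if_neg hk, if_neg hi, key k i hk hi ξ hξ]

theorem Orthonormal.expand {f : Fin (n + 2) → E n} (hf : Orthonormal ℝ f) (x : E n) :
    x = ∑ k, inner ℝ (f k) x • f k := by
  let b := (basisOfOrthonormalOfCardEqFinrank hf (by simp)).toOrthonormalBasis
    (by simpa using hf)
  have hb : ∀ k, b k = f k := fun k => by simp [b]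
  have := b.sum_repr' x
  simp only [hb] at this
  exact this.symm

theorem FrameFields.deriv_tang (hV : FrameFields X Ψ r β V) (hX : ContDiff ℝ ∞ X)
    (hX' : ∀ ξ ∈ Icc 0 r, deriv X ξ ≠ 0) (hΨ : Suited Ψ X) {ξ : ℝ} (hξ : ξ ∈ Icc 0 r) :
    deriv (tang X) ξ = -∑ k ∈ Finset.univ.erase 0, β k ξ • curveFrame X V k ξ := by
  conv_lhs => rw [(hV.orthonormal hX hX' hΨ hξ).expand (deriv (tang X) ξ)]
  rw [← Finset.add_sum_erase _ _ (Finset.mem_univ 0)]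
  have h0 : inner ℝ (curveFrame X V 0 ξ) (deriv (tang X) ξ) = 0 := by
    rw [curveFrame, if_pos rfl, inner_tang_deriv hX (hX' ξ hξ)]
  rw [h0, zero_smul, zero_add, ← Finset.sum_neg_distrib]
  refine Finset.sum_congr rfl fun k hk => ?_
  have hk := Finset.ne_of_mem_erase hk
  rw [(hV.spatial hX hX' hk hξ).2, curveFrame, if_neg hk, neg_smul, neg_neg]

/-- The rotation coefficients are determined by the curve and the initial frame. -/
theorem FrameFields.unique {β' : Fin (n + 2) → ℝ → ℝ} {V' : Fin (n + 2) → ℝ → Mink n}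
    (hV : FrameFields X Ψ r β V) (hV' : FrameFields X Ψ r β' V') (hX : ContDiff ℝ ∞ X)
    (hX' : ∀ ξ ∈ Icc 0 r, deriv X ξ ≠ 0) (hΨ : Suited Ψ X) {k : Fin (n + 2)} (hk : k ≠ 0) {ξ : ℝ}
    (hξ : ξ ∈ Icc 0 r) : β k ξ = β' k ξ := by
  -- The difference of two such fields is orthogonal to the tangent while its derivative is
  -- tangential, so its squared length is constant, and it is zero at the start.
  have := eq_zero_value_of_deriv_zero (r := r)
    (g := fun ξ => inner ℝ ((V k ξ).1 - (V' k ξ).1) ((V k ξ).1 - (V' k ξ).1))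
    fun ξ hξ => by
      have h := (hV.spatial hX hX' hk hξ).1.sub (hV'.spatial hX hX' hk hξ).1
      refine (h.inner ℝ h).congr_deriv ?_
      rw [← sub_smul]
      simp only [Pi.sub_apply, inner_smul_left, inner_smul_right, inner_sub_left, inner_sub_right,
        hV.inner_tang hX hX' hΨ hk hξ, hV'.inner_tang hX hX' hΨ hk hξ,
        real_inner_comm (V k ξ).1 (tang X ξ), real_inner_comm (V' k ξ).1 (tang X ξ)]
      simp
  have h0 := this ξ hξ
  rw [(hV k hk).1, (hV' k hk).1, sub_self, inner_zero_left, inner_self_eq_zero, sub_eq_zero] at h0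
  rw [(hV.spatial hX hX' hk hξ).2, (hV'.spatial hX hX' hk hξ).2, h0]

end Frames

end Smooth

end RibPair

end

noncomputable section

namespace RibPair

/-! ### The differential equation of the second curve -/

section Transform

variable {n : ℕ}

/-- The right-hand side of the differential equation of the second curve: `∂Y` is the mirror image
of the unit tangent of `X` in the hyperplane orthogonal to `Y - X`, scaled by `|∂X| + A |Y - X|`. -/
def transformField (X : ℝ → E n) (A : ℝ → ℝ) (p : ℝ × E n) : E n :=
  (‖deriv X p.1‖ + A p.1 * ‖p.2 - X p.1‖) • (tang X p.1 -
    (2 * inner ℝ (tang X p.1) (p.2 - X p.1) / ‖p.2 - X p.1‖ ^ 2) • (p.2 - X p.1))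

theorem contDiffAt_transformField {X : ℝ → E n} {A : ℝ → ℝ} (hX : ContDiff ℝ ∞ X)
    (hA : ContDiff ℝ ∞ A) {p : ℝ × E n} (h1 : deriv X p.1 ≠ 0) (h2 : p.2 ≠ X p.1) :
    ContDiffAt ℝ ∞ (transformField X A) p := by
  have hne := sub_ne_zero.2 h2
  have a1 : ContDiffAt ℝ ∞ (fun p : ℝ × E n => ‖deriv X p.1‖) p :=
    (contDiffAt_speed hX h1).comp p contDiffAt_fst
  have a2 : ContDiffAt ℝ ∞ (fun p : ℝ × E n => tang X p.1) p :=
    (contDiffAt_tang hX h1).comp p contDiffAt_fst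
  have a3 : ContDiffAt ℝ ∞ (fun p : ℝ × E n => p.2 - X p.1) p :=
    contDiffAt_snd.sub (hX.contDiffAt.comp p contDiffAt_fst)
  have a4 : ContDiffAt ℝ ∞ (fun p : ℝ × E n => ‖p.2 - X p.1‖) p := a3.norm ℝ hne
  have a5 : ContDiffAt ℝ ∞ (fun p : ℝ × E n => A p.1) p := hA.contDiffAt.comp p contDiffAt_fst
  exact (a1.add (a5.mul a4)).smul (a2.sub (((contDiffAt_const.mul (a2.inner ℝ a3)).div
    (a4.pow 2) (pow_ne_zero 2 (norm_ne_zero_iff.2 hne))).smul a3))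

/-- The mirror image of `t` in the hyperplane orthogonal to `w`. -/
theorem mirror_eq {F : Type*} [NormedAddCommGroup F] [InnerProductSpace ℝ F] {u v w : F} {p q : ℝ}
    (hu : ‖u‖ = 1) (hv : ‖v‖ = 1) (hw : w ≠ 0) (hspan : v = p • u + q • w)
    (hrib : inner ℝ (v + u) w = 0) (hne : v + u ≠ 0) :
    v = u - (2 * inner ℝ u w / ‖w‖ ^ 2) • w := by
  have hw2 : ‖w‖ ^ 2 ≠ 0 := pow_ne_zero 2 (norm_ne_zero_iff.2 hw)
  have hz : inner ℝ (v + u) (v - u) = 0 := by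
    rw [inner_add_left, inner_sub_right, inner_sub_right, real_inner_self_eq_norm_sq,
      real_inner_self_eq_norm_sq, hu, hv, real_inner_comm u v]
    ring
  -- For `p = -1` the sum `v + u` would be a multiple of `w` and orthogonal to `w`, hence zero: the
  -- excluded antiparallel case.
  have hp : p + 1 ≠ 0 := by
    intro hp
    have hz' : v + u = q • w := by
      rw [hspan, eq_neg_of_add_eq_zero_left hp]; module
    rw [hz', inner_smul_left, real_inner_self_eq_norm_sq, conj_trivial] at hrib
    rcases mul_eq_zero.1 hrib with h | h
    · exact hne (by rw [hz', h, zero_smul])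
    · exact hw2 h
  have hvu : (p + 1) • (v - u) = (p - 1) • (v + u) + (2 * q) • w := by
    rw [hspan]; module
  -- Pair `hvu` with `v + u`: it is orthogonal to `v - u` by equal lengths and to `w` by assumption.
  -- So `p = 1`, and `v - u` is a multiple of `w`.
  have h1 : (p - 1) * ‖v + u‖ ^ 2 = 0 := by
    have := congrArg (fun x => inner ℝ (v + u) x) hvu
    simp only [inner_smul_right, inner_add_right (v + u) ((p - 1) • (v + u)), hz, hrib,
      real_inner_self_eq_norm_sq] at this
    linarith
  have h2 : p - 1 = 0 := (mul_eq_zero.1 h1).resolve_right (pow_ne_zero 2 (norm_ne_zero_iff.2 hne))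
  obtain ⟨γ, hγ⟩ : ∃ γ : ℝ, v - u = γ • w := by
    refine ⟨(p + 1)⁻¹ * (2 * q), ?_⟩
    rw [h2, zero_smul, zero_add] at hvu
    rw [mul_smul, ← hvu, inv_smul_smul₀ hp]
  have hv' : v = u + γ • w := by rw [← hγ]; abel
  have h3 : 2 * inner ℝ u w + γ * ‖w‖ ^ 2 = 0 := by
    rw [hv', inner_add_left, inner_add_left, inner_smul_left, real_inner_self_eq_norm_sq,
      conj_trivial] at hrib
    linarith
  have h4 : γ = -(2 * inner ℝ u w / ‖w‖ ^ 2) := by field_simp; linarith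
  rw [hv', h4]
  module

theorem norm_mirror {F : Type*} [NormedAddCommGroup F] [InnerProductSpace ℝ F] {u w : F}
    (hw : w ≠ 0) : ‖u - (2 * inner ℝ u w / ‖w‖ ^ 2) • w‖ = ‖u‖ := by
  have hw2 : ‖w‖ ≠ 0 := norm_ne_zero_iff.2 hw
  have : ‖u - (2 * inner ℝ u w / ‖w‖ ^ 2) • w‖ ^ 2 = ‖u‖ ^ 2 := by
    rw [norm_sub_sq_real, inner_smul_right, norm_smul, mul_pow, Real.norm_eq_abs, sq_abs]
    field_simp
    ring
  exact (sq_eq_sq₀ (norm_nonneg _) (norm_nonneg _)).1 this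

variable {X Y : ℝ → E n} {A : ℝ → ℝ} {r : ℝ}

theorem derivWithin_curve (hr : 0 < r) (hX : ContDiff ℝ ∞ X) {ξ : ℝ} (hξ : ξ ∈ Icc 0 r) :
    derivWithin X (Icc 0 r) ξ = deriv X ξ :=
  ((hX.differentiable (by simp) ξ).hasDerivAt.hasDerivWithinAt).derivWithin
    (uniqueDiffOn_Icc hr ξ hξ)

/-- A pair that envelopes a circle congruence solves the differential equation. -/
theorem EnvelopesCircles.derivWithin_eq (hr : 0 < r) (hX : ContDiff ℝ ∞ X)
    (h : EnvelopesCircles X Y (Icc 0 r))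
    (hA : ∀ ξ ∈ Icc 0 r, ‖derivWithin Y (Icc 0 r) ξ‖ - ‖derivWithin X (Icc 0 r) ξ‖ =
      A ξ * ‖Y ξ - X ξ‖) {ξ : ℝ} (hξ : ξ ∈ Icc 0 r) :
    derivWithin Y (Icc 0 r) ξ = transformField X A (ξ, Y ξ) := by
  have hne := sub_ne_zero.2 (h.ne ξ hξ)
  have hx := h.immersed ξ hξ
  have hy := h.immersed' ξ hξ
  obtain ⟨c, c', hj⟩ := h.jonas ξ hξ
  have hrib := h.ribaucour ξ hξ
  have hnd := h.nondegenerate ξ hξ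
  have hsp := hA ξ hξ
  rw [derivWithin_curve hr hX hξ] at hx hj hrib hnd hsp
  change inner ℝ (_ + tang X ξ) _ = _ at hrib
  change _ + tang X ξ ≠ _ at hnd
  have hy0 := norm_ne_zero_iff.2 hy
  have key := mirror_eq (norm_tang hx)
    (by rw [norm_smul, norm_inv, norm_norm, inv_mul_cancel₀ hy0]) hne
    (p := ‖derivWithin Y (Icc 0 r) ξ‖⁻¹ * ((1 + c) * ‖deriv X ξ‖))
    (q := ‖derivWithin Y (Icc 0 r) ξ‖⁻¹ * c') (by
      rw [mul_smul, mul_smul, mul_smul, speed_smul_tang hx, ← smul_add]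
      congr 1
      rw [sub_eq_iff_eq_add.1 hj]
      module) hrib hnd
  rw [inv_smul_eq_iff₀ hy0] at key
  rw [transformField, ← hsp]
  simp only [add_sub_cancel]
  exact key

/-- Solutions of the differential equation envelope a circle congruence. -/
theorem envelopesCircles_of_hasDerivWithinAt (hr : 0 < r) (hX : ContDiff ℝ ∞ X)
    (hX' : ∀ ξ ∈ Icc 0 r, deriv X ξ ≠ 0) (hne : ∀ ξ ∈ Icc 0 r, Y ξ ≠ X ξ)
    (hpos : ∀ ξ ∈ Icc 0 r, 0 < ‖deriv X ξ‖ + A ξ * ‖Y ξ - X ξ‖)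
    (hind : ∀ ξ ∈ Icc 0 r, ∃ m : E n, inner ℝ m (tang X ξ) = 0 ∧ inner ℝ m (Y ξ - X ξ) ≠ 0)
    (hY : ∀ ξ ∈ Icc 0 r, HasDerivWithinAt Y (transformField X A (ξ, Y ξ)) (Icc 0 r) ξ) :
    EnvelopesCircles X Y (Icc 0 r) ∧
    ∀ ξ ∈ Icc 0 r, ‖derivWithin Y (Icc 0 r) ξ‖ - ‖derivWithin X (Icc 0 r) ξ‖ =
      A ξ * ‖Y ξ - X ξ‖ := by
  have dX : ∀ ξ ∈ Icc 0 r, derivWithin X (Icc 0 r) ξ = deriv X ξ := fun ξ hξ =>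
    derivWithin_curve hr hX hξ
  have dY : ∀ ξ ∈ Icc 0 r, derivWithin Y (Icc 0 r) ξ = transformField X A (ξ, Y ξ) := fun ξ hξ =>
    (hY ξ hξ).derivWithin (uniqueDiffOn_Icc hr ξ hξ)
  have nY : ∀ ξ ∈ Icc 0 r, ‖transformField X A (ξ, Y ξ)‖ = ‖deriv X ξ‖ + A ξ * ‖Y ξ - X ξ‖ := by
    intro ξ hξ
    rw [transformField, norm_smul, norm_mirror (sub_ne_zero.2 (hne ξ hξ)), norm_tang (hX' ξ hξ),
      mul_one, Real.norm_of_nonneg (hpos ξ hξ).le]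
  have tY : ∀ ξ ∈ Icc 0 r, ‖transformField X A (ξ, Y ξ)‖⁻¹ • transformField X A (ξ, Y ξ) =
      tang X ξ - (2 * inner ℝ (tang X ξ) (Y ξ - X ξ) / ‖Y ξ - X ξ‖ ^ 2) • (Y ξ - X ξ) := by
    intro ξ hξ
    rw [nY ξ hξ, transformField, inv_smul_smul₀ (hpos ξ hξ).ne']
  have w2 : ∀ ξ ∈ Icc 0 r, ‖Y ξ - X ξ‖ ^ 2 ≠ 0 := fun ξ hξ =>
    pow_ne_zero 2 (norm_ne_zero_iff.2 (sub_ne_zero.2 (hne ξ hξ)))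
  refine ⟨⟨hne, fun ξ hξ => ?_, fun ξ hξ => ?_, fun ξ hξ => ?_, fun ξ hξ => ?_, fun ξ hξ => ?_⟩,
    fun ξ hξ => ?_⟩
  · rw [dX ξ hξ]; exact hX' ξ hξ
  · rw [dY ξ hξ, ← norm_ne_zero_iff, nY ξ hξ]; exact (hpos ξ hξ).ne'
  · rw [dX ξ hξ, dY ξ hξ]
    refine ⟨(‖deriv X ξ‖ + A ξ * ‖Y ξ - X ξ‖) * ‖deriv X ξ‖⁻¹ - 1,
      -((‖deriv X ξ‖ + A ξ * ‖Y ξ - X ξ‖) *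
        (2 * inner ℝ (tang X ξ) (Y ξ - X ξ) / ‖Y ξ - X ξ‖ ^ 2)), ?_⟩
    rw [transformField]
    simp only
    generalize inner ℝ (tang X ξ) (Y ξ - X ξ) = i
    rw [tang]
    module
  · rw [dX ξ hξ, dY ξ hξ, tY ξ hξ]
    change inner ℝ (_ + tang X ξ) _ = _
    have := w2 ξ hξ
    rw [inner_add_left, inner_sub_left, inner_smul_left, real_inner_self_eq_norm_sq, conj_trivial,
      div_mul_cancel₀ _ this]
    ring
  · rw [dX ξ hξ, dY ξ hξ, tY ξ hξ]
    change _ + tang X ξ ≠ 0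
    -- `m` witnesses that the chord is not tangent to `X`. If the sum of unit tangents vanished,
    -- pairing with `m` would give `⟨t, w⟩ = 0`, and then `2t = 0`.
    obtain ⟨m, hm1, hm2⟩ := hind ξ hξ
    have hw := w2 ξ hξ
    generalize Y ξ - X ξ = w at hm2 hw ⊢
    intro h0
    have h1 := congrArg (fun x => inner ℝ m x) h0
    simp only [inner_add_right, inner_sub_right, inner_smul_right, hm1, inner_zero_right] at h1
    have h2 : inner ℝ (tang X ξ) w = 0 := by
      rw [zero_sub, add_zero, neg_eq_zero] at h1
      rcases mul_eq_zero.1 h1 with h | h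
      · rw [div_eq_zero_iff, or_iff_left hw] at h
        linarith
      · exact absurd h hm2
    rw [h2] at h0
    simp only [mul_zero, zero_div, zero_smul, sub_zero] at h0
    have h3 : tang X ξ = 0 := by
      have : (2 : ℝ) • tang X ξ = 0 := by rw [two_smul, h0]
      simpa using this
    have := norm_tang (hX' ξ hξ)
    rw [h3, norm_zero] at this
    exact zero_ne_one this
  · rw [dX ξ hξ, dY ξ hξ, nY ξ hξ]; ring

/-- Uniqueness of the second curve. -/
theorem EnvelopesCircles.eqOn {Y' : ℝ → E n} (hr : 0 < r) (hX : ContDiff ℝ ∞ X)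
    (hAs : ContDiff ℝ ∞ A)
    (hY : ContDiffOn ℝ 1 Y (Icc 0 r)) (hY' : ContDiffOn ℝ 1 Y' (Icc 0 r)) (h0 : Y 0 = Y' 0)
    (h : EnvelopesCircles X Y (Icc 0 r)) (h' : EnvelopesCircles X Y' (Icc 0 r))
    (hA : ∀ ξ ∈ Icc 0 r, ‖derivWithin Y (Icc 0 r) ξ‖ - ‖derivWithin X (Icc 0 r) ξ‖ =
      A ξ * ‖Y ξ - X ξ‖)
    (hA' : ∀ ξ ∈ Icc 0 r, ‖derivWithin Y' (Icc 0 r) ξ‖ - ‖derivWithin X (Icc 0 r) ξ‖ =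
      A ξ * ‖Y' ξ - X ξ‖) : EqOn Y Y' (Icc 0 r) := by
  -- The field is smooth only off the singular set of the equation. Both graphs are compact and
  -- avoid this set, so local Lipschitz continuity becomes uniform on their union, which suffices
  -- for uniqueness.
  let graph : (ℝ → E n) → Set (ℝ × E n) := fun Z => (fun ξ => (ξ, Z ξ)) '' Icc 0 r
  have hcomp : ∀ {Z : ℝ → E n}, ContDiffOn ℝ 1 Z (Icc 0 r) → IsCompact (graph Z) := fun hZ =>
    isCompact_Icc.image_of_continuousOn (continuousOn_id.prodMk hZ.continuousOn)
  have hC : IsCompact (graph Y ∪ graph Y') := (hcomp hY).union (hcomp hY')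
  have hX' : ∀ ξ ∈ Icc 0 r, deriv X ξ ≠ 0 := fun ξ hξ => by
    rw [← derivWithin_curve hr hX hξ]; exact h.immersed ξ hξ
  have hloc : LocallyLipschitzOn (graph Y ∪ graph Y') (transformField X A) := by
    intro p hp
    have hp' : deriv X p.1 ≠ 0 ∧ p.2 ≠ X p.1 := by
      rcases hp with ⟨ξ, hξ, rfl⟩ | ⟨ξ, hξ, rfl⟩
      · exact ⟨hX' ξ hξ, h.ne ξ hξ⟩
      · exact ⟨hX' ξ hξ, h'.ne ξ hξ⟩
    obtain ⟨K, t, ht, hK⟩ := ((contDiffAt_transformField hX hAs hp'.1 hp'.2).of_le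
      (m := 1) (by exact_mod_cast le_top)).exists_lipschitzOnWith
    exact ⟨K, t, mem_nhdsWithin_of_mem_nhds ht, hK⟩
  obtain ⟨K, hK⟩ := hloc.exists_lipschitzOnWith_of_compact hC
  have hder : ∀ {Z : ℝ → E n}, ContDiffOn ℝ 1 Z (Icc 0 r) →
      (∀ ξ ∈ Icc 0 r, derivWithin Z (Icc 0 r) ξ = transformField X A (ξ, Z ξ)) →
      ∀ t ∈ Ico 0 r, HasDerivWithinAt Z (transformField X A (t, Z t)) (Ici t) t := by
    intro Z hZ hd t ht
    have ht' : t ∈ Icc 0 r := ⟨ht.1, ht.2.le⟩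
    rw [← hd t ht']
    exact ((hZ.differentiableOn (by simp) t ht').hasDerivWithinAt).mono_of_mem_nhdsWithin
      (Icc_mem_nhdsGE_of_mem ht)
  refine ODE_solution_unique_of_mem_Icc_right (v := fun t y => transformField X A (t, y))
    (s := fun t => {y | (t, y) ∈ graph Y ∪ graph Y'}) (K := K) (fun t _ y hy z hz => ?_)
    hY.continuousOn (hder hY fun ξ hξ => h.derivWithin_eq hr hX hA hξ)
    (fun t ht => Or.inl ⟨t, ⟨ht.1, ht.2.le⟩, rfl⟩)
    hY'.continuousOn (hder hY' fun ξ hξ => h'.derivWithin_eq hr hX hA' hξ)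
    (fun t ht => Or.inr ⟨t, ⟨ht.1, ht.2.le⟩, rfl⟩) h0
  have := hK hy hz
  rwa [Prod.edist_eq, edist_self, max_eq_right (by simp)] at this

end Transform

end RibPair

end

noncomputable section

namespace RibPair

/-! ### Local existence of frame and second curve, and the equations of the chord -/

section Evolution

variable {n : ℕ}

/-- The vector field whose integral curves consist of the parameter, the frame of `X` and the
second curve. -/
def evolutionField (X : ℝ → E n) (A : ℝ → ℝ) (z : ℝ × (Fin (n + 2) → Mink n) × E n) :
    ℝ × (Fin (n + 2) → Mink n) × E n :=
  (1, fun k => -lor n (z.2.1 k) (deriv (tangentHat X) z.1) • tangentHat X z.1,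
    transformField X A (z.1, z.2.2))

theorem ContDiffAt.lor {F : Type*} [NormedAddCommGroup F] [NormedSpace ℝ F] {u v : F → Mink n}
    {x : F} (hu : ContDiffAt ℝ ∞ u x) (hv : ContDiffAt ℝ ∞ v x) :
    ContDiffAt ℝ ∞ (fun y => RibPair.lor n (u y) (v y)) x := by
  simp only [lor_apply]
  have a1 := hu.fst.inner ℝ hv.fst
  have a2 := hu.snd.fst.mul hv.snd.fst
  have a3 := hu.snd.snd.mul hv.snd.snd
  exact (a1.add a2).sub a3

theorem contDiffAt_evolutionField {X : ℝ → E n} {A : ℝ → ℝ} (hX : ContDiff ℝ ∞ X)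
    (hA : ContDiff ℝ ∞ A) {z : ℝ × (Fin (n + 2) → Mink n) × E n} (h1 : deriv X z.1 ≠ 0)
    (h2 : z.2.2 ≠ X z.1) : ContDiffAt ℝ ∞ (evolutionField X A) z := by
  have t1 : ContDiffAt ℝ ∞ (fun z : ℝ × (Fin (n + 2) → Mink n) × E n => tangentHat X z.1) z :=
    (contDiffAt_tangentHat hX h1).comp z contDiffAt_fst
  have t2 : ContDiffAt ℝ ∞
      (fun z : ℝ × (Fin (n + 2) → Mink n) × E n => deriv (tangentHat X) z.1) z :=
    (contDiffAt_deriv (contDiffAt_tangentHat hX h1)).comp z contDiffAt_fst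
  refine contDiffAt_const.prodMk ((contDiffAt_pi.2 fun k => ?_).prodMk ?_)
  · have t3 : ContDiffAt ℝ ∞ (fun z : ℝ × (Fin (n + 2) → Mink n) × E n => z.2.1 k) z :=
      ((contDiff_apply ℝ (Mink n) k).contDiffAt).comp z contDiffAt_snd.fst
    exact (t3.lor t2).neg.smul t1
  · exact ContDiffAt.comp (g := transformField X A)
      (f := fun z : ℝ × (Fin (n + 2) → Mink n) × E n => (z.1, z.2.2)) z
      (contDiffAt_transformField hX hA (p := (z.1, z.2.2)) h1 h2)
      (contDiffAt_fst.prodMk contDiffAt_snd.snd)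

/-- The frame of the curve `X` and the second curve exist near the initial parameter. -/
theorem exists_evolution {X : ℝ → E n} {A : ℝ → ℝ} (hX : ContDiff ℝ ∞ X) (hA : ContDiff ℝ ∞ A)
    (hX0 : deriv X 0 ≠ 0) {Xp0 : E n} (hne : Xp0 ≠ X 0)
    (hspeed : 0 < ‖deriv X 0‖ + A 0 * ‖Xp0 - X 0‖) (V₀ : Fin (n + 2) → Mink n) {s : ℝ}
    (hs : 0 < s * inner ℝ (Xp0 - X 0) (V₀ 1).1) :
    ∃ R : ℝ, 0 < R ∧ ∃ (V : Fin (n + 2) → ℝ → Mink n) (Y : ℝ → E n),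
      (∀ k, V k 0 = V₀ k) ∧ Y 0 = Xp0 ∧
      (∀ k, ContDiffOn ℝ ∞ (V k) (Ioo (-R) R)) ∧ ContDiffOn ℝ ∞ Y (Ioo (-R) R) ∧
      ∀ t ∈ Ioo (-R) R,
        (∀ k, HasDerivAt (V k) (-lor n (V k t) (deriv (tangentHat X) t) • tangentHat X t) t) ∧
        HasDerivAt Y (transformField X A (t, Y t)) t ∧
        deriv X t ≠ 0 ∧ Y t ≠ X t ∧ 0 < ‖deriv X t‖ + A t * ‖Y t - X t‖ ∧
        0 < s * inner ℝ (Y t - X t) (V 1 t).1 := by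
  -- The parameter is itself a coordinate, with derivative `1`. This makes the system autonomous;
  -- `hτ` then identifies that coordinate with `t`.
  obtain ⟨y, hy0, δ, hδ, hy⟩ := ((contDiffAt_evolutionField hX hA (z := (0, V₀, Xp0)) hX0 hne).of_le
    (m := 1) (by exact_mod_cast le_top)
    ).exists_forall_mem_closedBall_exists_eq_forall_mem_Ioo_hasDerivAt₀ 0
  simp only [zero_sub, zero_add] at hy
  have h0 : (0 : ℝ) ∈ Ioo (-δ) δ := ⟨by linarith, hδ⟩
  have hτ : ∀ t ∈ Ioo (-δ) δ, (y t).1 = t := by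
    intro t ht
    have hd : ∀ t ∈ Ioo (-δ) δ, HasDerivAt (fun t => (y t).1 - t) 0 t := fun t ht => by
      exact ((HasDerivAt.fst' (hy t ht)).sub (hasDerivAt_id t)).congr_deriv (sub_self 1)
    have := (convex_Ioo (-δ) δ).is_const_of_fderivWithin_eq_zero (𝕜 := ℝ)
      (f := fun t => (y t).1 - t)
      (fun t ht => (hd t ht).differentiableAt.differentiableWithinAt) (fun t ht => by
        rw [(hd t ht).hasFDerivAt.hasFDerivWithinAt.fderivWithin
          (isOpen_Ioo.uniqueDiffWithinAt ht)]
        ext; simp) ht h0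
    simp only [hy0] at this
    linarith
  have hc : ContinuousAt y 0 := (hy 0 h0).continuousAt
  have cV : ContinuousAt (fun t => ((y t).2.1 1).1) 0 := by fun_prop
  have cY : ContinuousAt (fun t => (y t).2.2) 0 := by fun_prop
  have cX : ContinuousAt X 0 := hX.continuous.continuousAt
  have cX' : ContinuousAt (deriv X) 0 := (contDiff_deriv hX).continuous.continuousAt
  have cA : ContinuousAt A 0 := hA.continuous.continuousAt
  -- These conditions are open and hold at `0`, so they persist nearby. The last one keeps the chord
  -- off the tangent direction.
  have e1 : ∀ᶠ t in nhds (0 : ℝ), deriv X t ≠ 0 := cX'.eventually_ne hX0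
  have e2 : ∀ᶠ t in nhds (0 : ℝ), (y t).2.2 - X t ≠ 0 :=
    (cY.sub cX).eventually_ne (by simpa [hy0, sub_eq_zero] using hne)
  have e3 : ∀ᶠ t in nhds (0 : ℝ), 0 < ‖deriv X t‖ + A t * ‖(y t).2.2 - X t‖ :=
    (cX'.norm.add (cA.mul (cY.sub cX).norm)).eventually_const_lt (by simpa [hy0] using hspeed)
  have e4 : ∀ᶠ t in nhds (0 : ℝ), 0 < s * inner ℝ ((y t).2.2 - X t) ((y t).2.1 1).1 :=
    (continuousAt_const.mul ((cY.sub cX).inner cV)).eventually_const_lt (by simpa [hy0] using hs)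
  obtain ⟨η, hη, hball⟩ := Metric.eventually_nhds_iff_ball.1 (e1.and (e2.and (e3.and e4)))
  rw [Real.ball_eq_Ioo, zero_sub, zero_add] at hball
  have hR : 0 < min δ η := lt_min hδ hη
  have hsub : ∀ t ∈ Ioo (-min δ η) (min δ η), t ∈ Ioo (-δ) δ ∧ t ∈ Ioo (-η) η := fun t ht =>
    ⟨⟨by linarith [ht.1, min_le_left δ η], by linarith [ht.2, min_le_left δ η]⟩,
     ⟨by linarith [ht.1, min_le_right δ η], by linarith [ht.2, min_le_right δ η]⟩⟩
  have hsm : ContDiffOn ℝ ∞ y (Ioo (-min δ η) (min δ η)) := by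
    refine contDiffOn_of_integralCurve (v := evolutionField X A)
      (U := {z | deriv X z.1 ≠ 0 ∧ z.2.2 ≠ X z.1})
      (fun z hz => (contDiffAt_evolutionField hX hA hz.1 hz.2).contDiffWithinAt) isOpen_Ioo
      (fun t ht => hy t (hsub t ht).1) fun t ht => ?_
    have hb := hball t (hsub t ht).2
    change deriv X (y t).1 ≠ 0 ∧ (y t).2.2 ≠ X (y t).1
    rw [hτ t (hsub t ht).1]
    exact ⟨hb.1, sub_ne_zero.1 hb.2.1⟩
  refine ⟨min δ η, hR, fun k t => (y t).2.1 k, fun t => (y t).2.2, fun k => by simp [hy0],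
    by simp [hy0], fun k => ?_, hsm.snd.snd, fun t ht => ?_⟩
  · exact contDiffOn_pi.1 hsm.snd.fst k
  · have hb := hball t (hsub t ht).2
    have hd := hy t (hsub t ht).1
    have h2 := ((ContinuousLinearMap.snd ℝ ℝ ((Fin (n + 2) → Mink n) × E n)).hasFDerivAt.comp_hasDerivAt
      t hd)
    have h3 := (ContinuousLinearMap.snd ℝ (Fin (n + 2) → Mink n) (E n)).hasFDerivAt.comp_hasDerivAt
      t h2
    have h4 := hasDerivAt_pi.1 (HasDerivAt.fst' h2)
    refine ⟨fun k => (h4 k).congr_deriv ?_, h3.congr_deriv ?_, hb.1, sub_ne_zero.1 hb.2.1, hb.2.2⟩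
    · simp [evolutionField, hτ t (hsub t ht).1]
    · simp [evolutionField, hτ t (hsub t ht).1]

/-- The direction of the chord of the pair `(X, Y)`. -/
def chord (X Y : ℝ → E n) (ξ : ℝ) : E n := ‖Y ξ - X ξ‖⁻¹ • (Y ξ - X ξ)

/-- The differential equations of the direction and of the length of the chord. -/
theorem hasDerivAt_chord {X Y : ℝ → E n} {A : ℝ → ℝ} (hX : ContDiff ℝ ∞ X) {ξ : ℝ}
    (h1 : deriv X ξ ≠ 0) (h2 : Y ξ ≠ X ξ) (hY : HasDerivAt Y (transformField X A (ξ, Y ξ)) ξ) :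
    HasDerivAt (chord X Y)
      (A ξ • tang X ξ - (A ξ * inner ℝ (tang X ξ) (chord X Y ξ)) • chord X Y ξ) ξ ∧
    HasDerivAt (fun ξ => ‖Y ξ - X ξ‖) (-(2 * ‖deriv X ξ‖ * inner ℝ (tang X ξ) (chord X Y ξ))
      - A ξ * inner ℝ (tang X ξ) (chord X Y ξ) * ‖Y ξ - X ξ‖) ξ := by
  have hw : Y ξ - X ξ ≠ 0 := sub_ne_zero.2 h2
  have hc : ‖Y ξ - X ξ‖ ≠ 0 := norm_ne_zero_iff.2 hw
  have hX' := (hX.differentiable (by simp) ξ).hasDerivAt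
  rw [← speed_smul_tang h1] at hX'
  have hW := hY.sub hX'
  have hsq := hW.norm_sq
  have hn : HasDerivAt (fun ξ => ‖Y ξ - X ξ‖) (-(2 * ‖deriv X ξ‖ * inner ℝ (tang X ξ) (chord X Y ξ))
      - A ξ * inner ℝ (tang X ξ) (chord X Y ξ) * ‖Y ξ - X ξ‖) ξ := by
    have := hsq.sqrt (by simpa using hw)
    simp only [Pi.sub_apply, Real.sqrt_sq (norm_nonneg _)] at this
    refine this.congr_deriv ?_
    simp only [transformField, chord]
    generalize Y ξ - X ξ = w at hc
    simp only [inner_sub_right, inner_smul_right]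
    rw [real_inner_self_eq_norm_sq, real_inner_comm (tang X ξ) w]
    field_simp
    ring
  refine ⟨?_, hn⟩
  refine ((hn.inv hc).smul hW).congr_deriv ?_
  simp only [transformField, chord, inner_smul_right, Pi.sub_apply, Pi.inv_apply]
  generalize inner ℝ (tang X ξ) (Y ξ - X ξ) = i
  match_scalars <;> field_simp <;> ring

end Evolution

end RibPair

end

noncomputable section

namespace RibPair

/-! ### Convergence of the discrete pairs -/

section Convergence

variable {n : ℕ}

/-- Smooth functions that describe, on `[0, r]`, a curve `X` with speed `h`, frame `f` and rotation
coefficients `β`, and its transform in the direction `d` at the distance `c`. -/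
structure ChordSystem (r : ℝ) (X : ℝ → E n) (A : ℝ → ℝ) (f : Fin (n + 2) → ℝ → E n)
    (β : Fin (n + 2) → ℝ → ℝ) (h : ℝ → ℝ) (d : ℝ → E n) (c : ℝ → ℝ) : Prop where
  smooth_X : ContDiff ℝ ∞ X
  smooth_A : ContDiff ℝ ∞ A
  smooth_f : ∀ k, ContDiff ℝ ∞ (f k)
  smooth_β : ∀ k, ContDiff ℝ ∞ (β k)
  smooth_h : ContDiff ℝ ∞ h
  smooth_d : ContDiff ℝ ∞ d
  smooth_c : ContDiff ℝ ∞ c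
  deriv_X : ∀ ξ ∈ Icc 0 r, deriv X ξ = h ξ • f 0 ξ
  deriv_tang : ∀ ξ ∈ Icc 0 r, deriv (f 0) ξ = -∑ k ∈ Finset.univ.erase 0, β k ξ • f k ξ
  deriv_f : ∀ k, k ≠ 0 → ∀ ξ ∈ Icc 0 r, deriv (f k) ξ = β k ξ • f 0 ξ
  deriv_d : ∀ ξ ∈ Icc 0 r, deriv d ξ = A ξ • f 0 ξ - (A ξ * inner ℝ (f 0 ξ) (d ξ)) • d ξ
  deriv_c : ∀ ξ ∈ Icc 0 r, deriv c ξ =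
    -(2 * h ξ * inner ℝ (f 0 ξ) (d ξ)) - A ξ * inner ℝ (f 0 ξ) (d ξ) * c ξ
  norm_d : ∀ ξ ∈ Icc 0 r, ‖d ξ‖ = 1

variable {r ε₁ : ℝ} {X : ℝ → E n} {A : ℝ → ℝ} {f : Fin (n + 2) → ℝ → E n}
  {β : Fin (n + 2) → ℝ → ℝ} {h : ℝ → ℝ} {d : ℝ → E n} {c : ℝ → ℝ} {S₀ : DState n}

/-- The data are admissible for small mesh sizes. -/
theorem ChordSystem.exists_admissible (H : ChordSystem r X A f β h d c)
    (hb : ∑ k, S₀.b k * S₀.b k = 1) :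
    ∃ ε₁ : ℝ, 0 < ε₁ ∧ ∀ ε, 0 < ε → ε < ε₁ → Admissible r ε S₀ β A := by
  obtain ⟨K, hK⟩ := isCompact_Icc.exists_bound_of_continuousOn (s := Icc 0 r)
    H.smooth_A.continuous.continuousOn
  obtain ⟨M, hM⟩ := isCompact_Icc.exists_bound_of_continuousOn (s := Icc 0 r)
    (f := fun ξ => ∑ k ∈ Finset.univ.erase 0, β k ξ ^ 2)
    (continuous_finsetSum _ fun k _ => (H.smooth_β k).continuous.pow 2).continuousOn
  refine ⟨min 1 (1 / (8 * (1 + |K| + |M|))), by positivity, fun ε e0 e1 => ?_⟩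
  have h1 : ε < 1 := e1.trans_le (min_le_left _ _)
  have h2 : ε * (8 * (1 + |K| + |M|)) ≤ 1 :=
    ((lt_div_iff₀ (by positivity)).1 (e1.trans_le (min_le_right _ _))).le
  have mem : ∀ j : ℕ, j * ε ≤ r → (j : ℝ) * ε ∈ Icc 0 r := fun j hj => ⟨by positivity, hj⟩
  have hK0 := abs_nonneg K
  have hM0 := abs_nonneg M
  refine ⟨e0, fun j hj => ?_, fun j hj => ?_, hb⟩
  · have h3 := (le_abs_self _).trans ((hM _ (mem j hj)).trans (le_abs_self M))
    rw [radicand]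
    have h4 : ε * |M| ≤ 1 / 8 := by nlinarith
    have h5 : ε ^ 2 / 4 * ∑ k ∈ Finset.univ.erase 0, β k (j * ε) ^ 2 ≤ ε ^ 2 / 4 * |M| := by
      gcongr
    nlinarith
  · have h3 := (hK _ (mem j hj)).trans (le_abs_self K)
    rw [Real.norm_eq_abs] at h3
    rw [abs_mul, abs_of_pos e0]
    nlinarith [mul_le_mul_of_nonneg_left h3 e0.le, mul_nonneg e0.le hM0]

/-- The initial values of the discrete evolution agree with those of the smooth functions. -/
structure DState.StartsAt (S₀ : DState n) (X : ℝ → E n) (f : Fin (n + 2) → ℝ → E n) (d : ℝ → E n)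
    (c : ℝ → ℝ) : Prop where
  point : point S₀.ψ = X 0
  frame : ∀ k, (act S₀.ψ (e k)).1 = f k 0
  dir : edgeDir S₀.ψ 1 S₀.b = d 0
  length : S₀.h = c 0

theorem ChordSystem.frame_error (H : ChordSystem r X A f β h d c)
    (hadm : ∀ ε, 0 < ε → ε < ε₁ → Admissible r ε S₀ β A) (hS : S₀.StartsAt X f d c) (l : ℕ) :
    UBdd r ε₁ l 0 (fun ε j => ε⁻¹ • ((fun k => (act (dseq S₀ h β A ε j).ψ (e k)).1)
      - fun k => f k (j * ε))) ∧
    UBdd r ε₁ l 0 (fun ε j => ε⁻¹ • (edgeDir (dseq S₀ h β A ε j).ψ 0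
      (coef ε fun k => β k (j * ε)) - f 0 (j * ε))) := by
  refine frame_convergence (o := 0) H.smooth_β H.smooth_f H.deriv_tang H.deriv_f
    (F := fun ε j k => (act (dseq S₀ h β A ε j).ψ (e k)).1)
    (N := fun ε j => coef ε (fun k => β k (j * ε)) 0)
    (fun ε e0 e1 j hj => ⟨(hadm ε e0 e1).rad j hj, if_pos rfl⟩) (fun ε e0 e1 j hj => ?_)
    (fun ε e0 e1 j hj => ?_) (fun ε e0 e1 k => hS.frame k) l
  · rw [edgeDir_eq, Finset.smul_sum]
    congr 1
    refine Finset.sum_congr rfl fun k hk => ?_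
    rw [coef, if_neg (Finset.ne_of_mem_erase hk), smul_smul]
  · have hj' : (j : ℝ) * ε ≤ r := by nlinarith
    simp only [(hadm ε e0 e1).ψ_succ hj', act_edge_mul_e]
    refine ⟨by rw [if_pos trivial], fun k hk => ?_⟩
    rw [if_neg hk]
    congr 2
    rw [coef, if_neg hk]
    ring

theorem ChordSystem.point_error (H : ChordSystem r X A f β h d c)
    (hadm : ∀ ε, 0 < ε → ε < ε₁ → Admissible r ε S₀ β A) (hS : S₀.StartsAt X f d c) (l : ℕ) :
    UBdd r ε₁ l 0 (fun ε j => ε⁻¹ • (point (dseq S₀ h β A ε j).ψ - X (j * ε))) := by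
  refine curve_convergence H.smooth_X H.smooth_h H.deriv_X (fun ε e0 e1 j hj => ?_)
    (fun ε e0 e1 => hS.point) (fun l => (H.frame_error hadm hS l).2) l
  have hj' : (j : ℝ) * ε ≤ r := by nlinarith
  rw [(hadm ε e0 e1).ψ_succ hj', point_edge_mul]
  module

/-- Since `rho` equals `-εA - 2⟨T,D⟩`, the coefficients `b` enter the evolution of direction and
length only through `D`, and `nu² = 1 + ε(2A⟨T,D⟩ + εA²)`. This is the recursion of
`chord_convergence`. -/
theorem ChordSystem.chord_error (H : ChordSystem r X A f β h d c)
    (hadm : ∀ ε, 0 < ε → ε < ε₁ → Admissible r ε S₀ β A) (hS : S₀.StartsAt X f d c) (l : ℕ) :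
    UBdd r ε₁ l 0 (fun ε j => ε⁻¹ • (edgeDir (dseq S₀ h β A ε j).ψ 1 (dseq S₀ h β A ε j).b
      - d (j * ε))) ∧
    UBdd r ε₁ l 0 (fun ε j => ε⁻¹ • ((dseq S₀ h β A ε j).h - c (j * ε))) := by
  have hrho : ∀ ε (j : ℕ), rho (coef ε fun k => β k (j * ε)) (dseq S₀ h β A ε j).b (ε * A (j * ε)) =
      -(ε * A (j * ε)) - 2 * inner ℝ (edgeDir (dseq S₀ h β A ε j).ψ 0
      (coef ε fun k => β k (j * ε))) (edgeDir (dseq S₀ h β A ε j).ψ 1 (dseq S₀ h β A ε j).b) := by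
    intro ε j
    rw [rho, inner_edgeDir_eq _ zero_ne_one]
  refine chord_convergence H.smooth_A H.smooth_h (H.smooth_f 0) H.smooth_d H.smooth_c H.deriv_d
    H.deriv_c (T := fun ε j => edgeDir (dseq S₀ h β A ε j).ψ 0 (coef ε fun k => β k (j * ε)))
    (D := fun ε j => edgeDir (dseq S₀ h β A ε j).ψ 1 (dseq S₀ h β A ε j).b)
    (C := fun ε j => (dseq S₀ h β A ε j).h)
    (N := fun ε j => nu (coef ε fun k => β k (j * ε)) (dseq S₀ h β A ε j).b (ε * A (j * ε)))
    (fun ε e0 e1 j hj => ?_) (fun ε e0 e1 j hj => norm_edgeDir _ _ _ ((hadm ε e0 e1).b_sq hj))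
    (fun ε e0 e1 j hj => ?_) (fun ε e0 e1 j hj => ?_) (fun ε e0 e1 => hS.dir) (fun ε e0 e1 => hS.length)
    (fun l => (H.frame_error hadm hS l).2) l
  · have h1 := ((hadm ε e0 e1).nu_spec (H1 := h) hj).1
    have h2 : ∀ i : ℝ, 1 - (-(ε * A (j * ε)) - 2 * i) * (ε * A (j * ε)) =
        1 + ε * (2 * A (j * ε) * i + ε * A (j * ε) ^ 2) := fun i => by ring
    rw [hrho, h2] at h1
    refine ⟨h1, ?_⟩
    rw [nu, hrho, h2]
  · have hj' : (j : ℝ) * ε ≤ r := by nlinarith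
    simp only [(hadm ε e0 e1).ψ_succ hj']
    exact edgeDir_step _ ((hadm ε e0 e1).coef_sq hj') ((hadm ε e0 e1).b_succ hj') (rho_add _ _ _)
  · have hj' : (j : ℝ) * ε ≤ r := by nlinarith
    rw [(hadm ε e0 e1).h_succ hj', hrho]
    ring

/-- The second point is the first plus length times direction, so its error is the first error plus
`(C - c) D + c (D - d)`. -/
theorem ChordSystem.second_point_error (H : ChordSystem r X A f β h d c)
    (hadm : ∀ ε, 0 < ε → ε < ε₁ → Admissible r ε S₀ β A) (hS : S₀.StartsAt X f d c) (l : ℕ) :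
    UBdd r ε₁ l 0 (fun ε j => ε⁻¹ • (point ((dfields S₀ h β A ε).ψp j)
      - (X (j * ε) + c (j * ε) • d (j * ε)))) := by
  have hD := (H.chord_error hadm hS l).1
  have hC := (H.chord_error hadm hS l).2
  have bD : UBdd r ε₁ l 0 fun ε j => edgeDir (dseq S₀ h β A ε j).ψ 1 (dseq S₀ h β A ε j).b :=
    ((UBdd.of_smooth H.smooth_d).add (UBdd.mesh.smul hD)).congr
      fun ε e0 e1 j _ => by rw [smul_inv_smul₀ e0.ne']; abel
  refine (((H.point_error hadm hS l).add (hC.smul bD)).add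
    ((UBdd.of_smooth H.smooth_c).smul hD)).congr fun ε e0 e1 j hj => ?_
  have hj' : (j : ℝ) * ε ≤ r := by simpa using hj
  simp only [dfields]
  rw [edgeOr_eq _ _ ((hadm ε e0 e1).b_sq hj'), point_edge_mul, smul_eq_mul]
  module

/-- The component `b_2` keeps its sign for small mesh sizes. -/
theorem ChordSystem.exists_sign (H : ChordSystem r X A f β h d c)
    (hadm : ∀ ε, 0 < ε → ε < ε₁ → Admissible r ε S₀ β A) (hS : S₀.StartsAt X f d c) {s : ℝ} (hs : s * s = 1)
    (hpos : ∀ ξ ∈ Icc 0 r, 0 < s * inner ℝ (d ξ) (f 1 ξ)) (hr : 0 ≤ r) :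
    ∃ ε₂ : ℝ, 0 < ε₂ ∧ ∀ ε, 0 < ε → ε < ε₁ → ε < ε₂ → ∀ j : ℕ, j * ε ≤ r →
      0 < s * (dseq S₀ h β A ε j).b 1 := by
  obtain ⟨K, hK⟩ := (H.chord_error hadm hS 0).1
  obtain ⟨M, hM⟩ := ((H.frame_error hadm hS 0).1).proj 1
  obtain ⟨ξ₀, hξ₀, hmin⟩ := isCompact_Icc.exists_isMinOn (s := Icc 0 r) ⟨0, le_refl 0, hr⟩
    (f := fun ξ => s * inner ℝ (d ξ) (f 1 ξ))
    (continuous_const.mul (H.smooth_d.continuous.inner (H.smooth_f 1).continuous)).continuousOn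
  have hc := hpos ξ₀ hξ₀
  set c₀ := s * inner ℝ (d ξ₀) (f 1 ξ₀)
  -- `b_2` is `⟨D, v_2⟩`. It differs from `⟨d, f_2⟩` by at most `ε (|K| + |M|)`, while `s⟨d, f_2⟩ ≥
  -- c₀ > 0` by compactness.
  refine ⟨c₀ / (1 + |K| + |M|), by positivity, fun ε e0 e1 e2 j hj => ?_⟩
  have h1 : ε * (1 + |K| + |M|) < c₀ := (lt_div_iff₀ (by positivity)).1 e2
  have h2 := hmin (a := (j : ℝ) * ε) ⟨by positivity, hj⟩
  change c₀ ≤ _ at h2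
  have hK' := (hK ε e0 e1 j (by simpa using hj)).trans (le_abs_self K)
  have hM' := (hM ε e0 e1 j (by simpa using hj)).trans (le_abs_self M)
  simp only [Pi.smul_apply, Pi.sub_apply] at hM'
  rw [norm_smul, norm_inv, Real.norm_of_nonneg e0.le, inv_mul_le_iff₀ e0] at hK' hM'
  rw [← edgeDir_inner_frame (dseq S₀ h β A ε j).ψ 1 (dseq S₀ h β A ε j).b]
  have hF := (orthonormal_frame (dseq S₀ h β A ε j).ψ).1 1
  have hd := H.norm_d (j * ε) ⟨by positivity, hj⟩
  simp only at hF
  generalize edgeDir (dseq S₀ h β A ε j).ψ 1 (dseq S₀ h β A ε j).b = D at *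
  generalize (act (dseq S₀ h β A ε j).ψ (e 1)).1 = F at *
  have h3 : inner ℝ D F = inner ℝ (d (j * ε)) (f 1 (j * ε)) + (inner ℝ (D - d (j * ε)) F
      + inner ℝ (d (j * ε)) (F - f 1 (j * ε))) := by
    rw [inner_sub_left, inner_sub_right]; ring
  have h4 := abs_real_inner_le_norm (D - d (j * ε)) F
  have h5 := abs_real_inner_le_norm (d (j * ε)) (F - f 1 (j * ε))
  rw [hF, mul_one] at h4
  rw [hd, one_mul] at h5
  have hs1 : |s| = 1 := by
    have : |s| * |s| = 1 := by rw [← abs_mul, hs, abs_one]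
    nlinarith [abs_nonneg s]
  have h6 : |s * (inner ℝ (D - d (j * ε)) F + inner ℝ (d (j * ε)) (F - f 1 (j * ε)))| ≤
      ε * |K| + ε * |M| := by
    rw [abs_mul, hs1, one_mul]
    exact (abs_add_le _ _).trans (add_le_add (h4.trans hK') (h5.trans hM'))
  rw [h3, mul_add]
  have := neg_le_of_abs_le h6
  nlinarith

/-- Uniformly bounded relative errors give convergence. -/
theorem OConverges.of_ubdd {u : ℝ → ℕ → E n} {g : ℝ → E n}
    (hu : ∀ l, UBdd r ε₁ l 0 (fun ε j => ε⁻¹ • (u ε j - g (j * ε)))) : OConverges r ε₁ u g := by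
  intro l
  obtain ⟨K, hK⟩ := (hu l).iterate
  refine ⟨K, fun ε e0 e1 _ i hi j hj => ?_⟩
  have h1 := hK ε e0 e1 i hi j (by simpa using hj)
  rw [diffQuot_iterate_smul, norm_smul, norm_inv, Real.norm_of_nonneg e0.le,
    inv_mul_le_iff₀ e0] at h1
  rwa [mul_comm] at h1

end Convergence

end RibPair

end

noncomputable section

namespace RibPair

/-! ### Initial values, and the passage from the smooth pair to the convergence lemmas -/

section Main

variable {n : ℕ} {X : ℝ → E n} {A : ℝ → ℝ} {Ψ : Hinf n} {Xp0 : E n}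

/-- A smooth function on an interval around `0` has a smooth extension from `[0, R / 4]` with the
same derivatives. -/
theorem exists_smooth_extension_deriv {F : Type*} [NormedAddCommGroup F] [NormedSpace ℝ F]
    {f : ℝ → F} {R : ℝ} (hR : 0 < R) (hf : ContDiffOn ℝ ∞ f (Ioo (-R) R)) :
    ∃ g : ℝ → F, ContDiff ℝ ∞ g ∧ (∀ ξ ∈ Icc 0 (R / 4), g ξ = f ξ) ∧
      ∀ ξ ∈ Icc 0 (R / 4), ∀ f' : F, HasDerivAt f f' ξ → deriv g ξ = f' := by
  obtain ⟨g, hg, hfg⟩ := exists_smooth_extension hR hf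
  have hmem : ∀ ξ ∈ Icc 0 (R / 4), ξ ∈ Ioo (-(R / 2)) (R / 2) := fun ξ hξ =>
    ⟨by linarith [hξ.1], by linarith [hξ.2]⟩
  refine ⟨g, hg, fun ξ hξ => (hfg (hmem ξ hξ)).symm, fun ξ hξ f' hf' => ?_⟩
  have : g =ᶠ[nhds ξ] f := by
    filter_upwards [Ioo_mem_nhds (hmem ξ hξ).1 (hmem ξ hξ).2] with t ht using (hfg ht).symm
  exact (hf'.congr_of_eventuallyEq this).deriv

theorem lor_chordHat_act (k : Fin (n + 2)) (x y : E n) :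
    lor n (chordHat x y) (act Ψ (e k)) = inner ℝ (‖y - x‖⁻¹ • (y - x)) (act Ψ (e k)).1 := by
  rw [lor_eq_inner (lor_eInf_eq_zero.2 ?_) (lor_act_eInf (lor_e_eInf k)), chordHat, Prod.smul_fst,
    Prod.fst_sub, lift_fst, lift_fst]
  rw [chordHat, map_smul, map_sub, infPart_lift, infPart_lift, sub_self, smul_zero]

theorem Orthonormal.sum_inner_sq {f : Fin (n + 2) → E n} (hf : Orthonormal ℝ f) (x : E n) :
    ∑ k, inner ℝ (f k) x * inner ℝ (f k) x = ‖x‖ ^ 2 := by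
  rw [← real_inner_self_eq_norm_sq]
  conv_rhs => rw [Orthonormal.expand hf x]
  rw [hf.inner_sum]
  simp

/-- The sign condition on the initial data. -/
theorem initSign_spec (hne : Xp0 ≠ X 0)
    (hD : ∑ k ∈ Finset.univ.erase 1, initB Ψ (X 0) Xp0 k ^ 2 < 4) :
    initSign Ψ (X 0) Xp0 * initSign Ψ (X 0) Xp0 = 1 ∧
    0 < initSign Ψ (X 0) Xp0 * inner ℝ (Xp0 - X 0) (act Ψ (e 1)).1 := by
  have hw : 0 < ‖Xp0 - X 0‖ := norm_pos_iff.2 (sub_ne_zero.2 hne)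
  have h1 := Orthonormal.sum_inner_sq (orthonormal_frame Ψ) (‖Xp0 - X 0‖⁻¹ • (Xp0 - X 0))
  rw [norm_smul, norm_inv, norm_norm, inv_mul_cancel₀ hw.ne', one_pow,
    ← Finset.add_sum_erase _ _ (Finset.mem_univ 1)] at h1
  have h2 : ∑ k ∈ Finset.univ.erase 1, initB Ψ (X 0) Xp0 k ^ 2 =
      4 * ∑ k ∈ Finset.univ.erase 1, inner ℝ (act Ψ (e k)).1 (‖Xp0 - X 0‖⁻¹ • (Xp0 - X 0)) *
        inner ℝ (act Ψ (e k)).1 (‖Xp0 - X 0‖⁻¹ • (Xp0 - X 0)) := by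
    rw [Finset.mul_sum]
    refine Finset.sum_congr rfl fun k _ => ?_
    rw [initB, lor_chordHat_act, real_inner_comm]
    ring
  -- The components of the unit chord in the frame have squares summing to `1`. If the one along
  -- `v_2` vanished, the sum of the `B_{k2}²` would equal `4`.
  have hq : lor n (chordHat (X 0) Xp0) (act Ψ (e 1)) ≠ 0 := by
    intro h0
    rw [lor_chordHat_act, real_inner_comm] at h0
    rw [h0] at h1
    linarith
  have h3 : inner ℝ (Xp0 - X 0) (act Ψ (e 1)).1 =
      ‖Xp0 - X 0‖ * lor n (chordHat (X 0) Xp0) (act Ψ (e 1)) := by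
    rw [lor_chordHat_act, inner_smul_left, conj_trivial, mul_inv_cancel_left₀ hw.ne']
  rw [h3, initSign]
  rcases hq.lt_or_gt with h | h
  · rw [Real.sign_of_neg h]
    exact ⟨by norm_num, by nlinarith⟩
  · rw [Real.sign_of_pos h]
    exact ⟨by norm_num, by nlinarith⟩

/-- The initial values of the discrete evolution. -/
def initState (Ψ : Hinf n) (x y : E n) : DState n where
  ψ := Ψ
  b := flip 1 fun k => -lor n (chordHat x y) (act Ψ (e k))
  h := ‖y - x‖

theorem initState_b_sq {x y : E n} (hne : y ≠ x) :
    ∑ k, (initState Ψ x y).b k * (initState Ψ x y).b k = 1 := by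
  have hw : ‖y - x‖ ≠ 0 := norm_ne_zero_iff.2 (sub_ne_zero.2 hne)
  have h1 := Orthonormal.sum_inner_sq (orthonormal_frame Ψ) (‖y - x‖⁻¹ • (y - x))
  rw [norm_smul, norm_inv, norm_norm, inv_mul_cancel₀ hw, one_pow] at h1
  rw [initState, sum_flip_sq, ← h1]
  refine Finset.sum_congr rfl fun k _ => ?_
  rw [lor_chordHat_act, real_inner_comm]
  ring

/-- The flip in `initState` cancels the one implicit in `edgeDir`, leaving the expansion of the unit
chord in the initial frame. -/
theorem edgeDir_initState (x y : E n) :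
    edgeDir Ψ 1 (initState Ψ x y).b = ‖y - x‖⁻¹ • (y - x) := by
  rw [edgeDir_eq_sum_flip, initState, flip_flip, ← Finset.sum_neg_distrib]
  conv_rhs => rw [Orthonormal.expand (orthonormal_frame Ψ) (‖y - x‖⁻¹ • (y - x))]
  refine Finset.sum_congr rfl fun k _ => ?_
  rw [lor_chordHat_act, real_inner_comm]
  module

theorem initState_b {x y : E n} {k : Fin (n + 2)} (hk : k ≠ 1) :
    2 * (initState Ψ x y).b k = initB Ψ x y k := by
  rw [initState, initB]
  simp only [flip, if_neg hk]
  ring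

/-- The frame, the speed and the chord of a smooth pair extend to a system of smooth functions. -/
theorem exists_chordSystem (hX : ContDiff ℝ ∞ X) (hA : ContDiff ℝ ∞ A) (hΨ : Suited Ψ X) {R : ℝ}
    (hR : 0 < R) {V : Fin (n + 2) → ℝ → Mink n} {Y : ℝ → E n}
    (hV : ∀ k, ContDiffOn ℝ ∞ (V k) (Ioo (-R) R)) (hY : ContDiffOn ℝ ∞ Y (Ioo (-R) R))
    (hV0 : ∀ k, V k 0 = act Ψ (e k))
    (hV' : ∀ t ∈ Ioo (-R) R, ∀ k,
      HasDerivAt (V k) (-lor n (V k t) (deriv (tangentHat X) t) • tangentHat X t) t)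
    (hY' : ∀ t ∈ Ioo (-R) R, HasDerivAt Y (transformField X A (t, Y t)) t)
    (hX' : ∀ t ∈ Ioo (-R) R, deriv X t ≠ 0) (hne : ∀ t ∈ Ioo (-R) R, Y t ≠ X t) :
    ∃ (f : Fin (n + 2) → ℝ → E n) (β : Fin (n + 2) → ℝ → ℝ) (h : ℝ → ℝ) (d : ℝ → E n) (c : ℝ → ℝ),
      ChordSystem (R / 4) X A f β h d c ∧ ∀ ξ ∈ Icc 0 (R / 4),
        (∀ k, f k ξ = curveFrame X V k ξ) ∧
        (∀ k, β k ξ = -lor n (V k ξ) (deriv (tangentHat X) ξ)) ∧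
        h ξ = ‖deriv X ξ‖ ∧ d ξ = chord X Y ξ ∧ c ξ = ‖Y ξ - X ξ‖ := by
  have hI : ∀ ξ ∈ Icc 0 (R / 4), ξ ∈ Ioo (-R) R := fun ξ hξ =>
    ⟨by linarith [hξ.1], by linarith [hξ.2]⟩
  have hFF : FrameFields X Ψ (R / 4) (fun k ξ => -lor n (V k ξ) (deriv (tangentHat X) ξ)) V :=
    fun k _ => ⟨hV0 k, fun ξ hξ => ⟨(hV' ξ (hI ξ hξ) k).hasDerivWithinAt, rfl⟩⟩
  have sW : ContDiffOn ℝ ∞ (fun ξ => Y ξ - X ξ) (Ioo (-R) R) := hY.sub hX.contDiffOn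
  have sc : ContDiffOn ℝ ∞ (fun ξ => ‖Y ξ - X ξ‖) (Ioo (-R) R) :=
    sW.norm ℝ fun ξ hξ => sub_ne_zero.2 (hne ξ hξ)
  have sd : ContDiffOn ℝ ∞ (chord X Y) (Ioo (-R) R) :=
    (sc.inv fun ξ hξ => norm_ne_zero_iff.2 (sub_ne_zero.2 (hne ξ hξ))).smul sW
  have sh : ContDiffOn ℝ ∞ (fun ξ => ‖deriv X ξ‖) (Ioo (-R) R) := fun ξ hξ =>
    (contDiffAt_speed hX (hX' ξ hξ)).contDiffWithinAt
  have sβ : ∀ k, ContDiffOn ℝ ∞ (fun ξ => -lor n (V k ξ) (deriv (tangentHat X) ξ)) (Ioo (-R) R) :=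
    fun k ξ hξ => (((hV k).contDiffAt (Ioo_mem_nhds hξ.1 hξ.2)).lor
      (contDiffAt_deriv (contDiffAt_tangentHat hX (hX' ξ hξ)))).neg.contDiffWithinAt
  have sf : ∀ k, ContDiffOn ℝ ∞ (curveFrame X V k) (Ioo (-R) R) := by
    intro k
    by_cases hk : k = 0
    · have : curveFrame X V k = tang X := funext fun ξ => if_pos hk
      rw [this]
      exact fun ξ hξ => (contDiffAt_tang hX (hX' ξ hξ)).contDiffWithinAt
    · have : curveFrame X V k = fun ξ => (V k ξ).1 := funext fun ξ => if_neg hk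
      rw [this]
      exact (hV k).fst
  -- The convergence lemmas ask for functions smooth on all of `ℝ`, but use their differential
  -- equations only on `[0, R / 4]`, where the extensions keep values and derivatives.
  choose f f1 f2 f3 using fun k => exists_smooth_extension_deriv hR (sf k)
  choose β β1 β2 _ using fun k => exists_smooth_extension_deriv hR (sβ k)
  obtain ⟨h, h1, h2, -⟩ := exists_smooth_extension_deriv hR sh
  obtain ⟨d, d1, d2, d3⟩ := exists_smooth_extension_deriv hR sd
  obtain ⟨c, c1, c2, c3⟩ := exists_smooth_extension_deriv hR sc
  have hX'' : ∀ ξ ∈ Icc 0 (R / 4), deriv X ξ ≠ 0 := fun ξ hξ => hX' ξ (hI ξ hξ)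
  have hf0 : ∀ ξ ∈ Icc 0 (R / 4), f 0 ξ = tang X ξ := fun ξ hξ => by
    rw [f2 0 ξ hξ, curveFrame, if_pos rfl]
  refine ⟨f, β, h, d, c, ⟨hX, hA, f1, β1, h1, d1, c1, fun ξ hξ => ?_, fun ξ hξ => ?_,
    fun k hk ξ hξ => ?_, fun ξ hξ => ?_, fun ξ hξ => ?_, fun ξ hξ => ?_⟩,
    fun ξ hξ => ⟨fun k => f2 k ξ hξ, fun k => β2 k ξ hξ, h2 ξ hξ, d2 ξ hξ, c2 ξ hξ⟩⟩
  · rw [h2 ξ hξ, hf0 ξ hξ, speed_smul_tang (hX'' ξ hξ)]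
  · have h0 : curveFrame X V 0 = tang X := funext fun ξ => if_pos rfl
    refine f3 0 ξ hξ _ ?_
    rw [h0]
    refine (hasDerivAt_tang hX (hX'' ξ hξ)).congr_deriv ?_
    rw [hFF.deriv_tang hX hX'' hΨ hξ]
    simp only [f2 _ ξ hξ, β2 _ ξ hξ]
  · have h0 : curveFrame X V k = fun ξ => (V k ξ).1 := funext fun ξ => if_neg hk
    refine f3 k ξ hξ _ ?_
    rw [h0, hf0 ξ hξ, β2 k ξ hξ, ← tangentHat_fst hX]
    exact HasDerivAt.fst' (hV' ξ (hI ξ hξ) k)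
  · refine d3 ξ hξ _ ?_
    rw [hf0 ξ hξ, d2 ξ hξ]
    exact (hasDerivAt_chord hX (hX'' ξ hξ) (hne ξ (hI ξ hξ)) (hY' ξ (hI ξ hξ))).1
  · refine c3 ξ hξ _ ?_
    rw [hf0 ξ hξ, d2 ξ hξ, h2 ξ hξ, c2 ξ hξ]
    exact (hasDerivAt_chord hX (hX'' ξ hξ) (hne ξ (hI ξ hξ)) (hY' ξ (hI ξ hξ))).2
  · rw [d2 ξ hξ, chord, norm_smul, norm_inv, norm_norm,
      inv_mul_cancel₀ (norm_ne_zero_iff.2 (sub_ne_zero.2 (hne ξ (hI ξ hξ))))]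

end Main

end RibPair

end

theorem mainTheorem10 (n : ℕ) (X : ℝ → E n) (A : ℝ → ℝ) (Xp0 : E n) (Ψ : Hinf n)
    (hX : ContDiff ℝ ∞ X) (hA : ContDiff ℝ ∞ A)
    (hX0 : deriv X 0 ≠ 0) (hne : Xp0 ≠ X 0)
    (hspeed : 0 < ‖deriv X 0‖ + A 0 * ‖Xp0 - X 0‖)
    (hΨ : Suited Ψ X)
    (hD : ∑ k ∈ Finset.univ.erase 1, initB Ψ (X 0) Xp0 k ^ 2 < 4) :
    ∃ r : ℝ, 0 < r ∧ ∃ Xp : ℝ → E n,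
      -- the enveloping curve: existence
      (ContDiffOn ℝ ∞ Xp (Set.Icc 0 r) ∧ Xp 0 = Xp0 ∧ EnvelopesCircles X Xp (Set.Icc 0 r) ∧
        ∀ ξ ∈ Set.Icc 0 r, ‖derivWithin Xp (Set.Icc 0 r) ξ‖ - ‖derivWithin X (Set.Icc 0 r) ξ‖ =
          A ξ * ‖Xp ξ - X ξ‖) ∧
      -- uniqueness, even among curves of class C^1
      (∀ Y : ℝ → E n, ContDiffOn ℝ 1 Y (Set.Icc 0 r) → Y 0 = Xp0 →
        EnvelopesCircles X Y (Set.Icc 0 r) →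
        (∀ ξ ∈ Set.Icc 0 r, ‖derivWithin Y (Set.Icc 0 r) ξ‖ - ‖derivWithin X (Set.Icc 0 r) ξ‖ =
          A ξ * ‖Y ξ - X ξ‖) →
        Set.EqOn Y Xp (Set.Icc 0 r)) ∧
      -- the rotation coefficients can be read off the curve X
      (∃ β : Fin (n + 2) → ℝ → ℝ, ReadOff X Ψ r β) ∧
      -- the discrete pairs built from them exist, are unique, and converge
      (∀ β : Fin (n + 2) → ℝ → ℝ, ReadOff X Ψ r β →
        ∃ ε₁ : ℝ, 0 < ε₁ ∧ ∃ S : ℝ → Fields n,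
          (∀ ε : ℝ, 0 < ε → ε < ε₁ →
            IsGoursatSolution (initSign Ψ (X 0) Xp0) ε r Ψ (fun ξ => ‖deriv X ξ‖) β A
              ‖Xp0 - X 0‖ (initB Ψ (X 0) Xp0) (S ε) ∧
            ∀ T : Fields n,
              IsGoursatSolution (initSign Ψ (X 0) Xp0) ε r Ψ (fun ξ => ‖deriv X ξ‖) β A
                ‖Xp0 - X 0‖ (initB Ψ (X 0) Xp0) T → AgreeOn ε r T (S ε)) ∧
          OConverges r ε₁ (fun ε j => point ((S ε).ψ j)) X ∧
          OConverges r ε₁ (fun ε j => point ((S ε).ψp j)) Xp) := by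
  obtain ⟨hs, hs0⟩ := initSign_spec hne hD
  obtain ⟨R, hR, V, Y, hV0, hY0, hVs, hYs, hE⟩ :=
    exists_evolution hX hA hX0 hne hspeed (fun k => act Ψ (e k)) hs0
  have hr : 0 < R / 4 := by linarith
  have hI : ∀ ξ ∈ Icc 0 (R / 4), ξ ∈ Ioo (-R) R := fun ξ hξ =>
    ⟨by linarith [hξ.1], by linarith [hξ.2]⟩
  have hX' : ∀ ξ ∈ Icc 0 (R / 4), deriv X ξ ≠ 0 := fun ξ hξ => (hE ξ (hI ξ hξ)).2.2.1
  have hFF : FrameFields X Ψ (R / 4) (fun k ξ => -lor n (V k ξ) (deriv (tangentHat X) ξ)) V :=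
    fun k _ => ⟨hV0 k, fun ξ hξ => ⟨((hE ξ (hI ξ hξ)).1 k).hasDerivWithinAt, rfl⟩⟩
  have hYs' : ContDiffOn ℝ ∞ Y (Icc 0 (R / 4)) := hYs.mono hI
  obtain ⟨henv, hdist⟩ := envelopesCircles_of_hasDerivWithinAt (A := A) hr hX hX'
    (fun ξ hξ => (hE ξ (hI ξ hξ)).2.2.2.1) (fun ξ hξ => (hE ξ (hI ξ hξ)).2.2.2.2.1)
    -- The frame vector `v_2` is the witness against tangency: it is orthogonal to the tangent, and
    -- its product with the chord keeps the sign `s`.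
    (fun ξ hξ => ⟨(V 1 ξ).1, hFF.inner_tang hX hX' hΨ one_ne_zero hξ, fun h0 => by
      have := (hE ξ (hI ξ hξ)).2.2.2.2.2
      rw [real_inner_comm, h0, mul_zero] at this
      exact this.false⟩)
    (fun ξ hξ => (hE ξ (hI ξ hξ)).2.1.hasDerivWithinAt)
  refine ⟨R / 4, hr, Y, ⟨hYs', hY0, henv, hdist⟩, fun Z hZ hZ0 hZe hZd =>
    hZe.eqOn hr hX hA hZ (hYs'.of_le (by exact_mod_cast le_top)) (hZ0.trans hY0.symm) henv hZd hdist,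
    ⟨_, V, hFF⟩, fun β ⟨W, hW⟩ => ?_⟩
  obtain ⟨f, β', h, d, c, H, hH⟩ := exists_chordSystem hX hA hΨ hR hVs hYs hV0
    (fun t ht => (hE t ht).1) (fun t ht => (hE t ht).2.1) (fun t ht => (hE t ht).2.2.1)
    (fun t ht => (hE t ht).2.2.2.1)
  obtain ⟨H1, -, -, H4, H5⟩ := hH 0 ⟨le_refl 0, hr.le⟩
  have hS : (initState Ψ (X 0) Xp0).StartsAt X f d c := by
    refine ⟨hΨ.point_eq, fun k => ?_, ?_, ?_⟩
    · rw [H1, curveFrame]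
      split_ifs with hk
      · rw [hk]; exact hΨ.act_e_zero hX
      · rw [hV0]; rfl
    · rw [H4, chord, hY0]; exact edgeDir_initState _ _
    · rw [H5, hY0]; rfl
  obtain ⟨ε₁, hε₁, hadm⟩ := H.exists_admissible (initState_b_sq (Ψ := Ψ) hne)
  obtain ⟨ε₂, hε₂, hsign⟩ := H.exists_sign hadm hS hs (fun ξ hξ => by
    have h1 := (hE ξ (hI ξ hξ)).2.2.2
    rw [(hH ξ hξ).1, (hH ξ hξ).2.2.2.1, curveFrame, if_neg one_ne_zero, chord, inner_smul_left,
      conj_trivial, mul_left_comm]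
    exact mul_pos (inv_pos.2 (norm_pos_iff.2 (sub_ne_zero.2 h1.1))) h1.2.2) hr.le
  refine ⟨min ε₁ ε₂, lt_min hε₁ hε₂, dfields (initState Ψ (X 0) Xp0) h β' A, fun ε e0 e1 => ?_,
    .of_ubdd fun l => (H.point_error hadm hS l).mono_mesh (min_le_left _ _),
    .of_ubdd fun l => ((H.second_point_error hadm hS l).congr fun ε e0 _ j hj => ?_).mono_mesh
      (min_le_left _ _)⟩
  · have e1' := e1.trans_le (min_le_left _ _)
    have hsol := (hadm ε e0 e1').isGoursatSolution hs
      (hsign ε e0 e1' (e1.trans_le (min_le_right _ _))) (fun k hk => initState_b (Ψ := Ψ) hk)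
    have hmem : ∀ j : ℕ, j * ε ≤ R / 4 → (j : ℝ) * ε ∈ Icc 0 (R / 4) := fun j hj =>
      ⟨by positivity, hj⟩
    -- The solution was built from the smooth extensions `h`, `β'`. On the lattice points of `[0,
    -- r]` they agree with the speed and with any coefficients `β` read off from `X`, since these
    -- are unique.
    have hsol' : IsGoursatSolution (initSign Ψ (X 0) Xp0) ε (R / 4) Ψ (fun ξ => ‖deriv X ξ‖) β A
        ‖Xp0 - X 0‖ (initB Ψ (X 0) Xp0) (dfields (initState Ψ (X 0) Xp0) h β' A ε) :=
      { hsol with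
        init_h1 := fun j hj => (hsol.init_h1 j hj).trans (hH _ (hmem j hj)).2.2.1
        init_β1 := fun j hj k hk => (hsol.init_β1 j hj k hk).trans
          (((hH _ (hmem j hj)).2.1 k).trans (hFF.unique hW hX hX' hΨ hk (hmem j hj))) }
    exact ⟨hsol', fun T hT => hT.agreeOn e0 hsol'⟩
  · obtain ⟨-, -, -, h4, h5⟩ := hH (j * ε) ⟨by positivity, by simpa using hj⟩
    have hw := norm_ne_zero_iff.2 (sub_ne_zero.2 (henv.ne (j * ε) ⟨by positivity, by simpa using hj⟩))
    rw [h4, h5, chord, smul_inv_smul₀ hw, add_sub_cancel]
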